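/- **Setting.** Let $Q=(V,E)$ be a finite quiver, $e:\alpha(e)\to\beta(e)$ for $e\in E$, with a fixed total order on $E$ and a dimension vector $\mathbf d=(d_v)_{v\in V}$; let $q\in\mathbb C^\times$ not be a root of unity and let $\xi:V\to\mathbb C^\times$. Matrices are indexed by $\bigsqcup_v\{1,\dots,d_v\}$, and $R$ is the $R$-matrix $\sum_i q\,E_{ii}\otimes E_{ii}+\sum_{i\ne j}E_{ii}\otimes E_{jj}+(q-q^{-1})\sum_{i>j}E_{ij}\otimes E_{ji}$, where the last sum is over pairs at the same vertex (so $R$ is the standard $R$-matrix at every vertex and the identity between different vertices). $R_{21}$ is its flip, $P_v$ the projection to the block of $v$. * $U=U_q(\mathfrak g^{\mathbf d})=\bigotimes_vU_q(\mathfrak{gl}_{d_v})$ is generated by the entries of an upper triangular $L^+$ and a lower triangular $L^-$, block diagonal, with inverse diagonals, and $L^\pm_1L^\pm_2R=RL^\pm_2L^\pm_1$, $L^-_1L^+_2R=RL^+_2L^-_1$; $\Delta(l^{\pm i}_j)=\sum_kl^{\pm i}_k\otimes l^{\pm k}_j$. $\mathcal C$ is the category of locally finite $U$-modules of type I (all $l^{+i}_i$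 act diagonalizably, with eigenvalues in $q^{\mathbb Z}$), and $\mathbf 1$ is the trivial module. * $\mathcal D_q$ is the algebra generated by matrices $A^e$ (supported in the block $\alpha(e),\beta(e)$) and $D^e$ (supported in the block $\beta(e),\alpha(e)$), $e\in E$, with the relations $R_{21}Y_1RY_2=Y_2R_{21}Y_1R$ for $Y=A^e,D^e$; $D^e_2R^{-1}A^e_1=A^e_1RD^e_2+\Omega$ if $e$ is not a loop ($\Omega$ being the flip restricted to the appropriate blocks); $R_{21}D^e_1RA^e_2=A^e_2R_{21}D^e_1R_{21}^{-1}$ if $e$ is a loop; $Z_1RY_2R^{-1}=RY_2R^{-1}Z_1$ for $Y\in\{A^e,D^e\}$, $Z\in\{A^f,D^f\}$, $e<f$; and localized so that $1+(q-q^{-1})A^eD^e$ and $1+(q-q^{-1})D^eA^e$ (non-loops), respectively $A^e$ and $D^e$ (loops; inverses inside the block), are invertible matrices. $U$ acts on $\mathcal D_q$, compatibly with $\Delta$, by $L^+_0\triangleright Y_1=R_{10}^{-1}Y_1R_{10}$, $L^-_0\triangleright Y_1=R_{01}Y_1R_{01}^{-1}$. * $\mathcal T$ is the reflection equation algebra,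 generated by the entries of an invertible block diagonal matrix $l$ and of its inverse with $R_{21}l_1Rl_2=l_2R_{21}l_1R$. The moment map $\mu:\mathcal T\to\mathcal D_q$ sends $l$ to the product over $e\in E$, in increasing order, of the matrices $M^e=(1+(q-q^{-1})D^eA^e)(1+(q-q^{-1})A^eD^e)^{-1}$ if $e$ is not a loop, and $M^e=1-P_v+D^e(A^e)^{-1}(D^e)^{-1}A^e$ for a loop $e$ at $v$. The character $\operatorname{tr}_\xi:\mathcal T\to\mathbb C$ is $l^i_j\mapsto\xi_v\delta^i_j$ for $i$ at the vertex $v$, and $\mathcal I_\xi=\ker\operatorname{tr}_\xi$. * $\mathcal A^\xi_{\mathbf d}(Q)=\operatorname{Hom}_{\mathcal C}\bigl(\mathbf 1,\ \mathcal D_q/\mathcal D_q\,\mu(\mathcal I_\xi)\bigr)$, the algebra of $U$-invariants of $\mathcal D_q/\mathcal D_q\mu(\mathcal I_\xi)$ with the product $[b][b']=[bb']$. * $\mathcal D_q\text{-mod}_{\mathcal C}$ is the category of equivariant $\mathcal D_q$-modules in $\mathcal C$: objects $M$ of $\mathcal C$ with an action of $\mathcal D_q$ whose structure map $\mathcal D_q\otimes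 M\to M$ is $U$-linear, and on which the moment map, shifted by $\operatorname{tr}_\xi$, gives the action of $U$, that is, $\sum_k\mu(l^i_k)\,l^{-k}_j\,m=\xi_v\,l^{+i}_j\,m$ for all $m\in M$ and all $i,j$ ($i$ at the vertex $v$). **Theorem.** The functor $$\mathbb H:\mathcal D_q\text{-mod}_{\mathcal C}\to\mathcal A^\xi_{\mathbf d}(Q)\text{-mod},\qquad M\mapsto\operatorname{Hom}_{\mathcal C}(\mathbf 1,M)$$ (the invariants of $M$, on which $[b]$ acts by $m\mapsto bm$) is essentially surjective. Its kernel $\operatorname{Ker}\mathbb H$ consists of the aspherical modules, those whose only invariant is $0$; it is a Serre subcategory, $\mathbb H$ inverts all morphisms whose kernel and cokernel are aspherical, and the induced functor $$\mathcal D_q\text{-mod}_{\mathcal C}/\operatorname{Ker}\mathbb H\to\mathcal A^\xi_{\mathbf d}(Q)\text{-mod}$$ from the Serre quotient category is an equivalence of categories. -/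

import Mathlib

set_option linter.unusedSectionVars false
set_option linter.unusedSimpArgs false

universe u

namespace QuiverQuantization

/-- A quiver with vertex set `V` and edge set `E` (with tail and head maps `α`, `β`), together with
a dimension vector. -/
structure DimQuiver (V E : Type u) where
  α : E → V
  β : E → V
  dim : V → ℕ

/-- The disjoint union over the vertices `v` of the index sets `{1, …, d_v}`; it indexes the
standard basis of `⨁ v, ℂ ^ (d_v)`. -/
abbrev DimQuiver.Idx {V E : Type u} (Q : DimQuiver V E) : Type u := Σ v : V, Fin (Q.dim v)

section Slots

variable {n S : Type*} [Fintype n] [DecidableEq n] [Ring S]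

/-- `X ↦ X ⊗ 1`. -/
def slot₁ : Matrix n n S →+* Matrix (n × n) (n × n) S :=
  (Matrix.blockDiagonalRingHom n n S).comp (Pi.constRingHom n (Matrix n n S))

/-- `X ↦ 1 ⊗ X`. -/
def slot₂ : Matrix n n S →+* Matrix (n × n) (n × n) S :=
  RingHom.comp (Matrix.reindexRingEquiv S (Equiv.prodComm n n)).toRingHom slot₁

/-- `X ↦ X₁₂`, acting on the first two of three tensor factors. -/
def slot₁₂ : Matrix (n × n) (n × n) S →+* Matrix ((n × n) × n) ((n × n) × n) S :=
  (Matrix.blockDiagonalRingHom (n × n) n S).comp (Pi.constRingHom n (Matrix (n × n) (n × n) S))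

/-- `X ↦ X₁₃`, acting on the first and the third of three tensor factors. -/
def slot₁₃ : Matrix (n × n) (n × n) S →+* Matrix ((n × n) × n) ((n × n) × n) S :=
  RingHom.comp (Matrix.reindexRingEquiv S
    ⟨fun x => ((x.1.1, x.2), x.1.2), fun x => ((x.1.1, x.2), x.1.2), fun _ => rfl,
      fun _ => rfl⟩).toRingHom slot₁₂

/-- `X ↦ X₂₃`, acting on the last two of three tensor factors. -/
def slot₂₃ : Matrix (n × n) (n × n) S →+* Matrix ((n × n) × n) ((n × n) × n) S :=
  RingHom.comp (Matrix.reindexRingEquiv S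
    ⟨fun x => ((x.2, x.1.1), x.1.2), fun x => ((x.1.2, x.2), x.1.1), fun _ => rfl,
      fun _ => rfl⟩).toRingHom slot₁₂

theorem slot₁_apply (X : Matrix n n S) (a b c e : n) :
    slot₁ X (a, b) (c, e) = if b = e then X a c else 0 := by
  simp [slot₁, Matrix.blockDiagonal_apply]

theorem slot₂_apply (X : Matrix n n S) (a b c e : n) :
    slot₂ X (a, b) (c, e) = if a = c then X b e else 0 := by
  simp [slot₂, slot₁, Matrix.blockDiagonal_apply, Matrix.reindexRingEquiv]

theorem slot₁₂_apply (X : Matrix (n × n) (n × n) S) (a b c a' b' c' : n) :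
    slot₁₂ X ((a, b), c) ((a', b'), c') = if c = c' then X (a, b) (a', b') else 0 := by
  simp [slot₁₂, Matrix.blockDiagonal_apply]

theorem slot₁₃_apply (X : Matrix (n × n) (n × n) S) (a b c a' b' c' : n) :
    slot₁₃ X ((a, b), c) ((a', b'), c') = if b = b' then X (a, c) (a', c') else 0 := by
  simp [slot₁₃, slot₁₂, Matrix.blockDiagonal_apply, Matrix.reindexRingEquiv]

theorem slot₂₃_apply (X : Matrix (n × n) (n × n) S) (a b c a' b' c' : n) :
    slot₂₃ X ((a, b), c) ((a', b'), c') = if a = a' then X (b, c) (b', c') else 0 := by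
  simp [slot₂₃, slot₁₂, Matrix.blockDiagonal_apply, Matrix.reindexRingEquiv]

/-- Interchange of the two tensor factors (twist), `X ↦ X₂₁`. -/
def tw : Matrix (n × n) (n × n) S →+* Matrix (n × n) (n × n) S :=
  (Matrix.reindexRingEquiv S (Equiv.prodComm n n)).toRingHom

theorem tw_apply (X : Matrix (n × n) (n × n) S) (a b c e : n) :
    tw X (a, b) (c, e) = X (b, a) (e, c) := by
  simp [tw, Matrix.reindexRingEquiv]

/-- A complex matrix viewed as a matrix over the `ℂ`-algebra `S`. -/
def scal (S : Type*) [Ring S] [Algebra ℂ S] : Matrix n n ℂ →+* Matrix n n S :=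
  (algebraMap ℂ S).mapMatrix

end Slots

section RMatrix
variable {V E : Type u} [Fintype V] [DecidableEq V] (Q : DimQuiver V E) (q : ℂ)

/-- `i` and `j` belong to the same vertex, and `i < j` there. -/
def below (i j : Q.Idx) : Prop := i.1 = j.1 ∧ (i.2 : ℕ) < j.2

instance (i j : Q.Idx) : Decidable (below Q i j) := inferInstanceAs (Decidable (_ ∧ _))

/-- The total `R`-matrix: on `ℂ ^ (d_v) ⊗ ℂ ^ (d_v)` it is the standard `R`-matrix of
`U_q(𝔤𝔩_{d_v})`, and on `ℂ ^ (d_v) ⊗ ℂ ^ (d_w)`, `v ≠ w`, it is the identity. Its inverse is the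
same matrix for `q⁻¹`. -/
noncomputable def Rmat : Matrix (Q.Idx × Q.Idx) (Q.Idx × Q.Idx) ℂ := Matrix.of fun p r =>
  (if p = r then (if p.1 = p.2 then q else 1) else 0) +
    (if p = r.swap ∧ below Q p.2 p.1 then q - q⁻¹ else 0)

variable {Q q}
theorem mul_Rmat {m : Type*} (M : Matrix m (Q.Idx × Q.Idx) ℂ) (x : m) (k l : Q.Idx) :
    (M * Rmat Q q) x (k, l) = (if k = l then q else 1) * M x (k, l) +
      (if below Q k l then q - q⁻¹ else 0) * M x (l, k) := by
  rw [Matrix.mul_apply]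
  simp only [Rmat, Matrix.of_apply, mul_add, Finset.sum_add_distrib, ite_and]
  simp [mul_comm]

theorem mul_slot₁₂ {m : Type*} {n S : Type*} [Fintype n] [DecidableEq n] [Ring S]
    (M : Matrix m ((n × n) × n) S) (X : Matrix (n × n) (n × n) S) (x : m) (k l r : n) :
    (M * slot₁₂ X) x ((k, l), r) =
      ((Matrix.of fun (x : m) (p : _ × _) => M x (p, r)) * X : Matrix m (n × n) S) x (k, l) := by
  simp [Matrix.mul_apply, Fintype.sum_prod_type, slot₁₂_apply]

theorem mul_slot₁₃ {m : Type*} {n S : Type*} [Fintype n] [DecidableEq n] [Ring S]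
    (M : Matrix m ((n × n) × n) S) (X : Matrix (n × n) (n × n) S) (x : m) (k l r : n) :
    (M * slot₁₃ X) x ((k, l), r) =
      ((Matrix.of fun (x : m) (p : _ × _) => M x ((p.1, l), p.2)) * X : Matrix m (n × n) S) x (k, r) := by
  simp [Matrix.mul_apply, Fintype.sum_prod_type, slot₁₃_apply]

theorem mul_slot₂₃ {m : Type*} {n S : Type*} [Fintype n] [DecidableEq n] [Ring S]
    (M : Matrix m ((n × n) × n) S) (X : Matrix (n × n) (n × n) S) (x : m) (k l r : n) :
    (M * slot₂₃ X) x ((k, l), r) =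
      ((Matrix.of fun (x : m) (p : _ × _) => M x ((k, p.1), p.2)) * X : Matrix m (n × n) S) x (l, r) := by
  simp [Matrix.mul_apply, Fintype.sum_prod_type, slot₂₃_apply]

theorem mul_tw_Rmat {m : Type*} (M : Matrix m (Q.Idx × Q.Idx) ℂ) (x : m) (k l : Q.Idx) :
    (M * tw (Rmat Q q)) x (k, l) = (if k = l then q else 1) * M x (k, l) +
      (if below Q l k then q - q⁻¹ else 0) * M x (l, k) := by
  have := mul_Rmat (q := q) (Matrix.of fun (x : m) (p : _ × _) => M x p.swap) x l k
  have h2 : (M * tw (Rmat Q q)) x (k, l) = ((Matrix.of fun (x : m) (p : _ × _) => M x p.swap) * Rmat Q q) x (l, k) := by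
    rw [Matrix.mul_apply, Matrix.mul_apply, ← (Equiv.prodComm _ _).sum_comp]
    simp [tw, Matrix.reindexRingEquiv]
  rw [h2, this]
  simp [eq_comm]

theorem below_cases (i j : Q.Idx) : i = j ∧ ¬ below Q i j ∧ ¬ below Q j i ∨ i ≠ j ∧ below Q i j ∧ ¬ below Q j i ∨ i ≠ j ∧ ¬ below Q i j ∧ below Q j i ∨ i ≠ j ∧ i.1 ≠ j.1 ∧ ¬ below Q i j ∧ ¬ below Q j i := by
  obtain ⟨v, i⟩ := i
  obtain ⟨w, j⟩ := j
  by_cases h : v = w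
  · subst h
    have : i = j ↔ (i : ℕ) = j := Fin.ext_iff
    simp only [below, Sigma.mk.injEq, heq_eq_eq, true_and, this]
    grind
  · simp [below, h, Ne.symm h]
theorem below.trans {i j k : Q.Idx} (h : below Q i j) (h' : below Q j k) : below Q i k :=
  ⟨h.1.trans h'.1, h.2.trans h'.2⟩
theorem below.irr {i : Q.Idx} (h : below Q i i) : False := lt_irrefl _ h.2


theorem yang_baxter (hq : q ≠ 0) {m : Type*} (M : Matrix m ((Q.Idx × Q.Idx) × Q.Idx) ℂ) :
    M * slot₁₂ (Rmat Q q) * slot₁₃ (Rmat Q q) * slot₂₃ (Rmat Q q) =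
      M * slot₂₃ (Rmat Q q) * slot₁₃ (Rmat Q q) * slot₁₂ (Rmat Q q) := by
  ext x ⟨⟨k, l⟩, r⟩
  simp only [mul_slot₁₂, mul_slot₁₃, mul_slot₂₃, mul_Rmat, Matrix.of_apply]
  have h1 : ∀ {i j k : Q.Idx}, below Q i j → below Q j k → below Q i k := below.trans
  have h2 : ∀ {i : Q.Idx}, below Q i i → False := below.irr
  have h3 : ∀ {i j : Q.Idx}, below Q i j → i.1 = j.1 := fun h => h.1
  have hq' : q * q⁻¹ = 1 := mul_inv_cancel₀ hq
  generalize q⁻¹ = p at *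
  have hc := fun i j => @below_cases _ _ _ _ Q i j
  have hkl := hc k l
  have hkr := hc k r
  have hlr := hc l r
  clear hc hq
  by_cases e1 : k = l
  · subst e1
    by_cases e2 : k = r
    · subst e2; simp [h2]
    · clear hkl
      rcases hkr with h | h | h | h
      · exact absurd h.1 e2
      all_goals simp [h, Ne.symm e2]; try grind
  · by_cases e2 : k = r
    · subst e2
      rcases hkl with h | h | h | h
      · exact absurd h.1 e1
      all_goals simp [h, h2, e1, Ne.symm e1]; try grind
    · by_cases e3 : l = r
      · subst e3
        rcases hkl with h | h | h | h
        · exact absurd h.1 e1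
        all_goals simp [h, h2, e1, Ne.symm e1]; try grind
      · rcases hkl with h | h | h | h
        · exact absurd h.1 e1
        all_goals
          rcases hkr with h' | h' | h' | h'
          · exact absurd h'.1 e2
          all_goals
            rcases hlr with h'' | h'' | h'' | h''
            · exact absurd h''.1 e3
            all_goals
              first
              | (exfalso; clear * - h h' h'' h1 h2 h3; grind)
              | (simp only [h, h', h'', e1, e2, e3, Ne.symm e1, Ne.symm e2, Ne.symm e3, if_true, if_false]; ring)

theorem Rmat_mul_inv (hq : q ≠ 0) : Rmat Q q * Rmat Q q⁻¹ = 1 := by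
  rw [← one_mul (Rmat Q q)]
  ext x ⟨k, l⟩
  simp only [mul_Rmat, inv_inv]
  have hq' : q * q⁻¹ = 1 := mul_inv_cancel₀ hq
  generalize (1 : Matrix (Q.Idx × Q.Idx) (Q.Idx × Q.Idx) ℂ) = M
  rcases below_cases k l with h | h | h | h
  · obtain ⟨rfl, h⟩ := h
    simp [h]; grind
  all_goals simp [h, Ne.symm h.1]; try ring

theorem Rmat_inv_mul (hq : q ≠ 0) : Rmat Q q⁻¹ * Rmat Q q = 1 := by
  simpa using Rmat_mul_inv (Q := Q) (inv_ne_zero hq)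

variable (Q) in
/-- The projection onto the summand `ℂ ^ (d_v)`. -/
def proj (v : V) : Matrix Q.Idx Q.Idx ℂ := Matrix.diagonal fun i => if i.1 = v then 1 else 0

variable (Q) in
/-- The flip `w ⊗ w' ↦ w' ⊗ w`. -/
def tau : Matrix (Q.Idx × Q.Idx) (Q.Idx × Q.Idx) ℂ :=
  Matrix.of fun p r => if p = r.swap then 1 else 0

theorem mul_slot₁_proj {m : Type*} (M : Matrix m (Q.Idx × Q.Idx) ℂ) (x : m) (k l : Q.Idx) (v : V) :
    (M * slot₁ (proj Q v)) x (k, l) = if k.1 = v then M x (k, l) else 0 := by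
  simp [Matrix.mul_apply, Fintype.sum_prod_type, slot₁_apply, proj, Matrix.diagonal_apply]

theorem mul_slot₂_proj {m : Type*} (M : Matrix m (Q.Idx × Q.Idx) ℂ) (x : m) (k l : Q.Idx) (v : V) :
    (M * slot₂ (proj Q v)) x (k, l) = if l.1 = v then M x (k, l) else 0 := by
  simp [Matrix.mul_apply, Fintype.sum_prod_type, slot₂_apply, proj, Matrix.diagonal_apply]

theorem mul_tau {m : Type*} (M : Matrix m (Q.Idx × Q.Idx) ℂ) (x : m) (k l : Q.Idx) :
    (M * tau Q) x (k, l) = M x (l, k) := by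
  simp [Matrix.mul_apply, tau]

theorem Rmat_proj₁ (v : V) : Commute (Rmat Q q) (slot₁ (proj Q v)) := by
  rw [Commute, SemiconjBy]
  have key : ∀ M : Matrix (Q.Idx × Q.Idx) (Q.Idx × Q.Idx) ℂ,
      M * Rmat Q q * slot₁ (proj Q v) = M * slot₁ (proj Q v) * Rmat Q q := by
    intro M
    ext x ⟨k, l⟩
    simp only [mul_slot₁_proj, mul_Rmat]
    have h3 : below Q k l → k.1 = l.1 := fun h => h.1
    grind
  simpa using key 1

theorem Rmat_proj₂ (v : V) : Commute (Rmat Q q) (slot₂ (proj Q v)) := by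
  rw [Commute, SemiconjBy]
  have key : ∀ M : Matrix (Q.Idx × Q.Idx) (Q.Idx × Q.Idx) ℂ,
      M * Rmat Q q * slot₂ (proj Q v) = M * slot₂ (proj Q v) * Rmat Q q := by
    intro M
    ext x ⟨k, l⟩
    simp only [mul_slot₂_proj, mul_Rmat]
    have h3 : below Q k l → k.1 = l.1 := fun h => h.1
    grind
  simpa using key 1

theorem Rmat_proj_proj {v w : V} (h : v ≠ w) :
    slot₁ (proj Q v) * slot₂ (proj Q w) * Rmat Q q = slot₁ (proj Q v) * slot₂ (proj Q w) := by
  have key : ∀ M : Matrix (Q.Idx × Q.Idx) (Q.Idx × Q.Idx) ℂ,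
      M * Rmat Q q * slot₁ (proj Q v) * slot₂ (proj Q w) =
        M * slot₁ (proj Q v) * slot₂ (proj Q w) := by
    intro M
    ext x ⟨k, l⟩
    simp only [mul_slot₁_proj, mul_slot₂_proj, mul_Rmat]
    have h3 : below Q k l → k.1 = l.1 := fun h => h.1
    grind
  rw [mul_assoc, ← (Rmat_proj₂ w).eq, ← mul_assoc, ← (Rmat_proj₁ v).eq]
  simpa using key 1

/-- Hecke relation. -/
theorem hecke : Rmat Q q - tw (Rmat Q q⁻¹) =
    (q - q⁻¹) • ((∑ v, slot₁ (proj Q v) * slot₂ (proj Q v)) * tau Q) := by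
  have key : ∀ M : Matrix (Q.Idx × Q.Idx) (Q.Idx × Q.Idx) ℂ,
      M * Rmat Q q - M * tw (Rmat Q q⁻¹) =
      (q - q⁻¹) • ((∑ v, M * slot₁ (proj Q v) * slot₂ (proj Q v)) * tau Q) := by
    intro M
    ext x ⟨k, l⟩
    simp only [Matrix.sub_apply, Matrix.smul_apply, mul_tau, mul_Rmat, mul_tw_Rmat,
      Matrix.sum_apply, mul_slot₁_proj, mul_slot₂_proj, inv_inv, smul_eq_mul]
    rcases below_cases k l with h | h | h | h
    · obtain ⟨rfl, h⟩ := h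
      simp [h]; ring
    · simp [h, h.2.1.1]
    · simp [h, h.2.2.1]; ring
    · have : ∀ v, (if k.1 = v then if l.1 = v then M x (l, k) else 0 else 0) = 0 := by
        grind
      have this' : ∀ v, (if l.1 = v then if k.1 = v then M x (l, k) else 0 else 0) = 0 := by
        grind
      simp [h, this, this']
  simpa [← mul_assoc] using key 1

theorem tw_inv_mul (hq : q ≠ 0) : tw (Rmat Q q⁻¹) * tw (Rmat Q q) = 1 := by
  rw [← map_mul, Rmat_inv_mul hq, map_one]

theorem tw_mul_inv (hq : q ≠ 0) : tw (Rmat Q q) * tw (Rmat Q q⁻¹) = 1 := by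
  rw [← map_mul, Rmat_mul_inv hq, map_one]

section Perm
variable {n S : Type*} [Fintype n] [DecidableEq n] [Ring S]

/-- Interchange of the first two of three tensor factors. -/
def swap₁₂ : Matrix ((n × n) × n) ((n × n) × n) S →+* Matrix ((n × n) × n) ((n × n) × n) S :=
  (Matrix.reindexRingEquiv S
    ⟨fun x => ((x.1.2, x.1.1), x.2), fun x => ((x.1.2, x.1.1), x.2), fun _ => rfl,
      fun _ => rfl⟩).toRingHom

/-- Cyclic permutation of three tensor factors. -/
def cycl : Matrix ((n × n) × n) ((n × n) × n) S →+* Matrix ((n × n) × n) ((n × n) × n) S :=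
  (Matrix.reindexRingEquiv S
    ⟨fun x => ((x.1.2, x.2), x.1.1), fun x => ((x.2, x.1.1), x.1.2), fun _ => rfl,
      fun _ => rfl⟩).toRingHom

theorem swap_apply (X : Matrix ((n × n) × n) ((n × n) × n) S) (a b c a' b' c' : n) :
    swap₁₂ X ((a, b), c) ((a', b'), c') = X ((b, a), c) ((b', a'), c') := by
  simp [swap₁₂, Matrix.reindexRingEquiv]

theorem cycl_apply (X : Matrix ((n × n) × n) ((n × n) × n) S) (a b c a' b' c' : n) :
    cycl X ((a, b), c) ((a', b'), c') = X ((c, a), b) ((c', a'), b') := by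
  simp [cycl, Matrix.reindexRingEquiv]

theorem swap_slot₁₂ (X : Matrix (n × n) (n × n) S) : swap₁₂ (slot₁₂ X) = slot₁₂ (tw X) := by
  ext ⟨⟨a, b⟩, c⟩ ⟨⟨a', b'⟩, c'⟩
  simp [swap_apply, slot₁₂_apply, tw_apply]

theorem swap_slot₁₃ (X : Matrix (n × n) (n × n) S) : swap₁₂ (slot₁₃ X) = slot₂₃ X := by
  ext ⟨⟨a, b⟩, c⟩ ⟨⟨a', b'⟩, c'⟩
  simp [swap_apply, slot₁₃_apply, slot₂₃_apply]

theorem swap_slot₂₃ (X : Matrix (n × n) (n × n) S) : swap₁₂ (slot₂₃ X) = slot₁₃ X := by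
  ext ⟨⟨a, b⟩, c⟩ ⟨⟨a', b'⟩, c'⟩
  simp [swap_apply, slot₁₃_apply, slot₂₃_apply]

theorem cycl_slot₁₂ (X : Matrix (n × n) (n × n) S) : cycl (slot₁₂ X) = slot₁₃ (tw X) := by
  ext ⟨⟨a, b⟩, c⟩ ⟨⟨a', b'⟩, c'⟩
  simp [cycl_apply, slot₁₂_apply, slot₁₃_apply, tw_apply]

theorem cycl_slot₁₃ (X : Matrix (n × n) (n × n) S) : cycl (slot₁₃ X) = slot₂₃ (tw X) := by
  ext ⟨⟨a, b⟩, c⟩ ⟨⟨a', b'⟩, c'⟩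
  simp [cycl_apply, slot₂₃_apply, slot₁₃_apply, tw_apply]

theorem cycl_slot₂₃ (X : Matrix (n × n) (n × n) S) : cycl (slot₂₃ X) = slot₁₂ X := by
  ext ⟨⟨a, b⟩, c⟩ ⟨⟨a', b'⟩, c'⟩
  simp [cycl_apply, slot₂₃_apply, slot₁₂_apply, tw_apply]

theorem tw_tw (X : Matrix (n × n) (n × n) S) : tw (tw X) = X := by
  ext ⟨a, b⟩ ⟨a', b'⟩
  simp [tw_apply]

end Perm

theorem inv_conj {A : Type*} [Ring A] {a x x' y y' : A} (hx : x * x' = 1) (hx' : x' * x = 1)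
    (hy : y * y' = 1) (hy' : y' * y = 1) (h : a * (y * x) = x * y * a) :
    a * (x' * y') = y' * x' * a := by
  calc a * (x' * y') = y' * x' * (x * y * a) * (x' * y') := by
        rw [show y' * x' * (x * y * a) = y' * (x' * x) * (y * a) by simp only [mul_assoc], hx',
          mul_one, ← mul_assoc y' y, hy', one_mul]
    _ = y' * x' * a := by
        rw [← h, show y' * x' * (a * (y * x)) * (x' * y') = y' * x' * a * (y * (x * x') * y') by
          simp only [mul_assoc], hx, mul_one, hy, mul_one]

/-- Compatibility of an invertible matrix `X` with the Yang–Baxter matrix. -/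
structure Compat (Q : DimQuiver V E) (q : ℂ) (X X' : Matrix (Q.Idx × Q.Idx) (Q.Idx × Q.Idx) ℂ) : Prop where
  mul_inv : X * X' = 1
  inv_mul : X' * X = 1
  ybe : slot₁₂ (Rmat Q q) * (slot₁₃ X * slot₂₃ X) = slot₂₃ X * slot₁₃ X * slot₁₂ (Rmat Q q)
  proj₁ : ∀ v, Commute X (slot₁ (proj Q v))
  proj₂ : ∀ v, Commute X (slot₂ (proj Q v))

theorem compat_pos (hq : q ≠ 0) : Compat Q q (Rmat Q q) (Rmat Q q⁻¹) where
  mul_inv := Rmat_mul_inv hq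
  inv_mul := Rmat_inv_mul hq
  ybe := by simpa [mul_assoc] using yang_baxter (Q := Q) hq (1 : Matrix ((Q.Idx × Q.Idx) × Q.Idx) _ ℂ)
  proj₁ := Rmat_proj₁
  proj₂ := Rmat_proj₂

theorem tw_slot₁ (X : Matrix Q.Idx Q.Idx ℂ) : tw (slot₁ X) = slot₂ X := by
  ext ⟨a, b⟩ ⟨c, e⟩
  simp [tw_apply, slot₁_apply, slot₂_apply]

theorem tw_slot₂ (X : Matrix Q.Idx Q.Idx ℂ) : tw (slot₂ X) = slot₁ X := by
  ext ⟨a, b⟩ ⟨c, e⟩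
  simp [tw_apply, slot₁_apply, slot₂_apply]

theorem compat_neg (hq : q ≠ 0) : Compat Q q (tw (Rmat Q q⁻¹)) (tw (Rmat Q q)) where
  mul_inv := tw_inv_mul hq
  inv_mul := tw_mul_inv hq
  ybe := by
    have h := congrArg cycl (yang_baxter (Q := Q) hq (1 : Matrix ((Q.Idx × Q.Idx) × Q.Idx) _ ℂ))
    simp only [map_mul, one_mul, cycl_slot₁₂, cycl_slot₁₃, cycl_slot₂₃] at h
    refine inv_conj (x := slot₁₃ (tw (Rmat Q q))) (y := slot₂₃ (tw (Rmat Q q)))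
      ?_ ?_ ?_ ?_ (by simpa only [mul_assoc] using h.symm)
    all_goals simp only [← map_mul, Rmat_inv_mul hq, Rmat_mul_inv hq, map_one]
  proj₁ v := by
    have h := (Rmat_proj₂ (Q := Q) (q := q⁻¹) v).map tw
    rwa [tw_slot₂] at h
  proj₂ v := by
    have h := (Rmat_proj₁ (Q := Q) (q := q⁻¹) v).map tw
    rwa [tw_slot₁] at h
end RMatrix

section Algebras

variable {V E : Type u} [Fintype V] [DecidableEq V] (Q : DimQuiver V E) (q : ℂ)

/-- Labels of the two triangular families `l⁺`, `l⁻`. -/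
inductive Sgn : Type
  | pos
  | neg

/-- The generators `l^{± i}_j`. -/
abbrev UGen : Type u := Sgn × Q.Idx × Q.Idx

/-- The matrix `L^±` of generators. -/
noncomputable def freeL (s : Sgn) : Matrix Q.Idx Q.Idx (FreeAlgebra ℂ (UGen Q)) :=
  Matrix.of fun i j => FreeAlgebra.ι ℂ (s, i, j)

/-- The relations of `U = U_q(𝔤^d) = ⨂ v, U_q(𝔤𝔩_{d_v})` on the generators `l^{± i}_j`. -/
inductive URel : FreeAlgebra ℂ (UGen Q) → FreeAlgebra ℂ (UGen Q) → Prop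
  | rtt (s : Sgn) (x y : Q.Idx × Q.Idx) :
      URel ((slot₁ (freeL Q s) * slot₂ (freeL Q s) * scal (FreeAlgebra ℂ (UGen Q)) (Rmat Q q)) x y)
        ((scal (FreeAlgebra ℂ (UGen Q)) (Rmat Q q) * slot₂ (freeL Q s) * slot₁ (freeL Q s)) x y)
  | rtt' (x y : Q.Idx × Q.Idx) :
      URel ((slot₁ (freeL Q .neg) * slot₂ (freeL Q .pos) * scal (FreeAlgebra ℂ (UGen Q)) (Rmat Q q)) x y)
        ((scal (FreeAlgebra ℂ (UGen Q)) (Rmat Q q) * slot₂ (freeL Q .pos) * slot₁ (freeL Q .neg)) x y)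
  | upper (i j : Q.Idx) (h : i ≠ j) (h' : ¬ below Q i j) : URel (freeL Q .pos i j) 0
  | lower (i j : Q.Idx) (h : i ≠ j) (h' : ¬ below Q j i) : URel (freeL Q .neg i j) 0
  | diag (i : Q.Idx) : URel (freeL Q .pos i i * freeL Q .neg i i) 1
  | diag' (i : Q.Idx) : URel (freeL Q .neg i i * freeL Q .pos i i) 1

/-- The quantized enveloping algebra `U = ⨂ v, U_q(𝔤𝔩_{d_v})`. -/
def U : Type u := RingQuot (URel Q q)

noncomputable instance : Ring (U Q q) := inferInstanceAs (Ring (RingQuot _))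
noncomputable instance : Algebra ℂ (U Q q) := inferInstanceAs (Algebra ℂ (RingQuot _))

/-- The quotient map onto `U`. -/
noncomputable def U.mk : FreeAlgebra ℂ (UGen Q) →ₐ[ℂ] U Q q := RingQuot.mkAlgHom ℂ (URel Q q)

/-- The matrix `L^±` over `U`. -/
noncomputable def Lmat (s : Sgn) : Matrix Q.Idx Q.Idx (U Q q) :=
  (freeL Q s).map (U.mk Q q)

/-- Labels for the matrix `l` of the reflection equation algebra and for its inverse. -/
inductive TSym : Type
  | l
  | linv

/-- The generators of the reflection equation algebra: the entries `l^i_j` of the matrix `l` and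
those of its inverse. -/
abbrev TGen : Type u := TSym × Q.Idx × Q.Idx

/-- The generators of the reflection equation algebra, arranged in a matrix. -/
noncomputable def freeT (b : TSym) : Matrix Q.Idx Q.Idx (FreeAlgebra ℂ (TGen Q)) :=
  Matrix.of fun i j => FreeAlgebra.ι ℂ (b, i, j)

/-- The relations of the reflection equation algebra. -/
inductive TRel : FreeAlgebra ℂ (TGen Q) → FreeAlgebra ℂ (TGen Q) → Prop
  | re (x y : Q.Idx × Q.Idx) :
      TRel ((scal (FreeAlgebra ℂ (TGen Q)) (tw (Rmat Q q)) * slot₁ (freeT Q .l) * scal (FreeAlgebra ℂ (TGen Q)) (Rmat Q q) *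
          slot₂ (freeT Q .l)) x y)
        ((slot₂ (freeT Q .l) * scal (FreeAlgebra ℂ (TGen Q)) (tw (Rmat Q q)) * slot₁ (freeT Q .l) *
          scal (FreeAlgebra ℂ (TGen Q)) (Rmat Q q)) x y)
  | block (i j : Q.Idx) (h : i.1 ≠ j.1) : TRel (freeT Q .l i j) 0
  | mul_inv (i j : Q.Idx) : TRel ((freeT Q .l * freeT Q .linv) i j)
      ((1 : Matrix Q.Idx Q.Idx (FreeAlgebra ℂ (TGen Q))) i j)
  | inv_mul (i j : Q.Idx) : TRel ((freeT Q .linv * freeT Q .l) i j)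
      ((1 : Matrix Q.Idx Q.Idx (FreeAlgebra ℂ (TGen Q))) i j)

/-- The reflection equation algebra with `q`-determinants inverted. -/
def REA : Type u := RingQuot (TRel Q q)

noncomputable instance : Ring (REA Q q) := inferInstanceAs (Ring (RingQuot _))
noncomputable instance : Algebra ℂ (REA Q q) := inferInstanceAs (Algebra ℂ (RingQuot _))

/-- The quotient map onto the reflection equation algebra. -/
noncomputable def REA.mk : FreeAlgebra ℂ (TGen Q) →ₐ[ℂ] REA Q q := RingQuot.mkAlgHom ℂ (TRel Q q)

/-- The generators of the reflection equation algebra, arranged in a matrix. -/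
noncomputable def Tmat (b : TSym) : Matrix Q.Idx Q.Idx (REA Q q) :=
  (freeT Q b).map (REA.mk Q q)

/-- The generators attached to an edge: `a`, `d` (for `∂`), and `g`, `h` which are adjoined in
order to invert quantum matrices. -/
inductive Sym : Type
  | a
  | d
  | g
  | h

abbrev DGen : Type u := E × Sym × Q.Idx × Q.Idx

/-- The generators attached to the edge `e`, arranged in a matrix. Only the block `ℂ ^ (d_{α e})`,
`ℂ ^ (d_{β e})` of `a`, and the opposite block of `d`, will be nonzero. -/
noncomputable def freeD (e : E) (s : Sym) : Matrix Q.Idx Q.Idx (FreeAlgebra ℂ (DGen Q)) :=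
  Matrix.of fun i j => FreeAlgebra.ι ℂ (e, s, i, j)

/-- The defining relations of `𝒟_q`, one tensor factor: the supports of the blocks, and the
localization. If `e` is not a loop, `g` and `h` are the inverses of `1 + (q - q⁻¹) a ∂` and of
`1 + (q - q⁻¹) ∂ a`; if `e` is a loop, they are the inverses of `a` and `∂`. -/
inductive DRel₁ : Matrix Q.Idx Q.Idx (FreeAlgebra ℂ (DGen Q)) →
    Matrix Q.Idx Q.Idx (FreeAlgebra ℂ (DGen Q)) → Prop
  | supp_a (e : E) : DRel₁ (freeD Q e .a)
      (scal (FreeAlgebra ℂ (DGen Q)) (proj Q (Q.α e)) * freeD Q e .a * scal (FreeAlgebra ℂ (DGen Q)) (proj Q (Q.β e)))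
  | supp_d (e : E) : DRel₁ (freeD Q e .d)
      (scal (FreeAlgebra ℂ (DGen Q)) (proj Q (Q.β e)) * freeD Q e .d * scal (FreeAlgebra ℂ (DGen Q)) (proj Q (Q.α e)))
  | g_right (e : E) (he : Q.α e ≠ Q.β e) :
      DRel₁ ((1 + (q - q⁻¹) • (freeD Q e .a * freeD Q e .d)) * freeD Q e .g) 1
  | g_left (e : E) (he : Q.α e ≠ Q.β e) :
      DRel₁ (freeD Q e .g * (1 + (q - q⁻¹) • (freeD Q e .a * freeD Q e .d))) 1
  | h_right (e : E) (he : Q.α e ≠ Q.β e) :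
      DRel₁ ((1 + (q - q⁻¹) • (freeD Q e .d * freeD Q e .a)) * freeD Q e .h) 1
  | h_left (e : E) (he : Q.α e ≠ Q.β e) :
      DRel₁ (freeD Q e .h * (1 + (q - q⁻¹) • (freeD Q e .d * freeD Q e .a))) 1
  | supp_g (e : E) (he : Q.α e = Q.β e) : DRel₁ (freeD Q e .g)
      (scal (FreeAlgebra ℂ (DGen Q)) (proj Q (Q.α e)) * freeD Q e .g * scal (FreeAlgebra ℂ (DGen Q)) (proj Q (Q.α e)))
  | supp_h (e : E) (he : Q.α e = Q.β e) : DRel₁ (freeD Q e .h)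
      (scal (FreeAlgebra ℂ (DGen Q)) (proj Q (Q.α e)) * freeD Q e .h * scal (FreeAlgebra ℂ (DGen Q)) (proj Q (Q.α e)))
  | ag (e : E) (he : Q.α e = Q.β e) :
      DRel₁ (freeD Q e .a * freeD Q e .g) (scal (FreeAlgebra ℂ (DGen Q)) (proj Q (Q.α e)))
  | ga (e : E) (he : Q.α e = Q.β e) :
      DRel₁ (freeD Q e .g * freeD Q e .a) (scal (FreeAlgebra ℂ (DGen Q)) (proj Q (Q.α e)))
  | dh (e : E) (he : Q.α e = Q.β e) :
      DRel₁ (freeD Q e .d * freeD Q e .h) (scal (FreeAlgebra ℂ (DGen Q)) (proj Q (Q.α e)))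
  | hd (e : E) (he : Q.α e = Q.β e) :
      DRel₁ (freeD Q e .h * freeD Q e .d) (scal (FreeAlgebra ℂ (DGen Q)) (proj Q (Q.α e)))

variable [LinearOrder E]

/-- The defining relations of `𝒟_q`, two tensor factors: the quadratic relations among the `a` and
among the `∂` of one edge, the relations between `a` and `∂` for an edge which is not a loop and
for a loop, and the braided commutation of the generators of different edges. -/
inductive DRel₂ : Matrix (Q.Idx × Q.Idx) (Q.Idx × Q.Idx) (FreeAlgebra ℂ (DGen Q)) →
    Matrix (Q.Idx × Q.Idx) (Q.Idx × Q.Idx) (FreeAlgebra ℂ (DGen Q)) → Prop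
  | re (e : E) (y : Sym) (hy : y = .a ∨ y = .d) : DRel₂
      (scal (FreeAlgebra ℂ (DGen Q)) (tw (Rmat Q q)) * slot₁ (freeD Q e y) * scal (FreeAlgebra ℂ (DGen Q)) (Rmat Q q) * slot₂ (freeD Q e y))
      (slot₂ (freeD Q e y) * scal (FreeAlgebra ℂ (DGen Q)) (tw (Rmat Q q)) * slot₁ (freeD Q e y) * scal (FreeAlgebra ℂ (DGen Q)) (Rmat Q q))
  | da (e : E) (he : Q.α e ≠ Q.β e) : DRel₂
      (slot₂ (freeD Q e .d) * scal (FreeAlgebra ℂ (DGen Q)) (Rmat Q q⁻¹) * slot₁ (freeD Q e .a))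
      (slot₁ (freeD Q e .a) * scal (FreeAlgebra ℂ (DGen Q)) (Rmat Q q) * slot₂ (freeD Q e .d) +
        scal (FreeAlgebra ℂ (DGen Q)) (slot₁ (proj Q (Q.α e)) * slot₂ (proj Q (Q.β e)) * tau Q))
  | da_loop (e : E) (he : Q.α e = Q.β e) : DRel₂
      (scal (FreeAlgebra ℂ (DGen Q)) (tw (Rmat Q q)) * slot₁ (freeD Q e .d) * scal (FreeAlgebra ℂ (DGen Q)) (Rmat Q q) * slot₂ (freeD Q e .a))
      (slot₂ (freeD Q e .a) * scal (FreeAlgebra ℂ (DGen Q)) (tw (Rmat Q q)) * slot₁ (freeD Q e .d) *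
        scal (FreeAlgebra ℂ (DGen Q)) (tw (Rmat Q q⁻¹)))
  | cross (e f : E) (hef : e < f) (y z : Sym) (hy : y = .a ∨ y = .d) (hz : z = .a ∨ z = .d) : DRel₂
      (slot₁ (freeD Q f z) * scal (FreeAlgebra ℂ (DGen Q)) (Rmat Q q) * slot₂ (freeD Q e y) * scal (FreeAlgebra ℂ (DGen Q)) (Rmat Q q⁻¹))
      (scal (FreeAlgebra ℂ (DGen Q)) (Rmat Q q) * slot₂ (freeD Q e y) * scal (FreeAlgebra ℂ (DGen Q)) (Rmat Q q⁻¹) * slot₁ (freeD Q f z))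

/-- The defining relations of `𝒟_q`: the entries of the matrix relations. -/
def DRel (x y : FreeAlgebra ℂ (DGen Q)) : Prop :=
  (∃ A B, DRel₁ Q q A B ∧ ∃ i j, x = A i j ∧ y = B i j) ∨
    ∃ A B, DRel₂ Q q A B ∧ ∃ i j, x = A i j ∧ y = B i j

/-- The algebra `𝒟_q` of quantum differential operators. -/
def D : Type u := RingQuot (DRel Q q)

noncomputable instance : Ring (D Q q) := inferInstanceAs (Ring (RingQuot _))
noncomputable instance : Algebra ℂ (D Q q) := inferInstanceAs (Algebra ℂ (RingQuot _))

/-- The quotient map onto `𝒟_q`. -/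
noncomputable def D.mk : FreeAlgebra ℂ (DGen Q) →ₐ[ℂ] D Q q := RingQuot.mkAlgHom ℂ (DRel Q q)

/-- The generators attached to the edge `e`, arranged in a matrix over `𝒟_q`. -/
noncomputable def Dmat (e : E) (s : Sym) : Matrix Q.Idx Q.Idx (D Q q) :=
  (freeD Q e s).map (D.mk Q q)

end Algebras

section ConjRing

variable {A : Type*} [Ring A] {x₁ x₁' x₂ x₂' y z a r r' s s' : A}

theorem conj_mul_conj (h₂ : x₂ * x₂' = 1)
    (h₂' : x₂' * x₂ = 1) (hy : Commute y x₂) (hz : Commute z x₁)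
    (ha : a * (x₁ * x₂) = x₂ * x₁ * a) :
    x₁' * y * x₁ * a * (x₂' * z * x₂) = x₁' * x₂' * (y * a * z) * (x₁ * x₂) := by
  have e : x₁ * a * x₂' = x₂' * a * x₁ := by
    calc x₁ * a * x₂' = x₂' * (x₂ * x₁ * a) * x₂' := by
          simp only [← mul_assoc]; rw [h₂', one_mul]
      _ = x₂' * a * x₁ := by
          rw [← ha]; simp only [mul_assoc]; rw [h₂, mul_one]
  have hy' : y * x₂' = x₂' * y := by
    calc y * x₂' = x₂' * (x₂ * y) * x₂' := by simp only [← mul_assoc]; rw [h₂', one_mul]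
      _ = x₂' * y := by rw [← hy.eq]; simp only [mul_assoc]; rw [h₂, mul_one]
  calc x₁' * y * x₁ * a * (x₂' * z * x₂) = x₁' * y * (x₁ * a * x₂') * z * x₂ := by
        simp only [mul_assoc]
    _ = x₁' * (y * x₂') * a * (x₁ * z) * x₂ := by rw [e]; simp only [mul_assoc]
    _ = _ := by rw [hy', ← hz.eq]; simp only [mul_assoc]

/-- If `a x y = y x a`, then the same holds for the inverses. -/
theorem braid_inv (h₁ : x₁ * x₁' = 1) (h₁' : x₁' * x₁ = 1) (h₂ : x₂ * x₂' = 1)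
    (h₂' : x₂' * x₂ = 1) (ha : a * (x₁ * x₂) = x₂ * x₁ * a) :
    a * (x₂' * x₁') = x₁' * x₂' * a :=
  inv_conj h₂ h₂' h₁ h₁' ha

theorem braid_symm (hr : r * s = 1) (hr' : s * r = 1) (h : r * (x₁ * x₂) = x₂ * x₁ * r) :
    s * (x₂ * x₁) = x₁ * x₂ * s := by
  calc s * (x₂ * x₁) = s * (x₂ * x₁ * r) * s := by simp only [mul_assoc]; rw [hr, mul_one]
    _ = x₁ * x₂ * s := by rw [← h]; simp only [← mul_assoc]; rw [hr', one_mul]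

/-- Braid relations between invertible elements `x₁, x₂` and `r, t`. -/
structure BraidData (x₁ x₁' x₂ x₂' r s t u : A) : Prop where
  h₁ : x₁ * x₁' = 1
  h₁' : x₁' * x₁ = 1
  h₂ : x₂ * x₂' = 1
  h₂' : x₂' * x₂ = 1
  hr : r * s = 1
  hr' : s * r = 1
  ht : t * u = 1
  ht' : u * t = 1
  A₁ : r * (x₁ * x₂) = x₂ * x₁ * r
  B₁ : t * (x₂ * x₁) = x₁ * x₂ * t

namespace BraidData
variable {t u : A}

theorem A₂ (H : BraidData x₁ x₁' x₂ x₂' r s t u) : u * (x₁ * x₂) = x₂ * x₁ * u := braid_symm H.ht H.ht' H.B₁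
theorem B₂ (H : BraidData x₁ x₁' x₂ x₂' r s t u) : s * (x₂ * x₁) = x₁ * x₂ * s := braid_symm H.hr H.hr' H.A₁

theorem W₁ (H : BraidData x₁ x₁' x₂ x₂' r s t u) (hy : Commute y x₂) (hz : Commute z x₁) (ha : a * (x₁ * x₂) = x₂ * x₁ * a) :
    x₁' * y * x₁ * (a * (x₂' * z * x₂)) = x₁' * x₂' * (y * a * z) * (x₁ * x₂) := by
  rw [← conj_mul_conj H.h₂ H.h₂' hy hz ha, mul_assoc _ a]

theorem W₂ (H : BraidData x₁ x₁' x₂ x₂' r s t u) (hy : Commute y x₂) (hz : Commute z x₁) (ha : a * (x₂ * x₁) = x₁ * x₂ * a) :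
    x₂' * z * x₂ * (a * (x₁' * y * x₁)) = x₂' * x₁' * (z * a * y) * (x₂ * x₁) := by
  rw [← conj_mul_conj H.h₁ H.h₁' hz hy ha, mul_assoc _ a]

theorem case_re (H : BraidData x₁ x₁' x₂ x₂' r s t u) (hy : Commute y x₂) (hz : Commute z x₁) (h : t * y * r * z = z * t * y * r) :
    t * (x₁' * y * x₁) * r * (x₂' * z * x₂) = x₂' * z * x₂ * t * (x₁' * y * x₁) * r := by
  have h1 := H.W₁ hy hz H.A₁
  have h2 := H.W₂ hy hz H.B₁
  have h3 := braid_inv H.h₂ H.h₂' H.h₁ H.h₁' H.B₁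
  calc _ = t * (x₁' * y * x₁ * (r * (x₂' * z * x₂))) := by simp only [mul_assoc]
    _ = t * (x₁' * x₂') * (y * r * z) * (x₁ * x₂) := by rw [h1]; simp only [mul_assoc]
    _ = x₂' * x₁' * (t * y * r * z) * (x₁ * x₂) := by rw [h3]; simp only [mul_assoc]
    _ = x₂' * x₁' * (z * t * y) * (r * (x₁ * x₂)) := by rw [h]; simp only [mul_assoc]
    _ = x₂' * x₁' * (z * t * y) * (x₂ * x₁) * r := by rw [H.A₁]; simp only [mul_assoc]
    _ = _ := by rw [← h2]; simp only [mul_assoc]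

theorem case_loop (H : BraidData x₁ x₁' x₂ x₂' r s t u) (hy : Commute y x₂) (hz : Commute z x₁) (h : t * y * r * z = z * t * y * u) :
    t * (x₁' * y * x₁) * r * (x₂' * z * x₂) = x₂' * z * x₂ * t * (x₁' * y * x₁) * u := by
  have h1 := H.W₁ hy hz H.A₁
  have h2 := H.W₂ hy hz H.B₁
  have h3 := braid_inv H.h₂ H.h₂' H.h₁ H.h₁' H.B₁
  calc _ = t * (x₁' * y * x₁ * (r * (x₂' * z * x₂))) := by simp only [mul_assoc]
    _ = t * (x₁' * x₂') * (y * r * z) * (x₁ * x₂) := by rw [h1]; simp only [mul_assoc]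
    _ = x₂' * x₁' * (t * y * r * z) * (x₁ * x₂) := by rw [h3]; simp only [mul_assoc]
    _ = x₂' * x₁' * (z * t * y) * (u * (x₁ * x₂)) := by rw [h]; simp only [mul_assoc]
    _ = x₂' * x₁' * (z * t * y) * (x₂ * x₁) * u := by rw [H.A₂]; simp only [mul_assoc]
    _ = _ := by rw [← h2]; simp only [mul_assoc]

theorem case_cross (H : BraidData x₁ x₁' x₂ x₂' r s t u) (hy : Commute y x₂) (hz : Commute z x₁) (h : y * r * z * s = r * z * s * y) :
    x₁' * y * x₁ * r * (x₂' * z * x₂) * s = r * (x₂' * z * x₂) * s * (x₁' * y * x₁) := by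
  have h1 := H.W₁ hy hz H.A₁
  have h2 := H.W₂ hy hz H.B₂
  have h3 := braid_inv H.h₁ H.h₁' H.h₂ H.h₂' H.A₁
  have h4 := H.B₂
  calc _ = x₁' * y * x₁ * (r * (x₂' * z * x₂)) * s := by simp only [mul_assoc]
    _ = x₁' * x₂' * (y * r * z) * (x₁ * x₂ * s) := by rw [h1]; simp only [mul_assoc]
    _ = x₁' * x₂' * (y * r * z * s) * (x₂ * x₁) := by rw [← h4]; simp only [mul_assoc]
    _ = x₁' * x₂' * r * (z * s * y) * (x₂ * x₁) := by rw [h]; simp only [mul_assoc]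
    _ = r * (x₂' * x₁' * (z * s * y) * (x₂ * x₁)) := by rw [← h3]; simp only [mul_assoc]
    _ = _ := by rw [← h2]; simp only [mul_assoc]

/-- Here `p` and `p'` are idempotents on which `x₁` and `x₂` commute. -/
theorem case_da (H : BraidData x₁ x₁' x₂ x₂' r s t u) (hy : Commute y x₂) (hz : Commute z x₁)
    {p p' w : A} (hp : p * (x₁ * x₂) = x₂ * x₁ * p) (hp' : p' * (x₁ * x₂) = x₂ * x₁ * p')
    (hp₁ : Commute p x₁) (hp₂ : Commute p x₂) (hp₁' : Commute p' x₁) (hp₂' : Commute p' x₂)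
    (hyz : p * (y * r * z) * p' = y * r * z) (hw : w * (x₂ * x₁) = x₁ * x₂ * w)
    (h : z * s * y = y * r * z + w) :
    x₂' * z * x₂ * s * (x₁' * y * x₁) = x₁' * y * x₁ * r * (x₂' * z * x₂) + w := by
  have h1 := H.W₁ hy hz H.A₁
  have h2 := H.W₂ hy hz H.B₂
  have e1 : x₂' * x₁' * p = x₁' * x₂' * p := by
    calc x₂' * x₁' * p = x₂' * x₁' * p * (x₁ * x₂) * (x₂' * x₁') := by
          rw [show x₂' * x₁' * p * (x₁ * x₂) * (x₂' * x₁') = x₂' * x₁' * p * (x₁ * (x₂ * x₂') * x₁')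
            by simp only [mul_assoc], H.h₂, mul_one, H.h₁, mul_one]
      _ = x₂' * x₁' * (x₁ * x₂ * p) * (x₂' * x₁') := by
          rw [← (hp₁.mul_right hp₂).eq]; simp only [mul_assoc]
      _ = p * (x₂' * x₁') := by
          rw [show x₂' * x₁' * (x₁ * x₂ * p) * (x₂' * x₁') = x₂' * (x₁' * x₁) * x₂ * p * (x₂' * x₁')
            by simp only [mul_assoc], H.h₁', mul_one, H.h₂', one_mul]
      _ = x₁' * x₂' * p := braid_inv H.h₁ H.h₁' H.h₂ H.h₂' hp
  have e2 : p' * (x₂ * x₁) = p' * (x₁ * x₂) := (hp₂'.mul_right hp₁').eq.trans hp'.symm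
  have e3 : x₂' * x₁' * (w * (x₂ * x₁)) = w := by
    rw [hw, show x₂' * x₁' * (x₁ * x₂ * w) = x₂' * (x₁' * x₁) * x₂ * w by simp only [mul_assoc],
      H.h₁', mul_one, H.h₂', one_mul]
  calc _ = x₂' * z * x₂ * (s * (x₁' * y * x₁)) := by simp only [mul_assoc]
    _ = x₂' * x₁' * p * (y * r * z) * (p' * (x₂ * x₁)) + x₂' * x₁' * (w * (x₂ * x₁)) := by
      rw [h2, h, mul_add, add_mul]
      conv_lhs => rw [← hyz]
      simp only [mul_assoc]
    _ = x₁' * x₂' * (p * (y * r * z) * p') * (x₁ * x₂) + w := by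
      rw [e1, e2, e3]; simp only [mul_assoc]
    _ = _ := by rw [hyz, ← h1]; simp only [mul_assoc]

end BraidData
end ConjRing

variable {V E : Type u} [Fintype V] [DecidableEq V]

section Act
variable [LinearOrder E] (Q : DimQuiver V E) (q : ℂ) [NeZero q]

/-- The matrix through which `l⁺` (resp. `l⁻`) acts on the vector representation. -/
noncomputable def Xmat : Sgn → Matrix (Q.Idx × Q.Idx) (Q.Idx × Q.Idx) ℂ
  | .pos => Rmat Q q
  | .neg => tw (Rmat Q q⁻¹)

/-- The inverse of `Xmat`. -/
noncomputable def Xinv : Sgn → Matrix (Q.Idx × Q.Idx) (Q.Idx × Q.Idx) ℂ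
  | .pos => Rmat Q q⁻¹
  | .neg => tw (Rmat Q q)

theorem compat (s : Sgn) : Compat Q q (Xmat Q q s) (Xinv Q q s) := by
  cases s
  · exact compat_pos (NeZero.ne q)
  · exact compat_neg (NeZero.ne q)

theorem ybe' (s : Sgn) : slot₁₂ (tw (Rmat Q q)) * (slot₂₃ (Xmat Q q s) * slot₁₃ (Xmat Q q s)) =
    slot₁₃ (Xmat Q q s) * slot₂₃ (Xmat Q q s) * slot₁₂ (tw (Rmat Q q)) := by
  have h := congrArg swap₁₂ (compat Q q s).ybe
  simpa only [map_mul, swap_slot₁₂, swap_slot₁₃, swap_slot₂₃] using h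

theorem slot₁_scal {n S : Type*} [Fintype n] [DecidableEq n] [Ring S] [Algebra ℂ S]
    (C : Matrix n n ℂ) : slot₁ (scal S C) = scal S (slot₁ C) := by
  ext ⟨a, b⟩ ⟨c, e⟩
  simp only [slot₁_apply, scal, RingHom.mapMatrix_apply, Matrix.map_apply]
  split <;> simp

theorem slot₂_scal {n S : Type*} [Fintype n] [DecidableEq n] [Ring S] [Algebra ℂ S]
    (C : Matrix n n ℂ) : slot₂ (scal S C) = scal S (slot₂ C) := by
  ext ⟨a, b⟩ ⟨c, e⟩
  simp only [slot₂_apply, scal, RingHom.mapMatrix_apply, Matrix.map_apply]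
  split <;> simp

theorem slot₁₂_scal {n S : Type*} [Fintype n] [DecidableEq n] [Ring S] [Algebra ℂ S]
    (C : Matrix (n × n) (n × n) ℂ) : slot₁₂ (scal S C) = scal S (slot₁₂ C) := by
  ext ⟨⟨a, b⟩, k⟩ ⟨⟨c, e⟩, l⟩
  simp only [slot₁₂_apply, scal, RingHom.mapMatrix_apply, Matrix.map_apply]
  split <;> simp

theorem slot₁₃_scal {n S : Type*} [Fintype n] [DecidableEq n] [Ring S] [Algebra ℂ S]
    (C : Matrix (n × n) (n × n) ℂ) : slot₁₃ (scal S C) = scal S (slot₁₃ C) := by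
  ext ⟨⟨a, b⟩, k⟩ ⟨⟨c, e⟩, l⟩
  simp only [slot₁₃_apply, scal, RingHom.mapMatrix_apply, Matrix.map_apply]
  split <;> simp

theorem slot₂₃_scal {n S : Type*} [Fintype n] [DecidableEq n] [Ring S] [Algebra ℂ S]
    (C : Matrix (n × n) (n × n) ℂ) : slot₂₃ (scal S C) = scal S (slot₂₃ C) := by
  ext ⟨⟨a, b⟩, k⟩ ⟨⟨c, e⟩, l⟩
  simp only [slot₂₃_apply, scal, RingHom.mapMatrix_apply, Matrix.map_apply]
  split <;> simp

/-- Scalar matrices commute with matrices acting on another tensor factor. -/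
theorem commute_slot₁ {n S : Type*} [Fintype n] [DecidableEq n] [Ring S] [Algebra ℂ S]
    (Y : Matrix n n S) (C : Matrix n n ℂ) : Commute (slot₁ Y) (slot₂ (scal S C)) := by
  rw [Commute, SemiconjBy]
  ext ⟨a, b⟩ ⟨c, e⟩
  simp [Matrix.mul_apply, Fintype.sum_prod_type, slot₁_apply, slot₂_apply, scal,
    Algebra.commutes]

theorem commute_slot₂ {n S : Type*} [Fintype n] [DecidableEq n] [Ring S] [Algebra ℂ S]
    (Y : Matrix n n S) (C : Matrix n n ℂ) : Commute (slot₂ Y) (slot₁ (scal S C)) := by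
  rw [Commute, SemiconjBy]
  ext ⟨a, b⟩ ⟨c, e⟩
  simp [Matrix.mul_apply, Fintype.sum_prod_type, slot₁_apply, slot₂_apply, scal,
    Algebra.commutes]

theorem commute_slot₁₂₁ {n S : Type*} [Fintype n] [DecidableEq n] [Ring S] [Algebra ℂ S]
    (Y : Matrix n n S) (C : Matrix (n × n) (n × n) ℂ) :
    Commute (slot₁₂ (slot₁ Y)) (slot₂₃ (scal S C)) := by
  rw [Commute, SemiconjBy]
  ext ⟨⟨a, b⟩, k⟩ ⟨⟨c, e⟩, l⟩
  simp [Matrix.mul_apply, Fintype.sum_prod_type, slot₁_apply, slot₁₂_apply, slot₂₃_apply, scal,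
    Algebra.commutes]

theorem commute_slot₁₂₂ {n S : Type*} [Fintype n] [DecidableEq n] [Ring S] [Algebra ℂ S]
    (Y : Matrix n n S) (C : Matrix (n × n) (n × n) ℂ) :
    Commute (slot₁₂ (slot₂ Y)) (slot₁₃ (scal S C)) := by
  rw [Commute, SemiconjBy]
  ext ⟨⟨a, b⟩, k⟩ ⟨⟨c, e⟩, l⟩
  simp [Matrix.mul_apply, Fintype.sum_prod_type, slot₂_apply, slot₁₂_apply, slot₁₃_apply, scal,
    Algebra.commutes]

theorem slot₁₃_slot₁ {n S : Type*} [Fintype n] [DecidableEq n] [Ring S]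
    (Y : Matrix n n S) : slot₁₃ (slot₁ Y) = slot₁₂ (slot₁ Y) := by
  ext ⟨⟨a, b⟩, k⟩ ⟨⟨c, e⟩, l⟩
  simp only [slot₁_apply, slot₁₂_apply, slot₁₃_apply]
  split_ifs <;> rfl

theorem slot₂₃_slot₁ {n S : Type*} [Fintype n] [DecidableEq n] [Ring S]
    (Y : Matrix n n S) : slot₂₃ (slot₁ Y) = slot₁₂ (slot₂ Y) := by
  ext ⟨⟨a, b⟩, k⟩ ⟨⟨c, e⟩, l⟩
  simp only [slot₁_apply, slot₂_apply, slot₁₂_apply, slot₂₃_apply]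
  split_ifs <;> rfl

/-- `y ↦ X⁻¹ y₁ X`: the action of `l^±` on a vector-covector matrix of elements of `𝒟_q`. -/
noncomputable def conjX (s : Sgn) (S : Type*) [Ring S] [Algebra ℂ S] :
    Matrix Q.Idx Q.Idx S →+* Matrix (Q.Idx × Q.Idx) (Q.Idx × Q.Idx) S where
  toFun Y := scal S (Xinv Q q s) * slot₁ Y * scal S (Xmat Q q s)
  map_one' := by rw [map_one, mul_one, ← map_mul, (compat Q q s).inv_mul, map_one]
  map_zero' := by simp
  map_add' a b := by simp [mul_add, add_mul]
  map_mul' a b := by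
    have h : scal S (Xmat Q q s) * scal S (Xinv Q q s) = 1 := by
      rw [← map_mul, (compat Q q s).mul_inv, map_one]
    have h' : scal S (Xinv Q q s) * slot₁ a * scal S (Xmat Q q s) *
        (scal S (Xinv Q q s) * slot₁ b * scal S (Xmat Q q s)) = scal S (Xinv Q q s) * slot₁ a *
        (scal S (Xmat Q q s) * scal S (Xinv Q q s)) * slot₁ b * scal S (Xmat Q q s) := by
      simp only [mul_assoc]
    rw [h', h, mul_one, map_mul]
    simp only [mul_assoc]

theorem conjX_apply (s : Sgn) (S : Type*) [Ring S] [Algebra ℂ S] (Y : Matrix Q.Idx Q.Idx S) :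
    conjX Q q s S Y = scal S (Xinv Q q s) * slot₁ Y * scal S (Xmat Q q s) := rfl

/-- The action of the generators `l^{± a}_b` on the generators of `𝒟_q`. -/
noncomputable def actGen (s : Sgn) : FreeAlgebra ℂ (DGen Q) →ₐ[ℂ] Matrix Q.Idx Q.Idx (D Q q) :=
  FreeAlgebra.lift ℂ fun x => Matrix.of fun a b =>
    conjX Q q s (D Q q) (Dmat Q q x.1 x.2.1) (x.2.2.1, a) (x.2.2.2, b)

/-- `actGen`, applied to the entries of a matrix. -/
noncomputable def actMat (s : Sgn) (n : Type*) [Fintype n] [DecidableEq n] :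
    Matrix n n (FreeAlgebra ℂ (DGen Q)) →+* Matrix (n × Q.Idx) (n × Q.Idx) (D Q q) :=
  (Matrix.compRingEquiv n Q.Idx (D Q q)).toRingHom.comp (actGen Q q s).toRingHom.mapMatrix

theorem actMat_apply (s : Sgn) {n : Type*} [Fintype n] [DecidableEq n]
    (Y : Matrix n n (FreeAlgebra ℂ (DGen Q))) (i j : n) (a b : Q.Idx) :
    actMat Q q s n Y (i, a) (j, b) = actGen Q q s (Y i j) a b := rfl

theorem actMat_freeD (s : Sgn) (e : E) (y : Sym) :
    actMat Q q s _ (freeD Q e y) = conjX Q q s (D Q q) (Dmat Q q e y) := by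
  ext ⟨i, a⟩ ⟨j, b⟩
  simp only [actMat_apply, actGen, freeD, Matrix.of_apply, FreeAlgebra.lift_ι_apply]

theorem actMat_scal₁ (s : Sgn) (C : Matrix Q.Idx Q.Idx ℂ) :
    actMat Q q s _ (scal _ C) = slot₁ (scal _ C) := by
  ext ⟨i, a⟩ ⟨j, b⟩
  simp [actMat_apply, scal, slot₁_apply, Matrix.algebraMap_matrix_apply]

theorem actMat_scal₂ (s : Sgn) (C : Matrix (Q.Idx × Q.Idx) (Q.Idx × Q.Idx) ℂ) :
    actMat Q q s _ (scal _ C) = slot₁₂ (scal _ C) := by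
  ext ⟨⟨i, k⟩, a⟩ ⟨⟨j, l⟩, b⟩
  simp [actMat_apply, scal, slot₁₂_apply, Matrix.algebraMap_matrix_apply]

theorem actMat_slot₁ (s : Sgn) (Y : Matrix Q.Idx Q.Idx (FreeAlgebra ℂ (DGen Q))) :
    actMat Q q s _ (slot₁ Y) = slot₁₃ (actMat Q q s _ Y) := by
  ext ⟨⟨i, k⟩, a⟩ ⟨⟨j, l⟩, b⟩
  simp only [actMat_apply, slot₁_apply, slot₁₃_apply]
  split <;> simp

theorem actMat_slot₂ (s : Sgn) (Y : Matrix Q.Idx Q.Idx (FreeAlgebra ℂ (DGen Q))) :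
    actMat Q q s _ (slot₂ Y) = slot₂₃ (actMat Q q s _ Y) := by
  ext ⟨⟨i, k⟩, a⟩ ⟨⟨j, l⟩, b⟩
  simp only [actMat_apply, slot₂_apply, slot₂₃_apply]
  split <;> simp

/-- The quotient map on matrices. -/
noncomputable def mkMat (n : Type*) [Fintype n] [DecidableEq n] :
    Matrix n n (FreeAlgebra ℂ (DGen Q)) →+* Matrix n n (D Q q) :=
  (D.mk Q q).toRingHom.mapMatrix

theorem mkMat_apply {n : Type*} [Fintype n] [DecidableEq n]
    (Y : Matrix n n (FreeAlgebra ℂ (DGen Q))) (i j : n) : mkMat Q q n Y i j = D.mk Q q (Y i j) := rfl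

theorem mkMat_freeD (e : E) (y : Sym) : mkMat Q q _ (freeD Q e y) = Dmat Q q e y := rfl

theorem mkMat_scal {n : Type*} [Fintype n] [DecidableEq n] (C : Matrix n n ℂ) :
    mkMat Q q _ (scal _ C) = scal _ C := by
  ext i j
  exact (D.mk Q q).commutes _

theorem mkMat_slot₁ (Y : Matrix Q.Idx Q.Idx (FreeAlgebra ℂ (DGen Q))) :
    mkMat Q q _ (slot₁ Y) = slot₁ (mkMat Q q _ Y) := by
  ext ⟨i, k⟩ ⟨j, l⟩
  simp only [mkMat_apply, slot₁_apply, apply_ite (D.mk Q q), map_zero]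

theorem mkMat_slot₂ (Y : Matrix Q.Idx Q.Idx (FreeAlgebra ℂ (DGen Q))) :
    mkMat Q q _ (slot₂ Y) = slot₂ (mkMat Q q _ Y) := by
  ext ⟨i, k⟩ ⟨j, l⟩
  simp only [mkMat_apply, slot₂_apply, apply_ite (D.mk Q q), map_zero]

theorem mkMat_rel₁ {A B} (h : DRel₁ Q q A B) : mkMat Q q _ A = mkMat Q q _ B := by
  ext i j
  exact RingQuot.mkAlgHom_rel ℂ (Or.inl ⟨A, B, h, i, j, rfl, rfl⟩)

theorem mkMat_rel₂ {A B} (h : DRel₂ Q q A B) : mkMat Q q _ A = mkMat Q q _ B := by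
  ext i j
  exact RingQuot.mkAlgHom_rel ℂ (Or.inr ⟨A, B, h, i, j, rfl, rfl⟩)

theorem mkMat_smul {n : Type*} [Fintype n] [DecidableEq n] (c : ℂ)
    (Y : Matrix n n (FreeAlgebra ℂ (DGen Q))) : mkMat Q q n (c • Y) = c • mkMat Q q n Y := by
  ext i j
  exact map_smul (D.mk Q q) c (Y i j)

theorem actMat_smul (s : Sgn) {n : Type*} [Fintype n] [DecidableEq n] (c : ℂ)
    (Y : Matrix n n (FreeAlgebra ℂ (DGen Q))) :
    actMat Q q s n (c • Y) = c • actMat Q q s n Y := by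
  ext ⟨i, a⟩ ⟨j, b⟩
  simp [actMat_apply]

theorem slot₁_smul {n S : Type*} [Fintype n] [DecidableEq n] [Ring S] [Algebra ℂ S] (c : ℂ)
    (Y : Matrix n n S) : slot₁ (c • Y) = c • slot₁ Y := by
  ext ⟨i, a⟩ ⟨j, b⟩
  simp [slot₁_apply]

theorem conjX_smul (s : Sgn) {S : Type*} [Ring S] [Algebra ℂ S] (c : ℂ)
    (Y : Matrix Q.Idx Q.Idx S) : conjX Q q s S (c • Y) = c • conjX Q q s S Y := by
  simp [conjX_apply, slot₁_smul]

theorem conjX_proj (s : Sgn) (S : Type*) [Ring S] [Algebra ℂ S] (v : V) :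
    conjX Q q s S (scal S (proj Q v)) = slot₁ (scal S (proj Q v)) := by
  rw [conjX_apply, slot₁_scal, ← map_mul, ← map_mul, mul_assoc, ← ((compat Q q s).proj₁ v).eq,
    ← mul_assoc, (compat Q q s).inv_mul, one_mul]

theorem act_rel₁ (s : Sgn) {A B} (h : DRel₁ Q q A B) : actMat Q q s _ A = actMat Q q s _ B := by
  have key : actMat Q q s _ A = conjX Q q s _ (mkMat Q q _ A) ∧
      actMat Q q s _ B = conjX Q q s _ (mkMat Q q _ B) := by
    cases h <;> constructor <;>
    simp only [map_mul, map_add, map_one, mkMat_freeD, mkMat_scal, actMat_freeD, actMat_scal₁,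
      conjX_proj, conjX_smul, mkMat_smul, actMat_smul]
  rw [key.1, key.2, mkMat_rel₁ Q q h]

section Rel₂
variable (s : Sgn)

theorem braidData : BraidData (slot₁₃ (scal (D Q q) (Xmat Q q s)))
    (slot₁₃ (scal _ (Xinv Q q s))) (slot₂₃ (scal _ (Xmat Q q s))) (slot₂₃ (scal _ (Xinv Q q s)))
    (slot₁₂ (scal _ (Rmat Q q))) (slot₁₂ (scal _ (Rmat Q q⁻¹)))
    (slot₁₂ (scal _ (tw (Rmat Q q)))) (slot₁₂ (scal _ (tw (Rmat Q q⁻¹)))) where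
  h₁ := by rw [← map_mul, ← map_mul, (compat Q q s).mul_inv, map_one, map_one]
  h₁' := by rw [← map_mul, ← map_mul, (compat Q q s).inv_mul, map_one, map_one]
  h₂ := by rw [← map_mul, ← map_mul, (compat Q q s).mul_inv, map_one, map_one]
  h₂' := by rw [← map_mul, ← map_mul, (compat Q q s).inv_mul, map_one, map_one]
  hr := by rw [← map_mul, ← map_mul, Rmat_mul_inv (NeZero.ne q), map_one, map_one]
  hr' := by rw [← map_mul, ← map_mul, Rmat_inv_mul (NeZero.ne q), map_one, map_one]
  ht := by rw [← map_mul, ← map_mul, tw_mul_inv (NeZero.ne q), map_one, map_one]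
  ht' := by rw [← map_mul, ← map_mul, tw_inv_mul (NeZero.ne q), map_one, map_one]
  A₁ := by simp only [slot₁₂_scal, slot₁₃_scal, slot₂₃_scal, ← map_mul, (compat Q q s).ybe]
  B₁ := by simp only [slot₁₂_scal, slot₁₃_scal, slot₂₃_scal, ← map_mul, ybe']

theorem proj_idem (v : V) : proj Q v * proj Q v = proj Q v := by
  simp [proj, Matrix.diagonal_mul_diagonal]

theorem Dmat_a (e : E) : Dmat Q q e .a =
    scal _ (proj Q (Q.α e)) * Dmat Q q e .a * scal _ (proj Q (Q.β e)) := by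
  simpa only [map_mul, mkMat_scal, mkMat_freeD] using mkMat_rel₁ Q q (DRel₁.supp_a e)

theorem Dmat_d (e : E) : Dmat Q q e .d =
    scal _ (proj Q (Q.β e)) * Dmat Q q e .d * scal _ (proj Q (Q.α e)) := by
  simpa only [map_mul, mkMat_scal, mkMat_freeD] using mkMat_rel₁ Q q (DRel₁.supp_d e)

theorem scal_complex {n : Type*} [Fintype n] [DecidableEq n] (C : Matrix n n ℂ) :
    scal ℂ C = C := by
  ext i j
  simp [scal]

theorem proj_comm₁ (v w : V) :
    Commute (slot₁₂ (slot₁ (proj Q v) * slot₂ (proj Q w))) (slot₁₃ (Xmat Q q s)) := by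
  rw [map_mul]
  refine Commute.mul_left ?_ ?_
  · rw [← slot₁₃_slot₁]
    exact ((compat Q q s).proj₁ v).symm.map slot₁₃
  · simpa only [scal_complex] using commute_slot₁₂₂ (S := ℂ) (proj Q w) (Xmat Q q s)

theorem proj_comm₂ (v w : V) :
    Commute (slot₁₂ (slot₁ (proj Q v) * slot₂ (proj Q w))) (slot₂₃ (Xmat Q q s)) := by
  rw [map_mul]
  refine Commute.mul_left ?_ ?_
  · simpa only [scal_complex] using commute_slot₁₂₁ (S := ℂ) (proj Q v) (Xmat Q q s)
  · rw [← slot₂₃_slot₁]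
    exact ((compat Q q s).proj₁ w).symm.map slot₂₃

/-- Two distinct vertices: there, the matrices `X₁₃` and `X₂₃` commute. -/
theorem proj_ybe {v w : V} (h : v ≠ w) :
    slot₁₂ (slot₁ (proj Q v) * slot₂ (proj Q w)) * (slot₁₃ (Xmat Q q s) * slot₂₃ (Xmat Q q s)) =
      slot₂₃ (Xmat Q q s) * slot₁₃ (Xmat Q q s) *
        slot₁₂ (slot₁ (proj Q v) * slot₂ (proj Q w)) := by
  have h1 := congrArg slot₁₂ (Rmat_proj_proj (Q := Q) (q := q) h)
  rw [map_mul slot₁₂ (_ * _)] at h1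
  have h2 := ((proj_comm₂ Q q s v w).mul_right (proj_comm₁ Q q s v w)).eq
  rw [← h1, mul_assoc, (compat Q q s).ybe, ← mul_assoc, h2]
  simp only [mul_assoc]

theorem tau_slot : slot₁₂ (tau Q) * (slot₂₃ (Xmat Q q s) * slot₁₃ (Xmat Q q s)) =
    slot₁₃ (Xmat Q q s) * slot₂₃ (Xmat Q q s) * slot₁₂ (tau Q) := by
  have h1 : ∀ X : Matrix (Q.Idx × Q.Idx) (Q.Idx × Q.Idx) ℂ,
      slot₁₂ (tau Q) * slot₂₃ X = slot₁₃ X * slot₁₂ (tau Q) := by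
    intro X
    ext ⟨⟨a, b⟩, k⟩ ⟨⟨c, e⟩, l⟩
    simp [Matrix.mul_apply, Fintype.sum_prod_type, slot₁₂_apply, slot₁₃_apply, slot₂₃_apply, tau,
      Prod.ext_iff, ite_and]
  have h2 : ∀ X : Matrix (Q.Idx × Q.Idx) (Q.Idx × Q.Idx) ℂ,
      slot₁₂ (tau Q) * slot₁₃ X = slot₂₃ X * slot₁₂ (tau Q) := by
    intro X
    ext ⟨⟨a, b⟩, k⟩ ⟨⟨c, e⟩, l⟩
    simp [Matrix.mul_apply, Fintype.sum_prod_type, slot₁₂_apply, slot₁₃_apply, slot₂₃_apply, tau,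
      Prod.ext_iff, ite_and]
  rw [← mul_assoc, h1, mul_assoc, h2, ← mul_assoc]

theorem da_support (e : E) :
    scal (D Q q) (slot₁ (proj Q (Q.α e)) * slot₂ (proj Q (Q.β e))) *
      (slot₁ (Dmat Q q e .a) * scal _ (Rmat Q q) * slot₂ (Dmat Q q e .d)) *
      scal _ (slot₁ (proj Q (Q.β e)) * slot₂ (proj Q (Q.α e))) =
    slot₁ (Dmat Q q e .a) * scal _ (Rmat Q q) * slot₂ (Dmat Q q e .d) := by
  have hP := fun v => congrArg (scal (D Q q)) (proj_idem Q v)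
  simp only [map_mul] at hP
  have a1 : scal _ (proj Q (Q.α e)) * Dmat Q q e .a = Dmat Q q e .a := by
    rw [Dmat_a]; simp only [← mul_assoc, hP]
  have a2 : Dmat Q q e .a * scal _ (proj Q (Q.β e)) = Dmat Q q e .a := by
    rw [Dmat_a]; simp only [mul_assoc, hP]
  have d1 : scal _ (proj Q (Q.β e)) * Dmat Q q e .d = Dmat Q q e .d := by
    rw [Dmat_d]; simp only [← mul_assoc, hP]
  have d2 : Dmat Q q e .d * scal _ (proj Q (Q.α e)) = Dmat Q q e .d := by
    rw [Dmat_d]; simp only [mul_assoc, hP]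
  have b1 := congrArg slot₁ a1
  have b2 := congrArg slot₁ a2
  have b3 := congrArg slot₂ d1
  have b4 := congrArg slot₂ d2
  rw [map_mul] at b1 b2 b3 b4
  have c1 := (commute_slot₁ (Dmat Q q e .a) (proj Q (Q.β e))).eq
  have c2 := (commute_slot₂ (Dmat Q q e .d) (proj Q (Q.β e))).eq
  have r1 := ((Rmat_proj₁ (Q := Q) (q := q) (Q.β e)).map (scal (D Q q))).eq
  have r2 := ((Rmat_proj₂ (Q := Q) (q := q) (Q.β e)).map (scal (D Q q))).eq
  rw [← slot₁_scal] at r1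
  rw [← slot₂_scal] at r2
  simp only [map_mul, ← slot₁_scal, ← slot₂_scal]
  generalize scal (D Q q) (Rmat Q q) = r at *
  generalize slot₁ (Dmat Q q e .a) = y at *
  generalize slot₂ (Dmat Q q e .d) = z at *
  calc _ = slot₁ (scal _ (proj Q (Q.α e))) * (slot₂ (scal _ (proj Q (Q.β e))) * y) * r *
        (z * slot₁ (scal _ (proj Q (Q.β e)))) * slot₂ (scal _ (proj Q (Q.α e))) := by
        simp only [mul_assoc]
    _ = (slot₁ (scal _ (proj Q (Q.α e))) * y) * (slot₂ (scal _ (proj Q (Q.β e))) * r) *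
        slot₁ (scal _ (proj Q (Q.β e))) * (z * slot₂ (scal _ (proj Q (Q.α e)))) := by
        rw [← c1, c2]; simp only [mul_assoc]
    _ = y * r * (slot₂ (scal _ (proj Q (Q.β e))) * slot₁ (scal _ (proj Q (Q.β e)))) * z := by
        rw [b1, b4, ← r2]; simp only [mul_assoc]
    _ = y * (r * slot₁ (scal _ (proj Q (Q.β e)))) * (slot₂ (scal _ (proj Q (Q.β e))) * z) := by
        rw [← (commute_slot₁ (scal _ (proj Q (Q.β e))) _).eq]; simp only [mul_assoc]
    _ = (y * slot₁ (scal _ (proj Q (Q.β e)))) * r * z := by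
        rw [r1, b3]; simp only [mul_assoc]
    _ = _ := by rw [b2]

theorem act_rel₂ {A B} (h : DRel₂ Q q A B) : actMat Q q s _ A = actMat Q q s _ B := by
  have hm := congrArg slot₁₂ (mkMat_rel₂ Q q h)
  have H := braidData Q q s
  have C₁ := fun Y : Matrix Q.Idx Q.Idx (D Q q) => commute_slot₁₂₁ Y (Xmat Q q s)
  have C₂ := fun Y : Matrix Q.Idx Q.Idx (D Q q) => commute_slot₁₂₂ Y (Xmat Q q s)
  cases h with
  | re e y hy =>
    simp only [map_mul, actMat_slot₁, actMat_slot₂, actMat_scal₂, actMat_freeD, conjX_apply,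
      slot₁₃_slot₁, slot₂₃_slot₁, mkMat_slot₁, mkMat_slot₂, mkMat_scal, mkMat_freeD] at hm ⊢
    exact H.case_re (C₁ _) (C₂ _) hm
  | da_loop e he =>
    simp only [map_mul, actMat_slot₁, actMat_slot₂, actMat_scal₂, actMat_freeD, conjX_apply,
      slot₁₃_slot₁, slot₂₃_slot₁, mkMat_slot₁, mkMat_slot₂, mkMat_scal, mkMat_freeD] at hm ⊢
    exact H.case_loop (C₁ _) (C₂ _) hm
  | cross e f hef y z hy hz =>
    simp only [map_mul, actMat_slot₁, actMat_slot₂, actMat_scal₂, actMat_freeD, conjX_apply,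
      slot₁₃_slot₁, slot₂₃_slot₁, mkMat_slot₁, mkMat_slot₂, mkMat_scal, mkMat_freeD] at hm ⊢
    exact H.case_cross (C₁ _) (C₂ _) hm
  | da e he =>
    rw [map_add, map_add] at hm
    rw [map_add]
    rw [actMat_scal₂, ]
    rw [mkMat_scal] at hm
    simp only [map_mul (mkMat Q q (Q.Idx × Q.Idx)), map_mul (actMat Q q s (Q.Idx × Q.Idx)), actMat_slot₁, actMat_slot₂, actMat_scal₂, actMat_freeD, conjX_apply,
      slot₁₃_slot₁, slot₂₃_slot₁, mkMat_slot₁, mkMat_slot₂, mkMat_scal, mkMat_freeD,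
      map_mul slot₁₂, map_mul slot₁₃, map_mul slot₂₃] at hm ⊢
    refine H.case_da (C₁ _) (C₂ _)
      (p := slot₁₂ (scal _ (slot₁ (proj Q (Q.α e)) * slot₂ (proj Q (Q.β e)))))
      (p' := slot₁₂ (scal _ (slot₁ (proj Q (Q.β e)) * slot₂ (proj Q (Q.α e)))))
      ?_ ?_ ?_ ?_ ?_ ?_ ?_ ?_ hm
    · simp only [slot₁₂_scal, slot₁₃_scal, slot₂₃_scal, ← map_mul (scal _), proj_ybe Q q s he]
    · simp only [slot₁₂_scal, slot₁₃_scal, slot₂₃_scal, ← map_mul (scal _),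
        proj_ybe Q q s (Ne.symm he)]
    · simpa only [slot₁₂_scal, slot₁₃_scal] using (proj_comm₁ Q q s _ _).map (scal (D Q q))
    · simpa only [slot₁₂_scal, slot₂₃_scal] using (proj_comm₂ Q q s _ _).map (scal (D Q q))
    · simpa only [slot₁₂_scal, slot₁₃_scal] using (proj_comm₁ Q q s _ _).map (scal (D Q q))
    · simpa only [slot₁₂_scal, slot₂₃_scal] using (proj_comm₂ Q q s _ _).map (scal (D Q q))
    · simpa only [map_mul slot₁₂] using congrArg slot₁₂ (da_support Q q e)
    · simp only [slot₁₂_scal, slot₁₃_scal, slot₂₃_scal, ← map_mul (scal _)]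
      refine congrArg _ ?_
      have h1 := proj_ybe Q q s he
      have h2 := ((proj_comm₁ Q q s (Q.α e) (Q.β e)).mul_right (proj_comm₂ Q q s _ _)).eq
      rw [map_mul slot₁₂ (_ * _), mul_assoc, tau_slot, ← mul_assoc, h2, mul_assoc]

/-- The algebra map `y ↦ (l^{± i}_j ▷ y)_{i j}` which describes the action of `U` on `𝒟_q`. -/
noncomputable def act : D Q q →ₐ[ℂ] Matrix Q.Idx Q.Idx (D Q q) :=
  RingQuot.liftAlgHom ℂ ⟨actGen Q q s, by
    intro x y hxy
    ext i j
    rcases hxy with ⟨A, B, h, k, l, rfl, rfl⟩ | ⟨A, B, h, k, l, rfl, rfl⟩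
    · exact congrFun (congrFun (act_rel₁ Q q s h) (k, i)) (l, j)
    · exact congrFun (congrFun (act_rel₂ Q q s h) (k, i)) (l, j)⟩

theorem act_Dmat (e : E) (y : Sym) (k l i j : Q.Idx) :
    act Q q s (Dmat Q q e y k l) i j =
      (scal (D Q q) (Xinv Q q s) * slot₁ (Dmat Q q e y) * scal (D Q q) (Xmat Q q s)) (k, i) (l, j) := by
  have h : act Q q s (Dmat Q q e y k l) = actGen Q q s (freeD Q e y k l) :=
    RingQuot.liftAlgHom_mkAlgHom_apply ..
  rw [h]
  exact congrFun (congrFun (actMat_freeD Q q s e y) (k, i)) (l, j)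

end Rel₂
end Act

section MomentRing

variable {A : Type*} [Ring A] [Algebra ℂ A]

/-- Relations of an edge between distinct vertices. -/
structure EdgeData (c : ℂ) (a₁ a₂ d₁ d₂ r s t u w w' k : A) : Prop where
  hr : r * s = 1
  hr' : s * r = 1
  ht : t * u = 1
  ht' : u * t = 1
  hecke : r = u + c • k
  hecke' : t = s + c • k
  aa : t * (a₁ * a₂) = a₂ * a₁ * r
  aa' : r * (a₂ * a₁) = a₁ * a₂ * t
  dd : t * (d₁ * d₂) = d₂ * d₁ * r
  dd' : r * (d₂ * d₁) = d₁ * d₂ * t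
  da : d₂ * s * a₁ = a₁ * r * d₂ + w
  da' : d₁ * u * a₂ = a₂ * t * d₁ + w'
  wa : w' * a₁ = a₂ * k
  aw : a₁ * w' = k * a₂
  wd : w * d₁ = d₂ * k
  dw : d₁ * w = k * d₂

variable {c : ℂ} {a₁ a₂ d₁ d₂ r s t u w w' k : A}

theorem EdgeData.beta_a (H : EdgeData c a₁ a₂ d₁ d₂ r s t u w w' k) :
    (1 + c • (d₁ * a₁)) * a₂ = a₂ * t * (1 + c • (d₁ * a₁)) * r := by
  have e1 : a₁ * a₂ = u * (a₂ * a₁ * r) := by rw [← H.aa, ← mul_assoc, H.ht', one_mul]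
  have e2 : a₂ * t * r = a₂ + c • (a₂ * k * r) := by
    rw [H.hecke', mul_add, add_mul, mul_assoc a₂ s r, H.hr', mul_one, mul_smul_comm, smul_mul_assoc]
  have e3 : d₁ * a₁ * a₂ = a₂ * t * d₁ * a₁ * r + a₂ * k * r := by
    rw [mul_assoc, e1, ← H.wa, ← mul_assoc, ← mul_assoc, ← mul_assoc, H.da', add_mul, add_mul]
  rw [add_mul, one_mul, smul_mul_assoc, e3, mul_add, mul_one, add_mul, e2, mul_smul_comm,
    smul_mul_assoc, smul_add]
  simp only [mul_assoc]
  abel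

theorem EdgeData.alpha_a (H : EdgeData c a₁ a₂ d₁ d₂ r s t u w w' k) :
    r * a₂ * (1 + c • (a₁ * d₁)) = (1 + c • (a₁ * d₁)) * u * a₂ := by
  have e3 : a₁ * d₁ * u * a₂ = r * a₂ * a₁ * d₁ + k * a₂ := by
    rw [← H.aw, mul_assoc a₁, mul_assoc a₁, H.da', mul_add]
    simp only [← mul_assoc]
    rw [← H.aa']
    simp only [← mul_assoc]
  rw [mul_add, mul_one, mul_smul_comm, add_mul, add_mul, one_mul, smul_mul_assoc, smul_mul_assoc,
    e3]
  nth_rewrite 1 [H.hecke]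
  rw [add_mul, smul_mul_assoc, smul_add]
  simp only [mul_assoc]
  abel

theorem EdgeData.beta_d (H : EdgeData c a₁ a₂ d₁ d₂ r s t u w w' k) :
    (1 + c • (d₁ * a₁)) * r * d₂ = u * d₂ * (1 + c • (d₁ * a₁)) := by
  have e1 : u * (d₂ * d₁) = d₁ * d₂ * s := by
    calc u * (d₂ * d₁) = u * (d₂ * d₁ * r) * s := by simp only [mul_assoc]; rw [H.hr, mul_one]
      _ = _ := by rw [← H.dd, ← mul_assoc u, H.ht', one_mul]
  have e3 : u * d₂ * (d₁ * a₁) = d₁ * a₁ * r * d₂ + k * d₂ := by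
    rw [← H.dw, mul_assoc d₁ a₁, mul_assoc d₁, ← mul_add, ← H.da]
    simp only [← mul_assoc] at e1 ⊢
    rw [e1]
  rw [mul_add, mul_one, mul_smul_comm, e3, add_mul, add_mul, one_mul, smul_mul_assoc,
    smul_mul_assoc]
  nth_rewrite 1 [H.hecke]
  rw [add_mul, smul_mul_assoc, smul_add]
  abel

theorem EdgeData.alpha_d (H : EdgeData c a₁ a₂ d₁ d₂ r s t u w w' k) :
    (1 + c • (a₁ * d₁)) * d₂ * t = d₂ * s * (1 + c • (a₁ * d₁)) := by
  have e3 : a₁ * d₁ * d₂ * t + d₂ * k = d₂ * s * (a₁ * d₁) := by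
    rw [← H.wd, ← mul_assoc, H.da, add_mul, mul_assoc a₁ d₁, mul_assoc a₁, ← H.dd']
    simp only [mul_assoc]
  rw [mul_add, mul_one, mul_smul_comm, ← e3, add_mul, add_mul, one_mul, smul_mul_assoc,
    smul_mul_assoc, smul_add]
  nth_rewrite 1 [H.hecke']
  rw [mul_add, mul_smul_comm]
  abel

/-- The moment map identity for an edge between distinct vertices; `m` and `g` stand for the
two factors of the edge map. -/
theorem EdgeData.moment (H : EdgeData c a₁ a₂ d₁ d₂ r s t u w w' k) {g pa pb : A}
    (hg : (1 + c • (a₁ * d₁)) * g = 1) (hg' : g * (1 + c • (a₁ * d₁)) = 1)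
    (ha : pa * a₂ = a₂) (hab : a₂ * pb = a₂) (hd : pb * d₂ = d₂) (hda : d₂ * pa = d₂)
    (hra : (1 + c • (d₁ * a₁)) * u * pa = u * (1 + c • (d₁ * a₁)) * pa)
    (hta : pa * t * (1 + c • (d₁ * a₁)) = pa * (1 + c • (d₁ * a₁)) * t)
    (hsb : pb * s * g = pb * g * s) (hrb : g * r * pb = r * g * pb) :
    Commute (t * ((1 + c • (d₁ * a₁)) * g) * r) a₂ ∧
      Commute (t * ((1 + c • (d₁ * a₁)) * g) * r) d₂ := by
  have E1 := H.beta_a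
  have E2 := H.alpha_a
  have E3 := H.beta_d
  have E4 := H.alpha_d
  generalize 1 + c • (d₁ * a₁) = m at *
  generalize 1 + c • (a₁ * d₁) = n at *
  have F2 : g * r * a₂ = u * a₂ * g := by
    calc g * r * a₂ = g * (r * a₂ * n) * g := by simp only [mul_assoc]; rw [hg, mul_one]
      _ = _ := by rw [E2]; simp only [← mul_assoc]; rw [hg', one_mul]
  have F4 : g * d₂ * s = d₂ * t * g := by
    calc g * d₂ * s = g * (d₂ * s * n) * g := by simp only [mul_assoc]; rw [hg, mul_one]
      _ = _ := by rw [← E4]; simp only [← mul_assoc]; rw [hg', one_mul]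
  constructor
  · show t * (m * g) * r * a₂ = a₂ * (t * (m * g) * r)
    have h1 : a₂ * t * m = m * a₂ * s := by
      rw [E1]; simp only [mul_assoc]; rw [H.hr, mul_one]
    have h2 : a₂ * s * g = a₂ * g * s := by
      calc a₂ * s * g = a₂ * (pb * s * g) := by simp only [← mul_assoc, hab]
        _ = a₂ * g * s := by rw [hsb]; simp only [← mul_assoc, hab]
    have h3 : t * m * u * a₂ = m * a₂ := by
      calc t * m * u * a₂ = t * (m * u * pa) * a₂ := by simp only [mul_assoc, ha]
        _ = m * a₂ := by rw [hra]; simp only [← mul_assoc]; rw [H.ht, one_mul, mul_assoc, ha]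
    calc t * (m * g) * r * a₂ = t * m * (g * r * a₂) := by simp only [mul_assoc]
      _ = t * m * u * a₂ * g := by rw [F2]; simp only [mul_assoc]
      _ = m * (a₂ * g * s) * r := by rw [h3]; simp only [mul_assoc]; rw [H.hr', mul_one]
      _ = (a₂ * t * m) * g * r := by rw [← h2, h1]; simp only [mul_assoc]
      _ = _ := by simp only [mul_assoc]
  · show t * (m * g) * r * d₂ = d₂ * (t * (m * g) * r)
    have h1 : g * r * d₂ = r * g * d₂ := by
      calc g * r * d₂ = g * r * pb * d₂ := by rw [mul_assoc _ pb, hd]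
        _ = r * g * d₂ := by rw [hrb]; simp only [mul_assoc, hd]
    have h2 : d₂ * m * t = d₂ * t * m := by
      calc d₂ * m * t = d₂ * (pa * m * t) := by simp only [← mul_assoc, hda]
        _ = d₂ * t * m := by rw [← hta]; simp only [← mul_assoc, hda]
    calc t * (m * g) * r * d₂ = t * m * (g * r * d₂) := by simp only [mul_assoc]
      _ = t * m * r * (g * d₂ * s) * r := by
        rw [h1]; simp only [mul_assoc]; rw [H.hr', mul_one]
      _ = t * (m * r * d₂) * t * g * r := by rw [F4]; simp only [mul_assoc]
      _ = d₂ * m * t * g * r := by rw [E3]; simp only [← mul_assoc]; rw [H.ht, one_mul]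
      _ = _ := by rw [h2]; simp only [mul_assoc]

/-- Relations of a loop. -/
structure LoopData (a₁ a₂ d₁ d₂ g h p p' r s t u : A) : Prop where
  hr : r * s = 1
  hr' : s * r = 1
  ht : t * u = 1
  ht' : u * t = 1
  aa : t * a₁ * r * a₂ = a₂ * t * a₁ * r
  aa' : r * a₂ * t * a₁ = a₁ * r * a₂ * t
  dd : t * d₁ * r * d₂ = d₂ * t * d₁ * r
  dd' : r * d₂ * t * d₁ = d₁ * r * d₂ * t
  da : t * d₁ * r * a₂ = a₂ * t * d₁ * u
  da' : r * d₂ * t * a₁ = a₁ * r * d₂ * s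
  ag : a₁ * g = p
  ga : g * a₁ = p
  dh : d₁ * h = p
  hd : h * d₁ = p
  pg : p * g = g
  gp : g * p = g
  ph : p * h = h
  hp : h * p = h
  pr : Commute p r
  ps : Commute p s
  pt : Commute p t
  pu : Commute p u
  pa : Commute p a₂
  pd : Commute p d₂
  pa₂ : p' * a₂ = a₂
  ap₂ : a₂ * p' = a₂
  pd₂ : p' * d₂ = d₂
  dp₂ : d₂ * p' = d₂
  tr : (1 - p) * p' * (t * r) = (1 - p) * p'
  tr' : t * r * ((1 - p) * p') = (1 - p) * p'

theorem move_inv {a g p x y : A} (ag : a * g = p) (ga : g * a = p) (pg : p * g = g)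
    (gp : g * p = g) (px : Commute p x) (py : Commute p y) (h : x * a = a * y) :
    g * x = y * g := by
  calc g * x = g * p * x := by rw [gp]
    _ = g * (x * a) * g := by rw [mul_assoc, px.eq, ← ag]; simp only [mul_assoc]
    _ = p * y * g := by rw [h, ← ga]; simp only [mul_assoc]
    _ = y * g := by rw [py.eq, mul_assoc, pg]

theorem LoopData.moment_a {a₁ a₂ d₁ d₂ g h p p' r s t u : A}
    (H : LoopData a₁ a₂ d₁ d₂ g h p p' r s t u) :
    Commute (t * (d₁ * g * h * a₁) * r) a₂ := by
  have e1 : u * a₂ * t * d₁ = d₁ * (r * a₂ * t) := by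
    calc u * a₂ * t * d₁ = u * (a₂ * t * d₁ * u) * t := by
          simp only [mul_assoc]; rw [H.ht', mul_one]
      _ = _ := by rw [← H.da]; simp only [← mul_assoc]; rw [H.ht', one_mul]
  have e2 : u * a₂ * t * a₁ = a₁ * (r * a₂ * s) := by
    calc u * a₂ * t * a₁ = u * (a₂ * t * a₁ * r) * s := by
          simp only [mul_assoc]; rw [H.hr, mul_one]
      _ = _ := by rw [← H.aa]; simp only [← mul_assoc]; rw [H.ht', one_mul]
  have c1 : Commute p (u * a₂ * t) := (H.pu.mul_right H.pa).mul_right H.pt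
  have c2 : Commute p (r * a₂ * t) := (H.pr.mul_right H.pa).mul_right H.pt
  have e3 : g * (r * a₂ * t) = r * a₂ * t * g :=
    move_inv H.ag H.ga H.pg H.gp c2 c2 (by rw [H.aa']; simp only [mul_assoc])
  have e4 : h * (u * a₂ * t) = r * a₂ * t * h := move_inv H.dh H.hd H.ph H.hp c1 c2 e1
  show t * (d₁ * g * h * a₁) * r * a₂ = a₂ * (t * (d₁ * g * h * a₁) * r)
  calc t * (d₁ * g * h * a₁) * r * a₂ = t * d₁ * g * h * (a₁ * (r * a₂ * s)) * r := by
        simp only [mul_assoc]; rw [H.hr', mul_one]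
    _ = t * d₁ * g * (h * (u * a₂ * t)) * a₁ * r := by rw [← e2]; simp only [mul_assoc]
    _ = t * d₁ * (g * (r * a₂ * t)) * h * a₁ * r := by rw [e4]; simp only [mul_assoc]
    _ = t * (d₁ * (r * a₂ * t)) * g * h * a₁ * r := by rw [e3]; simp only [mul_assoc]
    _ = t * u * (a₂ * t * d₁ * g * h * a₁ * r) := by rw [← e1]; simp only [mul_assoc]
    _ = _ := by rw [H.ht, one_mul]; simp only [mul_assoc]

theorem LoopData.moment_d {a₁ a₂ d₁ d₂ g h p p' r s t u : A}
    (H : LoopData a₁ a₂ d₁ d₂ g h p p' r s t u) :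
    Commute (t * (d₁ * g * h * a₁) * r) d₂ := by
  have e2 : u * d₂ * t * d₁ = d₁ * (r * d₂ * s) := by
    calc u * d₂ * t * d₁ = u * (d₂ * t * d₁ * r) * s := by
          simp only [mul_assoc]; rw [H.hr, mul_one]
      _ = _ := by rw [← H.dd]; simp only [← mul_assoc]; rw [H.ht', one_mul]
  have c1 : Commute p (r * d₂ * s) := (H.pr.mul_right H.pd).mul_right H.ps
  have c2 : Commute p (r * d₂ * t) := (H.pr.mul_right H.pd).mul_right H.pt
  have e3 : g * (r * d₂ * t) = r * d₂ * s * g :=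
    move_inv H.ag H.ga H.pg H.gp c2 c1 (by rw [H.da']; simp only [mul_assoc])
  have e4 : h * (r * d₂ * t) = r * d₂ * t * h :=
    move_inv H.dh H.hd H.ph H.hp c2 c2 (by rw [H.dd']; simp only [mul_assoc])
  have e1 : r * d₂ * t * a₁ = a₁ * (r * d₂ * s) := by rw [H.da']; simp only [mul_assoc]
  show t * (d₁ * g * h * a₁) * r * d₂ = d₂ * (t * (d₁ * g * h * a₁) * r)
  calc t * (d₁ * g * h * a₁) * r * d₂ = t * d₁ * g * h * (a₁ * (r * d₂ * s)) * r := by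
        simp only [mul_assoc]; rw [H.hr', mul_one]
    _ = t * d₁ * g * (h * (r * d₂ * t)) * a₁ * r := by rw [← e1]; simp only [mul_assoc]
    _ = t * d₁ * (g * (r * d₂ * t)) * h * a₁ * r := by rw [e4]; simp only [mul_assoc]
    _ = t * (d₁ * (r * d₂ * s)) * g * h * a₁ * r := by rw [e3]; simp only [mul_assoc]
    _ = t * u * (d₂ * t * d₁ * g * h * a₁ * r) := by rw [← e2]; simp only [mul_assoc]
    _ = _ := by rw [H.ht, one_mul]; simp only [mul_assoc]

/-- The moment map identity for a loop. -/
theorem LoopData.moment {a₁ a₂ d₁ d₂ g h p p' r s t u : A}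
    (H : LoopData a₁ a₂ d₁ d₂ g h p p' r s t u) :
    Commute (t * (1 - p + d₁ * g * h * a₁) * r) a₂ ∧
      Commute (t * (1 - p + d₁ * g * h * a₁) * r) d₂ := by
  have e : t * (1 - p) * r = (1 - p) * (t * r) := by
    rw [mul_sub, mul_one, ← H.pt.eq]; simp only [sub_mul, one_mul, mul_assoc]
  have e' : t * (1 - p) * r = t * r * (1 - p) := by
    rw [mul_assoc t, sub_mul, one_mul, H.pr.eq]; simp only [mul_sub, mul_one, mul_assoc]
  have key : ∀ y : A, p' * y = y → y * p' = y → Commute p y →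
      Commute (t * (d₁ * g * h * a₁) * r) y →
      Commute (t * (1 - p + d₁ * g * h * a₁) * r) y := by
    intro y h1 h2 h3 h4
    rw [mul_add, add_mul]
    refine Commute.add_left ?_ h4
    have h5 : Commute (1 - p) y := (Commute.one_left y).sub_left h3
    show t * (1 - p) * r * y = y * (t * (1 - p) * r)
    calc t * (1 - p) * r * y = t * r * ((1 - p) * p') * y := by
          rw [e']; simp only [mul_assoc, h1]
      _ = y * (1 - p) := by rw [H.tr', mul_assoc, h1, h5.eq]
      _ = (1 - p) * y * p' := by rw [mul_assoc, h2, h5.eq]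
      _ = y * ((1 - p) * p') := by rw [h5.eq, mul_assoc]
      _ = _ := by
        rw [← H.tr, e]
        have : y * (1 - p) * p' = y * (1 - p) := by rw [← h5.eq, mul_assoc, h2]
        simp only [← mul_assoc, this]
  exact ⟨key a₂ H.pa₂ H.ap₂ H.pa H.moment_a, key d₂ H.pd₂ H.dp₂ H.pd H.moment_d⟩

end MomentRing

section Moment
variable {V E : Type u} [Fintype V] [DecidableEq V] [LinearOrder E] (Q : DimQuiver V E) (q : ℂ)

/-- The edge map of `e`. If `e` is not a loop, this matrix has the block `1 + (q - q⁻¹) ∂ a` at the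
head of `e` and the block `(1 + (q - q⁻¹) a ∂)⁻¹` at its tail; for a loop, it has the block
`∂ a⁻¹ ∂⁻¹ a` at its vertex. The other blocks are trivial. -/
noncomputable def edgeMat (e : E) : Matrix Q.Idx Q.Idx (D Q q) :=
  if Q.α e = Q.β e then
    1 - scal _ (proj Q (Q.α e)) + Dmat Q q e .d * Dmat Q q e .g * Dmat Q q e .h * Dmat Q q e .a
  else (1 + (q - q⁻¹) • (Dmat Q q e .d * Dmat Q q e .a)) * Dmat Q q e .g

/-- The inverse of `edgeMat`. -/
noncomputable def edgeInv (e : E) : Matrix Q.Idx Q.Idx (D Q q) :=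
  if Q.α e = Q.β e then
    1 - scal _ (proj Q (Q.α e)) + Dmat Q q e .g * Dmat Q q e .d * Dmat Q q e .a * Dmat Q q e .h
  else (1 + (q - q⁻¹) • (Dmat Q q e .a * Dmat Q q e .d)) * Dmat Q q e .h

variable [Fintype E]

/-- The moment map, on the matrix of generators: the product over the edges, in increasing
order. -/
noncomputable def momentMat : Matrix Q.Idx Q.Idx (D Q q) :=
  ((Finset.univ.sort (· ≤ ·)).map (edgeMat Q q)).prod

/-- The inverse of `momentMat`. -/
noncomputable def momentInv : Matrix Q.Idx Q.Idx (D Q q) :=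
  ((Finset.univ.sort (· ≤ ·)).reverse.map (edgeInv Q q)).prod

end Moment

section MomentProof
variable {V E : Type u} [Fintype V] [DecidableEq V] [LinearOrder E] (Q : DimQuiver V E) (q : ℂ)

theorem tw_slot₁' {n S : Type*} [Fintype n] [DecidableEq n] [Ring S] (X : Matrix n n S) :
    tw (slot₁ X) = slot₂ X := by
  ext ⟨a, b⟩ ⟨c, e⟩
  simp [tw_apply, slot₁_apply, slot₂_apply]

theorem tw_slot₂' {n S : Type*} [Fintype n] [DecidableEq n] [Ring S] (X : Matrix n n S) :
    tw (slot₂ X) = slot₁ X := by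
  ext ⟨a, b⟩ ⟨c, e⟩
  simp [tw_apply, slot₁_apply, slot₂_apply]

theorem tw_scal {n S : Type*} [Fintype n] [DecidableEq n] [Ring S] [Algebra ℂ S]
    (C : Matrix (n × n) (n × n) ℂ) : tw (scal S C) = scal S (tw C) := by
  ext ⟨a, b⟩ ⟨c, e⟩
  simp [tw_apply, scal]

theorem tw_tau : tw (tau Q) = tau Q := by
  ext ⟨a, b⟩ ⟨c, e⟩
  simp [tw_apply, tau, Prod.ext_iff, and_comm]

theorem tau_mul_slot₁ {S : Type*} [Ring S] [Algebra ℂ S] (Y : Matrix Q.Idx Q.Idx S) :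
    scal S (tau Q) * slot₁ Y = slot₂ Y * scal S (tau Q) := by
  ext ⟨a, b⟩ ⟨c, e⟩
  simp [Matrix.mul_apply, Fintype.sum_prod_type, slot₁_apply, slot₂_apply, tau, scal,
    Prod.ext_iff, ite_and, apply_ite (algebraMap ℂ S)]

theorem tau_mul_slot₂ {S : Type*} [Ring S] [Algebra ℂ S] (Y : Matrix Q.Idx Q.Idx S) :
    scal S (tau Q) * slot₂ Y = slot₁ Y * scal S (tau Q) := by
  ext ⟨a, b⟩ ⟨c, e⟩
  simp [Matrix.mul_apply, Fintype.sum_prod_type, slot₁_apply, slot₂_apply, tau, scal,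
    Prod.ext_iff, ite_and, apply_ite (algebraMap ℂ S)]

/-- Matrices which respect the vertices and are trivial between distinct vertices. -/
structure IsLocal (X : Matrix (Q.Idx × Q.Idx) (Q.Idx × Q.Idx) ℂ) : Prop where
  comm₁ : ∀ v, Commute X (slot₁ (proj Q v))
  comm₂ : ∀ v, Commute X (slot₂ (proj Q v))
  triv : ∀ v w, v ≠ w → slot₁ (proj Q v) * slot₂ (proj Q w) * X =
    slot₁ (proj Q v) * slot₂ (proj Q w)

theorem slot_comm (v w : V) : Commute (slot₁ (proj Q v)) (slot₂ (proj Q w)) := by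
  simpa only [scal_complex] using commute_slot₁ (S := ℂ) (proj Q v) (proj Q w)

theorem isLocal_R : IsLocal Q (Rmat Q q) := ⟨Rmat_proj₁, Rmat_proj₂, fun _ _ h => Rmat_proj_proj h⟩

theorem IsLocal.tw {X : Matrix (Q.Idx × Q.Idx) (Q.Idx × Q.Idx) ℂ} (h : IsLocal Q X) :
    IsLocal Q (tw X) where
  comm₁ v := by simpa only [tw_slot₂'] using (h.comm₂ v).map QuiverQuantization.tw
  comm₂ v := by simpa only [tw_slot₁'] using (h.comm₁ v).map QuiverQuantization.tw
  triv v w hvw := by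
    have := congrArg QuiverQuantization.tw (h.triv w v hvw.symm)
    simp only [map_mul, tw_slot₁', tw_slot₂'] at this
    rw [(slot_comm Q v w).eq, this]

variable {Q} in
theorem IsLocal.comm_left {X : Matrix (Q.Idx × Q.Idx) (Q.Idx × Q.Idx) ℂ} (h : IsLocal Q X)
    {S : Type*} [Ring S] [Algebra ℂ S] {v w : V} (hvw : v ≠ w) {Y : Matrix Q.Idx Q.Idx S}
    (h1 : scal S (proj Q v) * Y = Y) (h2 : Y * scal S (proj Q v) = Y) :
    scal S (slot₂ (proj Q w)) * scal S X * slot₁ Y = scal S (slot₂ (proj Q w)) * slot₁ Y ∧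
    scal S (slot₂ (proj Q w)) * slot₁ Y * scal S X = scal S (slot₂ (proj Q w)) * slot₁ Y ∧
    slot₁ Y * scal S X * scal S (slot₂ (proj Q w)) = slot₁ Y * scal S (slot₂ (proj Q w)) ∧
    scal S X * slot₁ Y * scal S (slot₂ (proj Q w)) = slot₁ Y * scal S (slot₂ (proj Q w)) := by
  have t1 := congrArg (scal S) (h.triv v w hvw)
  have c1 := ((h.comm₁ v).map (scal S)).eq
  have c2 := ((h.comm₂ w).map (scal S)).eq
  have sc := ((slot_comm Q v w).map (scal S)).eq
  have y1 := congrArg slot₁ h1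
  have y2 := congrArg slot₁ h2
  have yc := (commute_slot₁ Y (proj Q w)).eq
  rw [slot₂_scal] at yc
  rw [map_mul, slot₁_scal] at y1 y2
  simp only [map_mul] at t1
  generalize scal S (slot₁ (proj Q v)) = p at *
  generalize scal S (slot₂ (proj Q w)) = p' at *
  generalize scal S X = x at *
  generalize slot₁ Y = y at *
  have x1 : p' * p * x = p' * p := by rw [← sc, t1]
  have x2 : x * p' * p = p' * p := by rw [c2, mul_assoc, c1, ← mul_assoc, x1]
  have k0 : p' * p * y = p' * y := by rw [mul_assoc, y1]
  have k1 : p' * x * y = p' * y := by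
    calc p' * x * y = p' * (x * p) * y := by rw [mul_assoc p' (x * p), mul_assoc x, y1, mul_assoc]
      _ = p' * y := by rw [c1, ← mul_assoc, x1, k0]
  have k2 : y * x * p' = y * p' := by
    calc y * x * p' = y * p * x * p' := by rw [y2]
      _ = y * (p * p' * x) := by rw [mul_assoc _ x, c2]; simp only [mul_assoc]
      _ = y * p' := by rw [t1, ← mul_assoc, y2]
  refine ⟨k1, ?_, k2, ?_⟩
  · rw [← yc, mul_assoc, ← c2, ← mul_assoc, k2]
  · rw [mul_assoc, yc, ← mul_assoc, c2, k1]

theorem IsLocal.comm_one_add {X : Matrix (Q.Idx × Q.Idx) (Q.Idx × Q.Idx) ℂ} (h : IsLocal Q X)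
    {S : Type*} [Ring S] [Algebra ℂ S] {v w : V} (hvw : v ≠ w) {Y : Matrix Q.Idx Q.Idx S}
    (h1 : scal S (proj Q v) * Y = Y) (h2 : Y * scal S (proj Q v) = Y) :
    scal S (slot₂ (proj Q w)) * scal S X * slot₁ (1 + Y) =
      scal S (slot₂ (proj Q w)) * slot₁ (1 + Y) * scal S X ∧
    slot₁ (1 + Y) * scal S X * scal S (slot₂ (proj Q w)) =
      scal S X * slot₁ (1 + Y) * scal S (slot₂ (proj Q w)) := by
  obtain ⟨k1, k2, k3, k4⟩ := h.comm_left hvw h1 h2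
  constructor
  · rw [map_add, map_one, mul_add, mul_add, add_mul, mul_one, mul_one, k1, k2]
  · rw [map_add, map_one, mul_add, add_mul, add_mul, add_mul, mul_one, one_mul, k3, k4]

theorem proj_orth {v w : V} (h : v ≠ w) : proj Q v * proj Q w = 0 := by
  rw [proj, proj, Matrix.diagonal_mul_diagonal, ← Matrix.diagonal_zero]
  congr 1
  ext i
  simp only [mul_ite, mul_one, mul_zero]
  grind

/-- `∑ v, P_v ⊗ P_v`, composed with the flip. -/
noncomputable def kap : Matrix (Q.Idx × Q.Idx) (Q.Idx × Q.Idx) ℂ :=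
  (∑ v, slot₁ (proj Q v) * slot₂ (proj Q v)) * tau Q

theorem tau_mul₁ (X : Matrix Q.Idx Q.Idx ℂ) : tau Q * slot₁ X = slot₂ X * tau Q := by
  simpa only [scal_complex] using tau_mul_slot₁ Q (S := ℂ) X

theorem tau_mul₂ (X : Matrix Q.Idx Q.Idx ℂ) : tau Q * slot₂ X = slot₁ X * tau Q := by
  simpa only [scal_complex] using tau_mul_slot₂ Q (S := ℂ) X

theorem kap₁ (v : V) : slot₁ (proj Q v) * kap Q = slot₁ (proj Q v) * slot₂ (proj Q v) * tau Q := by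
  rw [kap, ← mul_assoc, Finset.mul_sum, Finset.sum_eq_single v]
  · rw [← mul_assoc, ← map_mul, proj_idem]
  · intro w _ hw
    rw [← mul_assoc, ← map_mul, proj_orth Q hw.symm, map_zero, zero_mul]
  · simp

theorem kap₂ (v : V) : slot₂ (proj Q v) * kap Q = slot₁ (proj Q v) * slot₂ (proj Q v) * tau Q := by
  rw [kap, ← mul_assoc, Finset.mul_sum, Finset.sum_eq_single v]
  · rw [(slot_comm Q v v).eq, ← mul_assoc, ← map_mul, proj_idem]
  · intro w _ hw
    rw [(slot_comm Q w w).eq, ← mul_assoc, ← map_mul, proj_orth Q hw.symm, map_zero, zero_mul]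
  · simp

theorem kap_comm₂ (v : V) :
    kap Q * slot₂ (proj Q v) = slot₁ (proj Q v) * slot₂ (proj Q v) * tau Q := by
  rw [kap, mul_assoc, tau_mul₂, ← mul_assoc, Finset.sum_mul, Finset.sum_eq_single v]
  · rw [mul_assoc (slot₁ _), ← (slot_comm Q v v).eq, ← mul_assoc, ← map_mul, proj_idem]
  · intro w _ hw
    rw [mul_assoc, ← (slot_comm Q v w).eq, ← mul_assoc, ← map_mul, proj_orth Q hw, map_zero,
      zero_mul]
  · simp

theorem tw_kap : tw (kap Q) = kap Q := by
  rw [kap, map_mul, map_sum, tw_tau]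
  congr 1
  refine Finset.sum_congr rfl fun v _ => ?_
  rw [map_mul, tw_slot₁', tw_slot₂', (slot_comm Q v v).eq]

theorem hecke_kap : Rmat Q q = tw (Rmat Q q⁻¹) + (q - q⁻¹) • kap Q := by
  rw [← sub_eq_iff_eq_add', hecke]; rfl

theorem scal_smul {n S : Type*} [Fintype n] [DecidableEq n] [Ring S] [Algebra ℂ S] (c : ℂ)
    (C : Matrix n n ℂ) : scal S (c • C) = c • scal S C := by
  ext i j
  show algebraMap ℂ S (c * C i j) = c • algebraMap ℂ S (C i j)
  rw [map_mul, Algebra.smul_def]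

variable [NeZero q]

theorem pa_mul (e : E) : scal _ (proj Q (Q.α e)) * Dmat Q q e .a = Dmat Q q e .a := by
  have hP := congrArg (scal (D Q q)) (proj_idem Q (Q.α e))
  rw [map_mul] at hP
  rw [Dmat_a]; simp only [← mul_assoc, hP]

theorem a_mul (e : E) : Dmat Q q e .a * scal _ (proj Q (Q.β e)) = Dmat Q q e .a := by
  have hP := congrArg (scal (D Q q)) (proj_idem Q (Q.β e))
  rw [map_mul] at hP
  rw [Dmat_a]; simp only [mul_assoc, hP]

theorem pd_mul (e : E) : scal _ (proj Q (Q.β e)) * Dmat Q q e .d = Dmat Q q e .d := by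
  have hP := congrArg (scal (D Q q)) (proj_idem Q (Q.β e))
  rw [map_mul] at hP
  rw [Dmat_d]; simp only [← mul_assoc, hP]

theorem d_mul (e : E) : Dmat Q q e .d * scal _ (proj Q (Q.α e)) = Dmat Q q e .d := by
  have hP := congrArg (scal (D Q q)) (proj_idem Q (Q.α e))
  rw [map_mul] at hP
  rw [Dmat_d]; simp only [mul_assoc, hP]

theorem re_D (e : E) (y : Sym) (hy : y = .a ∨ y = .d) :
    scal _ (tw (Rmat Q q)) * slot₁ (Dmat Q q e y) * scal _ (Rmat Q q) * slot₂ (Dmat Q q e y) =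
    slot₂ (Dmat Q q e y) * scal _ (tw (Rmat Q q)) * slot₁ (Dmat Q q e y) * scal _ (Rmat Q q) := by
  simpa only [map_mul, mkMat_slot₁, mkMat_slot₂, mkMat_scal, mkMat_freeD]
    using mkMat_rel₂ Q q (DRel₂.re e y hy)

theorem da_D (e : E) (he : Q.α e ≠ Q.β e) :
    slot₂ (Dmat Q q e .d) * scal _ (Rmat Q q⁻¹) * slot₁ (Dmat Q q e .a) =
      slot₁ (Dmat Q q e .a) * scal _ (Rmat Q q) * slot₂ (Dmat Q q e .d) +
        scal _ (slot₁ (proj Q (Q.α e)) * slot₂ (proj Q (Q.β e)) * tau Q) := by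
  have h := mkMat_rel₂ Q q (DRel₂.da e he)
  rw [map_add, mkMat_scal] at h
  simpa only [map_mul (mkMat Q q _), mkMat_slot₁, mkMat_slot₂, mkMat_scal, mkMat_freeD] using h

theorem da_loop_D (e : E) (he : Q.α e = Q.β e) :
    scal _ (tw (Rmat Q q)) * slot₁ (Dmat Q q e .d) * scal _ (Rmat Q q) * slot₂ (Dmat Q q e .a) =
      slot₂ (Dmat Q q e .a) * scal _ (tw (Rmat Q q)) * slot₁ (Dmat Q q e .d) *
        scal _ (tw (Rmat Q q⁻¹)) := by
  simpa only [map_mul, mkMat_slot₁, mkMat_slot₂, mkMat_scal, mkMat_freeD]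
    using mkMat_rel₂ Q q (DRel₂.da_loop e he)

theorem cross_D (e f : E) (hef : e < f) (y z : Sym) (hy : y = .a ∨ y = .d)
    (hz : z = .a ∨ z = .d) :
    slot₁ (Dmat Q q f z) * scal _ (Rmat Q q) * slot₂ (Dmat Q q e y) * scal _ (Rmat Q q⁻¹) =
      scal _ (Rmat Q q) * slot₂ (Dmat Q q e y) * scal _ (Rmat Q q⁻¹) * slot₁ (Dmat Q q f z) := by
  simpa only [map_mul, mkMat_slot₁, mkMat_slot₂, mkMat_scal, mkMat_freeD]
    using mkMat_rel₂ Q q (DRel₂.cross e f hef y z hy hz)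

theorem scal_inv {S : Type*} [Ring S] [Algebra ℂ S] :
    scal S (Rmat Q q) * scal S (Rmat Q q⁻¹) = 1 ∧ scal S (Rmat Q q⁻¹) * scal S (Rmat Q q) = 1 ∧
    scal S (tw (Rmat Q q)) * scal S (tw (Rmat Q q⁻¹)) = 1 ∧
    scal S (tw (Rmat Q q⁻¹)) * scal S (tw (Rmat Q q)) = 1 := by
  refine ⟨?_, ?_, ?_, ?_⟩ <;> rw [← map_mul]
  · rw [Rmat_mul_inv (NeZero.ne q), map_one]
  · rw [Rmat_inv_mul (NeZero.ne q), map_one]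
  · rw [tw_mul_inv (NeZero.ne q), map_one]
  · rw [tw_inv_mul (NeZero.ne q), map_one]

/-- Between distinct vertices a local matrix drops out. -/
theorem drop₁ {X : Matrix (Q.Idx × Q.Idx) (Q.Idx × Q.Idx) ℂ} (hX : IsLocal Q X) {v w : V}
    (hvw : v ≠ w) {Y Z : Matrix Q.Idx Q.Idx (D Q q)} (hY : Y * scal _ (proj Q v) = Y)
    (hZ : scal _ (proj Q w) * Z = Z) :
    slot₁ Y * scal _ X * slot₂ Z = slot₁ Y * slot₂ Z := by
  have t1 := congrArg (scal (D Q q)) (hX.triv v w hvw)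
  have c2 := ((hX.comm₂ w).map (scal (D Q q))).eq
  have y := congrArg slot₁ hY
  have z := congrArg slot₂ hZ
  rw [map_mul, slot₁_scal] at y
  rw [map_mul, slot₂_scal] at z
  simp only [map_mul] at t1
  calc slot₁ Y * scal _ X * slot₂ Z = slot₁ Y * (scal _ (slot₁ (proj Q v)) * (scal _ X *
        scal _ (slot₂ (proj Q w)))) * slot₂ Z := by
        conv_lhs => rw [← y, ← z]
        simp only [mul_assoc]
    _ = slot₁ Y * scal _ (slot₁ (proj Q v)) * (scal _ (slot₂ (proj Q w)) * slot₂ Z) := by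
        rw [c2, ← mul_assoc (scal _ (slot₁ _)), t1]; simp only [mul_assoc]
    _ = _ := by rw [y, z]

theorem drop₂ {X : Matrix (Q.Idx × Q.Idx) (Q.Idx × Q.Idx) ℂ} (hX : IsLocal Q X) {v w : V}
    (hvw : v ≠ w) {Y Z : Matrix Q.Idx Q.Idx (D Q q)} (hY : Y * scal _ (proj Q v) = Y)
    (hZ : scal _ (proj Q w) * Z = Z) :
    slot₂ Y * scal _ X * slot₁ Z = slot₂ Y * slot₁ Z := by
  have h := congrArg tw (drop₁ Q q (hX.tw) hvw hY hZ)
  simpa only [map_mul, tw_slot₁', tw_slot₂', tw_scal, tw_tw] using h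

theorem edgeData (e : E) (he : Q.α e ≠ Q.β e) : EdgeData (q - q⁻¹)
    (slot₁ (Dmat Q q e .a)) (slot₂ (Dmat Q q e .a)) (slot₁ (Dmat Q q e .d))
    (slot₂ (Dmat Q q e .d)) (scal _ (Rmat Q q)) (scal _ (Rmat Q q⁻¹)) (scal _ (tw (Rmat Q q)))
    (scal _ (tw (Rmat Q q⁻¹)))
    (scal _ (slot₁ (proj Q (Q.α e)) * slot₂ (proj Q (Q.β e)) * tau Q))
    (scal _ (slot₂ (proj Q (Q.α e)) * slot₁ (proj Q (Q.β e)) * tau Q))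
    (scal _ (kap Q)) := by
  have hk : scal (D Q q) (Rmat Q q) = scal _ (tw (Rmat Q q⁻¹)) + (q - q⁻¹) • scal _ (kap Q) := by
    rw [← scal_smul, ← map_add, ← hecke_kap]
  have hk' : scal (D Q q) (tw (Rmat Q q)) = scal _ (Rmat Q q⁻¹) + (q - q⁻¹) • scal _ (kap Q) := by
    have h : tw (Rmat Q q) = Rmat Q q⁻¹ + (q - q⁻¹) • kap Q := by
      have h := congrArg tw (hecke_kap Q q)
      rw [map_add, tw_tw] at h
      rw [h]
      congr 1
      have h2 : tw ((q - q⁻¹) • kap Q) = (q - q⁻¹) • tw (kap Q) := by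
        ext ⟨a, b⟩ ⟨c, d⟩
        simp [tw_apply]
      rw [h2, tw_kap]
    rw [← scal_smul, ← map_add, ← h]
  have haa : scal (D Q q) (tw (Rmat Q q)) * (slot₁ (Dmat Q q e .a) * slot₂ (Dmat Q q e .a)) =
      slot₂ (Dmat Q q e .a) * slot₁ (Dmat Q q e .a) * scal _ (Rmat Q q) := by
    have h := re_D Q q e .a (Or.inl rfl)
    rw [mul_assoc _ (slot₁ _), mul_assoc _ _ (slot₂ _),
      drop₁ Q q (isLocal_R Q q) he.symm (a_mul Q q e) (pa_mul Q q e),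
      drop₂ Q q (isLocal_R Q q).tw he.symm (a_mul Q q e) (pa_mul Q q e)] at h
    exact h
  have hdd : scal (D Q q) (tw (Rmat Q q)) * (slot₁ (Dmat Q q e .d) * slot₂ (Dmat Q q e .d)) =
      slot₂ (Dmat Q q e .d) * slot₁ (Dmat Q q e .d) * scal _ (Rmat Q q) := by
    have h := re_D Q q e .d (Or.inr rfl)
    rw [mul_assoc _ (slot₁ _), mul_assoc _ _ (slot₂ _),
      drop₁ Q q (isLocal_R Q q) he (d_mul Q q e) (pd_mul Q q e),
      drop₂ Q q (isLocal_R Q q).tw he (d_mul Q q e) (pd_mul Q q e)] at h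
    exact h
  have hda := da_D Q q e he
  have a1 := congrArg slot₁ (pa_mul Q q e)
  have a2 := congrArg slot₂ (pa_mul Q q e)
  have a3 := congrArg slot₁ (a_mul Q q e)
  have a4 := congrArg slot₂ (a_mul Q q e)
  have d1 := congrArg slot₁ (pd_mul Q q e)
  have d2 := congrArg slot₂ (pd_mul Q q e)
  have d3 := congrArg slot₁ (d_mul Q q e)
  have d4 := congrArg slot₂ (d_mul Q q e)
  simp only [map_mul] at a1 a2 a3 a4 d1 d2 d3 d4
  have τ1 := fun Y : Matrix Q.Idx Q.Idx (D Q q) => tau_mul_slot₁ Q Y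
  have τ2 := fun Y : Matrix Q.Idx Q.Idx (D Q q) => tau_mul_slot₂ Q Y
  have ck := fun (Y : Matrix Q.Idx Q.Idx (D Q q)) v => (commute_slot₁ Y (proj Q v)).eq
  have ck' := fun (Y : Matrix Q.Idx Q.Idx (D Q q)) v => (commute_slot₂ Y (proj Q v)).eq
  have k2 := fun v => congrArg (scal (D Q q)) (kap₂ Q v)
  have k3 := fun v => congrArg (scal (D Q q)) (kap_comm₂ Q v)
  simp only [map_mul, ← slot₁_scal, ← slot₂_scal] at k2 k3
  simp only [slot₁_scal, slot₂_scal] at a1 a2 a3 a4 d1 d2 d3 d4 ck ck' k2 k3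
  have scP := fun v w => ((slot_comm Q v w).map (scal (D Q q))).eq
  refine
  { hr := (scal_inv Q q).1
    hr' := (scal_inv Q q).2.1
    ht := (scal_inv Q q).2.2.1
    ht' := (scal_inv Q q).2.2.2
    hecke := hk
    hecke' := hk'
    aa := haa
    aa' := by simpa only [map_mul, tw_slot₁', tw_slot₂', tw_scal, tw_tw] using congrArg tw haa
    dd := hdd
    dd' := by simpa only [map_mul, tw_slot₁', tw_slot₂', tw_scal, tw_tw] using congrArg tw hdd
    da := hda
    da' := by
      simpa only [map_add, map_mul, tw_slot₁', tw_slot₂', tw_scal, tw_tw, tw_tau]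
        using congrArg tw hda
    wa := ?_
    aw := ?_
    wd := ?_
    dw := ?_ }
  · rw [map_mul, map_mul, mul_assoc, τ1]
    conv_rhs => rw [← a4, mul_assoc _ _ (scal _ (kap Q)), k2, scP]
    simp only [← mul_assoc]
    rw [a4, mul_assoc _ _ (slot₂ _), ← ck', ← mul_assoc, a2]
  · rw [map_mul, map_mul, ← mul_assoc, ← mul_assoc, ck]
    conv_rhs => rw [← a2, ← mul_assoc, k3, mul_assoc, τ2, scP]
    rw [mul_assoc _ (slot₁ _), a3, ← mul_assoc, mul_assoc _ _ (slot₁ _), a1]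
  · rw [map_mul, map_mul, mul_assoc, τ1]
    conv_rhs => rw [← d4, mul_assoc _ _ (scal _ (kap Q)), k2, scP]
    simp only [← mul_assoc]
    rw [d4, mul_assoc _ _ (slot₂ _), d2, ← ck']
  · rw [map_mul, map_mul, ← mul_assoc, ← mul_assoc, d3]
    conv_rhs => rw [← d2, ← mul_assoc, k3, mul_assoc, τ2, scP]
    rw [← mul_assoc, mul_assoc _ _ (slot₁ _), d1, ck]

end MomentProof

section MomentProof
variable {V E : Type u} [Fintype V] [DecidableEq V] [LinearOrder E] (Q : DimQuiver V E) (q : ℂ)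
variable [NeZero q]

/-- `Y` commutes with the moment matrix, in the sense of quantum moment maps. -/
def MComm (M Y : Matrix Q.Idx Q.Idx (D Q q)) : Prop :=
  Commute (scal _ (tw (Rmat Q q)) * slot₁ M * scal _ (Rmat Q q)) (slot₂ Y)

theorem g_D (e : E) (he : Q.α e ≠ Q.β e) :
    (1 + (q - q⁻¹) • (Dmat Q q e .a * Dmat Q q e .d)) * Dmat Q q e .g = 1 ∧
    Dmat Q q e .g * (1 + (q - q⁻¹) • (Dmat Q q e .a * Dmat Q q e .d)) = 1 ∧
    (1 + (q - q⁻¹) • (Dmat Q q e .d * Dmat Q q e .a)) * Dmat Q q e .h = 1 ∧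
    Dmat Q q e .h * (1 + (q - q⁻¹) • (Dmat Q q e .d * Dmat Q q e .a)) = 1 := by
  have h1 := mkMat_rel₁ Q q (DRel₁.g_right e he)
  have h2 := mkMat_rel₁ Q q (DRel₁.g_left e he)
  have h3 := mkMat_rel₁ Q q (DRel₁.h_right e he)
  have h4 := mkMat_rel₁ Q q (DRel₁.h_left e he)
  simp only [map_mul, map_add, map_one, mkMat_smul, mkMat_freeD] at h1 h2 h3 h4
  exact ⟨h1, h2, h3, h4⟩

theorem loop_D (e : E) (he : Q.α e = Q.β e) :
    Dmat Q q e .a * Dmat Q q e .g = scal _ (proj Q (Q.α e)) ∧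
    Dmat Q q e .g * Dmat Q q e .a = scal _ (proj Q (Q.α e)) ∧
    Dmat Q q e .d * Dmat Q q e .h = scal _ (proj Q (Q.α e)) ∧
    Dmat Q q e .h * Dmat Q q e .d = scal _ (proj Q (Q.α e)) := by
  have h1 := mkMat_rel₁ Q q (DRel₁.ag e he)
  have h2 := mkMat_rel₁ Q q (DRel₁.ga e he)
  have h3 := mkMat_rel₁ Q q (DRel₁.dh e he)
  have h4 := mkMat_rel₁ Q q (DRel₁.hd e he)
  simp only [map_mul, mkMat_scal, mkMat_freeD] at h1 h2 h3 h4
  exact ⟨h1, h2, h3, h4⟩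

theorem loop_supp (e : E) (he : Q.α e = Q.β e) :
    scal _ (proj Q (Q.α e)) * Dmat Q q e .g = Dmat Q q e .g ∧
    Dmat Q q e .g * scal _ (proj Q (Q.α e)) = Dmat Q q e .g ∧
    scal _ (proj Q (Q.α e)) * Dmat Q q e .h = Dmat Q q e .h ∧
    Dmat Q q e .h * scal _ (proj Q (Q.α e)) = Dmat Q q e .h := by
  have hP := congrArg (scal (D Q q)) (proj_idem Q (Q.α e))
  rw [map_mul] at hP
  have h1 := mkMat_rel₁ Q q (DRel₁.supp_g e he)
  have h2 := mkMat_rel₁ Q q (DRel₁.supp_h e he)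
  simp only [map_mul, mkMat_scal, mkMat_freeD] at h1 h2
  refine ⟨?_, ?_, ?_, ?_⟩
  · rw [h1]; simp only [← mul_assoc, hP]
  · rw [h1]; simp only [mul_assoc, hP]
  · rw [h2]; simp only [← mul_assoc, hP]
  · rw [h2]; simp only [mul_assoc, hP]

/-- An element which commutes with the images of `a` and `∂` commutes with the images of all
generators. -/
theorem comm_gen {B : Type*} [Ring B] (f : Matrix Q.Idx Q.Idx (D Q q) →+* B) (x : B) (e : E)
    (hs : ∀ (c : ℂ) Y, Commute x (f Y) → Commute x (f (c • Y)))
    (hp : ∀ v, Commute x (f (scal _ (proj Q v))))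
    (ha : Commute x (f (Dmat Q q e .a))) (hd : Commute x (f (Dmat Q q e .d))) (y : Sym) :
    Commute x (f (Dmat Q q e y)) := by
  have inv : ∀ m g : Matrix Q.Idx Q.Idx (D Q q), Commute x (f m) → m * g = 1 → g * m = 1 →
      Commute x (f g) := by
    intro m g hm h1 h2
    have h1' : f m * f g = 1 := by rw [← map_mul, h1, map_one]
    have h2' : f g * f m = 1 := by rw [← map_mul, h2, map_one]
    show x * f g = f g * x
    calc x * f g = f g * (f m * x) * f g := by rw [← mul_assoc, h2', one_mul]
      _ = f g * x := by rw [← hm.eq]; simp only [mul_assoc]; rw [h1', mul_one]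
  have blk : ∀ (m g : Matrix Q.Idx Q.Idx (D Q q)) (p : Matrix Q.Idx Q.Idx (D Q q)),
      Commute x (f m) → Commute x (f p) → m * g = p → g * m = p → p * g = g → g * p = g →
      Commute x (f g) := by
    intro m g p hm hp h1 h2 h3 h4
    have h1' := congrArg f h1
    have h2' := congrArg f h2
    have h3' := congrArg f h3
    have h4' := congrArg f h4
    rw [map_mul] at h1' h2' h3' h4'
    show x * f g = f g * x
    calc x * f g = x * f p * f g := by rw [mul_assoc, h3']
      _ = f g * (f m * x) * f g := by rw [hp.eq, ← h2']; simp only [mul_assoc]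
      _ = f g * (x * f p) := by rw [← hm.eq, ← h1']; simp only [mul_assoc]
      _ = f g * x := by rw [hp.eq, ← mul_assoc, h4']
  have h1 : Commute x (f 1) := by rw [map_one]; exact Commute.one_right x
  by_cases he : Q.α e = Q.β e
  · obtain ⟨l1, l2, l3, l4⟩ := loop_D Q q e he
    obtain ⟨s1, s2, s3, s4⟩ := loop_supp Q q e he
    cases y
    · exact ha
    · exact hd
    · exact blk _ _ _ ha (hp _) l1 l2 s1 s2
    · exact blk _ _ _ hd (hp _) l3 l4 s3 s4
  · obtain ⟨l1, l2, l3, l4⟩ := g_D Q q e he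
    cases y
    · exact ha
    · exact hd
    · refine inv _ _ ?_ l1 l2
      rw [map_add]
      exact h1.add_right (hs _ _ (by rw [map_mul]; exact ha.mul_right hd))
    · refine inv _ _ ?_ l3 l4
      rw [map_add]
      exact h1.add_right (hs _ _ (by rw [map_mul]; exact hd.mul_right ha))

theorem slot₂_smul {n S : Type*} [Fintype n] [DecidableEq n] [Ring S] [Algebra ℂ S] (c : ℂ)
    (Y : Matrix n n S) : slot₂ (c • Y) = c • slot₂ Y := by
  ext ⟨i, a⟩ ⟨j, b⟩
  simp [slot₂_apply]

theorem mcomm_proj (M : Matrix Q.Idx Q.Idx (D Q q)) (v : V) : MComm Q q M (scal _ (proj Q v)) := by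
  rw [MComm, slot₂_scal]
  refine Commute.mul_left (Commute.mul_left ?_ ?_) ?_
  · exact ((isLocal_R Q q).tw.comm₂ v).map (scal (D Q q))
  · rw [← slot₂_scal]
    exact commute_slot₁ _ _
  · exact ((isLocal_R Q q).comm₂ v).map (scal (D Q q))

theorem edge_moment_ne (e : E) (he : Q.α e ≠ Q.β e) :
    MComm Q q (edgeMat Q q e) (Dmat Q q e .a) ∧ MComm Q q (edgeMat Q q e) (Dmat Q q e .d) := by
  obtain ⟨l1, l2, -, -⟩ := g_D Q q e he
  have H := edgeData Q q e he
  have a2 := congrArg slot₂ (pa_mul Q q e)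
  have a4 := congrArg slot₂ (a_mul Q q e)
  have d2 := congrArg slot₂ (pd_mul Q q e)
  have d4 := congrArg slot₂ (d_mul Q q e)
  rw [map_mul, slot₂_scal] at a2 a4 d2 d4
  have m : slot₁ (1 + (q - q⁻¹) • (Dmat Q q e .d * Dmat Q q e .a)) =
      1 + (q - q⁻¹) • (slot₁ (Dmat Q q e .d) * slot₁ (Dmat Q q e .a)) := by
    rw [map_add, map_one, slot₁_smul, map_mul]
  have n : slot₁ (1 + (q - q⁻¹) • (Dmat Q q e .a * Dmat Q q e .d)) =
      1 + (q - q⁻¹) • (slot₁ (Dmat Q q e .a) * slot₁ (Dmat Q q e .d)) := by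
    rw [map_add, map_one, slot₁_smul, map_mul]
  have g1 := congrArg slot₁ l1
  have g2 := congrArg slot₁ l2
  rw [map_mul, n, map_one] at g1 g2
  have hY1 : scal _ (proj Q (Q.β e)) * ((q - q⁻¹) • (Dmat Q q e .d * Dmat Q q e .a)) =
      (q - q⁻¹) • (Dmat Q q e .d * Dmat Q q e .a) := by
    rw [mul_smul_comm, ← mul_assoc, pd_mul]
  have hY2 : ((q - q⁻¹) • (Dmat Q q e .d * Dmat Q q e .a)) * scal _ (proj Q (Q.β e)) =
      (q - q⁻¹) • (Dmat Q q e .d * Dmat Q q e .a) := by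
    rw [smul_mul_assoc, mul_assoc, a_mul]
  -- `g = 1 + z`, where `z` is concentrated at the tail of `e`
  obtain ⟨z, hz, hz1, hz2⟩ : ∃ z, Dmat Q q e .g = 1 + z ∧ scal _ (proj Q (Q.α e)) * z = z ∧
      z * scal _ (proj Q (Q.α e)) = z := by
    refine ⟨Dmat Q q e .g - 1, by abel, ?_, ?_⟩
    · have : Dmat Q q e .g - 1 =
          - ((q - q⁻¹) • (Dmat Q q e .a * Dmat Q q e .d * Dmat Q q e .g)) := by
        rw [add_mul, one_mul, smul_mul_assoc] at l1
        rw [sub_eq_iff_eq_add, ← l1]; abel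
      rw [this, mul_neg, mul_smul_comm, ← mul_assoc, ← mul_assoc, pa_mul]
    · have : Dmat Q q e .g - 1 =
          - ((q - q⁻¹) • (Dmat Q q e .g * (Dmat Q q e .a * Dmat Q q e .d))) := by
        rw [mul_add, mul_one, mul_smul_comm] at l2
        rw [sub_eq_iff_eq_add, ← l2]; abel
      rw [this, neg_mul, smul_mul_assoc, mul_assoc, mul_assoc, d_mul]
  have loc := isLocal_R Q q
  have loc' := isLocal_R Q q⁻¹
  have res := H.moment g1 g2 a2 a4 d2 d4
    (by
      rw [← m]
      exact (loc'.tw.comm_one_add _ he.symm hY1 hY2).2)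
    (by
      rw [← m]
      exact (loc.tw.comm_one_add _ he.symm hY1 hY2).1)
    (by
      rw [hz]
      exact (loc'.comm_one_add _ he hz1 hz2).1)
    (by
      rw [hz]
      exact (loc.comm_one_add _ he hz1 hz2).2)
  rw [← m, ← map_mul] at res
  rw [edgeMat, if_neg he]
  exact res

theorem tr_triv (v : V) : (1 - slot₁ (proj Q v)) * slot₂ (proj Q v) *
    (tw (Rmat Q q) * Rmat Q q) = (1 - slot₁ (proj Q v)) * slot₂ (proj Q v) := by
  have h1 : ∑ w, proj Q w = 1 := by
    ext i j
    simp only [Matrix.sum_apply, proj, Matrix.diagonal_apply, Matrix.one_apply]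
    split <;> simp
  have h2 : (1 : Matrix (Q.Idx × Q.Idx) (Q.Idx × Q.Idx) ℂ) - slot₁ (proj Q v) =
      ∑ w ∈ Finset.univ.erase v, slot₁ (proj Q w) := by
    rw [sub_eq_iff_eq_add, Finset.sum_erase_add _ _ (Finset.mem_univ v), ← map_sum, h1, map_one]
  rw [h2, Finset.sum_mul, Finset.sum_mul]
  refine Finset.sum_congr rfl fun w hw => ?_
  have hwv := Finset.ne_of_mem_erase hw
  rw [← mul_assoc, (isLocal_R Q q).tw.triv w v hwv, (isLocal_R Q q).triv w v hwv]

theorem edge_moment_eq (e : E) (he : Q.α e = Q.β e) :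
    MComm Q q (edgeMat Q q e) (Dmat Q q e .a) ∧ MComm Q q (edgeMat Q q e) (Dmat Q q e .d) := by
  obtain ⟨l1, l2, l3, l4⟩ := loop_D Q q e he
  obtain ⟨s1, s2, s3, s4⟩ := loop_supp Q q e he
  have a1 := pa_mul Q q e
  have a2 := a_mul Q q e
  have d1 := pd_mul Q q e
  have d2 := d_mul Q q e
  rw [← he] at a2 d1
  have loc := isLocal_R Q q
  have loc' := isLocal_R Q q⁻¹
  have aa := re_D Q q e .a (Or.inl rfl)
  have dd := re_D Q q e .d (Or.inr rfl)
  have da := da_loop_D Q q e he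
  have f1 := fun {X Y Z : Matrix Q.Idx Q.Idx (D Q q)} (h : X * Y = Z) => congrArg slot₁ h
  have f2 := fun {X Y Z : Matrix Q.Idx Q.Idx (D Q q)} (h : X * Y = Z) => congrArg slot₂ h
  simp only [map_mul] at f1 f2
  have tr := congrArg (scal (D Q q)) (tr_triv Q q (Q.α e))
  have ct : Commute ((1 - slot₁ (proj Q (Q.α e))) * slot₂ (proj Q (Q.α e)))
      (tw (Rmat Q q) * Rmat Q q) := by
    have hc : ∀ X : Matrix (Q.Idx × Q.Idx) (Q.Idx × Q.Idx) ℂ, IsLocal Q X →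
        Commute ((1 - slot₁ (proj Q (Q.α e))) * slot₂ (proj Q (Q.α e))) X := fun X hX =>
      ((Commute.one_left _).sub_left (hX.comm₁ _).symm).mul_left (hX.comm₂ _).symm
    exact (hc _ loc.tw).mul_right (hc _ loc)
  have tr' := congrArg (scal (D Q q)) (ct.eq.symm.trans (tr_triv Q q (Q.α e)))
  simp only [map_mul, map_sub, map_one] at tr tr'
  have key : LoopData (slot₁ (Dmat Q q e .a)) (slot₂ (Dmat Q q e .a)) (slot₁ (Dmat Q q e .d))
      (slot₂ (Dmat Q q e .d)) (slot₁ (Dmat Q q e .g)) (slot₁ (Dmat Q q e .h))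
      (slot₁ (scal _ (proj Q (Q.α e)))) (slot₂ (scal _ (proj Q (Q.α e))))
      (scal _ (Rmat Q q)) (scal _ (Rmat Q q⁻¹)) (scal _ (tw (Rmat Q q)))
      (scal _ (tw (Rmat Q q⁻¹))) :=
  { hr := (scal_inv Q q).1
    hr' := (scal_inv Q q).2.1
    ht := (scal_inv Q q).2.2.1
    ht' := (scal_inv Q q).2.2.2
    aa := aa
    aa' := by
      simpa only [map_mul, tw_slot₁', tw_slot₂', tw_scal, tw_tw] using congrArg tw aa
    dd := dd
    dd' := by
      simpa only [map_mul, tw_slot₁', tw_slot₂', tw_scal, tw_tw] using congrArg tw dd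
    da := da
    da' := by
      simpa only [map_mul, tw_slot₁', tw_slot₂', tw_scal, tw_tw] using congrArg tw da
    ag := f1 l1
    ga := f1 l2
    dh := f1 l3
    hd := f1 l4
    pg := f1 s1
    gp := f1 s2
    ph := f1 s3
    hp := f1 s4
    pr := by rw [slot₁_scal]; exact ((loc.comm₁ _).map (scal _)).symm
    ps := by rw [slot₁_scal]; exact ((loc'.comm₁ _).map (scal _)).symm
    pt := by rw [slot₁_scal]; exact ((loc.tw.comm₁ _).map (scal _)).symm
    pu := by rw [slot₁_scal]; exact ((loc'.tw.comm₁ _).map (scal _)).symm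
    pa := (commute_slot₂ _ _).symm
    pd := (commute_slot₂ _ _).symm
    pa₂ := f2 a1
    ap₂ := f2 a2
    pd₂ := f2 d1
    dp₂ := f2 d2
    tr := by rw [slot₁_scal, slot₂_scal]; exact tr
    tr' := by rw [slot₁_scal, slot₂_scal]; exact tr' }
  have res := key.moment
  rw [MComm, MComm, edgeMat, if_pos he]
  simpa only [map_add, map_sub, map_one, map_mul slot₁] using res

theorem edge_moment (e : E) (y : Sym) : MComm Q q (edgeMat Q q e) (Dmat Q q e y) := by
  have h : MComm Q q (edgeMat Q q e) (Dmat Q q e .a) ∧ MComm Q q (edgeMat Q q e) (Dmat Q q e .d) := by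
    by_cases he : Q.α e = Q.β e
    · exact edge_moment_eq Q q e he
    · exact edge_moment_ne Q q e he
  refine comm_gen Q q slot₂ _ e ?_ (mcomm_proj Q q _) h.1 h.2 y
  intro c Y hY
  rw [slot₂_smul]
  exact hY.smul_right c

end MomentProof

section MomentProof
variable {V E : Type u} [Fintype V] [DecidableEq V] [LinearOrder E] (Q : DimQuiver V E) (q : ℂ)

/-- Conjugation. -/
def conjHom {B : Type*} [Ring B] (x x' : B) (h : x' * x = 1) (h' : x * x' = 1) : B →+* B where
  toFun y := x * y * x'
  map_one' := by rw [mul_one, h']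
  map_zero' := by simp
  map_add' a b := by simp [mul_add, add_mul]
  map_mul' a b := by
    calc x * (a * b) * x' = x * a * (x' * x) * b * x' := by rw [h]; simp only [mul_assoc, one_mul]
      _ = _ := by simp only [mul_assoc]

variable [NeZero q]

/-- `Y ↦ R₂₁⁻¹ Y₂ R₂₁`. -/
noncomputable def conjT : Matrix Q.Idx Q.Idx (D Q q) →+*
    Matrix (Q.Idx × Q.Idx) (Q.Idx × Q.Idx) (D Q q) :=
  (conjHom (scal _ (tw (Rmat Q q⁻¹))) (scal _ (tw (Rmat Q q))) (scal_inv Q q).2.2.1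
    (scal_inv Q q).2.2.2).comp slot₂

/-- `Y ↦ R Y₂ R⁻¹`. -/
noncomputable def conjR : Matrix Q.Idx Q.Idx (D Q q) →+*
    Matrix (Q.Idx × Q.Idx) (Q.Idx × Q.Idx) (D Q q) :=
  (conjHom (scal _ (Rmat Q q)) (scal _ (Rmat Q q⁻¹)) (scal_inv Q q).2.1
    (scal_inv Q q).1).comp slot₂

theorem conjT_apply (Y : Matrix Q.Idx Q.Idx (D Q q)) :
    conjT Q q Y = scal _ (tw (Rmat Q q⁻¹)) * slot₂ Y * scal _ (tw (Rmat Q q)) := rfl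

theorem conjR_apply (Y : Matrix Q.Idx Q.Idx (D Q q)) :
    conjR Q q Y = scal _ (Rmat Q q) * slot₂ Y * scal _ (Rmat Q q⁻¹) := rfl

theorem conjT_proj (v : V) (Y : Matrix Q.Idx Q.Idx (D Q q)) :
    Commute (conjT Q q Y) (slot₁ (scal _ (proj Q v))) := by
  rw [conjT_apply]
  refine Commute.mul_left (Commute.mul_left ?_ (commute_slot₂ _ _)) ?_ <;> rw [slot₁_scal]
  · exact ((isLocal_R Q q⁻¹).tw.comm₁ v).map (scal _)
  · exact ((isLocal_R Q q).tw.comm₁ v).map (scal _)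

theorem conjR_proj (v : V) (Y : Matrix Q.Idx Q.Idx (D Q q)) :
    Commute (conjR Q q Y) (slot₁ (scal _ (proj Q v))) := by
  rw [conjR_apply]
  refine Commute.mul_left (Commute.mul_left ?_ (commute_slot₂ _ _)) ?_ <;> rw [slot₁_scal]
  · exact ((isLocal_R Q q).comm₁ v).map (scal _)
  · exact ((isLocal_R Q q⁻¹).comm₁ v).map (scal _)

theorem conjT_scal_proj (v : V) :
    conjT Q q (scal _ (proj Q v)) = slot₂ (scal _ (proj Q v)) := by
  rw [conjT_apply, slot₂_scal, (((isLocal_R Q q⁻¹).tw.comm₂ v).map (scal (D Q q))).eq, mul_assoc,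
    (scal_inv Q q).2.2.2, mul_one]

theorem conjR_scal_proj (v : V) :
    conjR Q q (scal _ (proj Q v)) = slot₂ (scal _ (proj Q v)) := by
  rw [conjR_apply, slot₂_scal, (((isLocal_R Q q).comm₂ v).map (scal (D Q q))).eq, mul_assoc,
    (scal_inv Q q).1, mul_one]

theorem smul_slot₁ (x : Matrix (Q.Idx × Q.Idx) (Q.Idx × Q.Idx) (D Q q)) (c : ℂ)
    (Y : Matrix Q.Idx Q.Idx (D Q q)) (h : Commute x (slot₁ Y)) : Commute x (slot₁ (c • Y)) := by
  rw [slot₁_smul]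
  exact h.smul_right c

theorem cross_T (e f : E) (hef : e < f) (y z : Sym) :
    Commute (conjT Q q (Dmat Q q f z)) (slot₁ (Dmat Q q e y)) := by
  have base : ∀ y z : Sym, (y = .a ∨ y = .d) → (z = .a ∨ z = .d) →
      Commute (conjT Q q (Dmat Q q f z)) (slot₁ (Dmat Q q e y)) := by
    intro y z hy hz
    have h := congrArg tw (cross_D Q q e f hef y z hy hz)
    simp only [map_mul, tw_slot₁', tw_slot₂', tw_scal] at h
    obtain ⟨-, -, i1, i2⟩ := scal_inv Q q (S := D Q q)
    show _ * _ = _ * _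
    rw [conjT_apply]
    generalize scal (D Q q) (tw (Rmat Q q)) = t at *
    generalize scal (D Q q) (tw (Rmat Q q⁻¹)) = u at *
    generalize slot₁ (Dmat Q q e y) = a at *
    generalize slot₂ (Dmat Q q f z) = b at *
    calc u * b * t * a = u * (b * t * a * u) * t := by simp only [mul_assoc]; rw [i2, mul_one]
      _ = _ := by rw [h]; simp only [← mul_assoc]; rw [i2, one_mul]
  refine comm_gen Q q slot₁ _ e (smul_slot₁ Q q _) (fun v => conjT_proj Q q v _) ?_ ?_ y
  all_goals
    refine (comm_gen Q q (conjT Q q) _ f ?_ ?_ ?_ ?_ z).symm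
    · intro c Y hY
      rw [conjT_apply, slot₂_smul, mul_smul_comm, smul_mul_assoc]
      exact hY.smul_right c
    · intro v
      rw [conjT_scal_proj]
      exact commute_slot₁ _ _
    · exact (base _ _ (by simp) (by simp)).symm
    · exact (base _ _ (by simp) (by simp)).symm

theorem cross_R (e f : E) (hef : e < f) (y z : Sym) :
    Commute (conjR Q q (Dmat Q q e y)) (slot₁ (Dmat Q q f z)) := by
  have base : ∀ y z : Sym, (y = .a ∨ y = .d) → (z = .a ∨ z = .d) →
      Commute (conjR Q q (Dmat Q q e y)) (slot₁ (Dmat Q q f z)) := by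
    intro y z hy hz
    have h := cross_D Q q e f hef y z hy hz
    show _ * _ = _ * _
    rw [conjR_apply, ← h]
    simp only [mul_assoc]
  refine comm_gen Q q slot₁ _ f (smul_slot₁ Q q _) (fun v => conjR_proj Q q v _) ?_ ?_ z
  all_goals
    refine (comm_gen Q q (conjR Q q) _ e ?_ ?_ ?_ ?_ y).symm
    · intro c Y hY
      rw [conjR_apply, slot₂_smul, mul_smul_comm, smul_mul_assoc]
      exact hY.smul_right c
    · intro v
      rw [conjR_scal_proj]
      exact commute_slot₁ _ _
    · exact (base _ _ (by simp) (by simp)).symm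
    · exact (base _ _ (by simp) (by simp)).symm

/-- An element which commutes with the images of all generators of `e` commutes with the image of
the edge map. -/
theorem comm_edgeMat {B : Type*} [Ring B] (f : Matrix Q.Idx Q.Idx (D Q q) →+* B) (x : B) (e : E)
    (hs : ∀ (c : ℂ) Y, Commute x (f Y) → Commute x (f (c • Y)))
    (hp : ∀ v, Commute x (f (scal _ (proj Q v))))
    (hy : ∀ y, Commute x (f (Dmat Q q e y))) : Commute x (f (edgeMat Q q e)) := by
  have h1 : Commute x (f 1) := by rw [map_one]; exact Commute.one_right x
  rw [edgeMat]
  split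
  · rw [map_add, map_sub, map_mul, map_mul, map_mul]
    exact (h1.sub_right (hp _)).add_right
      ((((hy _).mul_right (hy _)).mul_right (hy _)).mul_right (hy _))
  · rw [map_mul, map_add]
    refine (h1.add_right (hs _ _ ?_)).mul_right (hy _)
    rw [map_mul]
    exact (hy _).mul_right (hy _)

variable [Fintype E]

/-- The moment map identity. -/
theorem moment_gen (e : E) (y : Sym) : MComm Q q (momentMat Q q) (Dmat Q q e y) := by
  obtain ⟨l₁, l₂, hl⟩ := List.append_of_mem ((Finset.mem_sort (α := E) (· ≤ ·)).2 (Finset.mem_univ e))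
  have hsort := (Finset.sortedLT_sort (Finset.univ : Finset E)).pairwise
  rw [hl, List.pairwise_append] at hsort
  obtain ⟨-, h2, h3⟩ := hsort
  rw [List.pairwise_cons] at h2
  rw [momentMat, hl, List.map_append, List.prod_append, List.map_cons, List.prod_cons]
  have c1 : Commute (conjT Q q (Dmat Q q e y)) (slot₁ (l₁.map (edgeMat Q q)).prod) := by
    rw [map_list_prod, List.map_map]
    refine Commute.list_prod_right _ _ fun z hz => ?_
    obtain ⟨f, hf, rfl⟩ := List.mem_map.1 hz
    exact comm_edgeMat Q q slot₁ _ f (smul_slot₁ Q q _) (fun v => conjT_proj Q q v _) fun y' =>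
      cross_T Q q f e (h3 f hf e (by simp)) y' y
  have c2 : Commute (conjR Q q (Dmat Q q e y)) (slot₁ (l₂.map (edgeMat Q q)).prod) := by
    rw [map_list_prod, List.map_map]
    refine Commute.list_prod_right _ _ fun z hz => ?_
    obtain ⟨f, hf, rfl⟩ := List.mem_map.1 hz
    exact comm_edgeMat Q q slot₁ _ f (smul_slot₁ Q q _) (fun v => conjR_proj Q q v _) fun y' =>
      cross_R Q q e f (h2.1 f hf) y y'
  have c0 := (edge_moment Q q e y).eq
  obtain ⟨i1, i2, i3, i4⟩ := scal_inv Q q (S := D Q q)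
  replace c1 := c1.eq
  replace c2 := c2.eq
  rw [MComm, map_mul, map_mul]
  rw [conjT_apply] at c1
  rw [conjR_apply] at c2
  show _ * _ = _ * _
  generalize slot₁ (l₁.map (edgeMat Q q)).prod = m₁ at *
  generalize slot₁ (l₂.map (edgeMat Q q)).prod = m₂ at *
  generalize slot₁ (edgeMat Q q e) = m at *
  generalize slot₂ (Dmat Q q e y) = b at *
  generalize scal (D Q q) (Rmat Q q) = r at *
  generalize scal (D Q q) (Rmat Q q⁻¹) = s at *
  generalize scal (D Q q) (tw (Rmat Q q)) = t at *
  generalize scal (D Q q) (tw (Rmat Q q⁻¹)) = v at *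
  have c0' : m * (r * b * s) = v * b * t * m := by
    calc m * (r * b * s) = v * (t * m * r * b) * s := by
          simp only [← mul_assoc]; rw [i4, one_mul]
      _ = _ := by rw [c0]; simp only [mul_assoc]; rw [i1, mul_one]
  calc t * (m₁ * (m * m₂)) * r * b = t * m₁ * m * (m₂ * (r * b * s)) * r := by
        simp only [mul_assoc]; rw [i2, mul_one]
    _ = t * m₁ * (m * (r * b * s)) * m₂ * r := by rw [← c2]; simp only [mul_assoc]
    _ = t * (m₁ * (v * b * t)) * m * m₂ * r := by rw [c0']; simp only [mul_assoc]
    _ = b * (t * (m₁ * (m * m₂)) * r) := by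
        rw [← c1]; simp only [← mul_assoc]; rw [i3, one_mul]

theorem mcomm_smul (M : Matrix Q.Idx Q.Idx (D Q q)) (c : ℂ) (Y : Matrix Q.Idx Q.Idx (D Q q))
    (h : MComm Q q M Y) : MComm Q q M (c • Y) := by
  rw [MComm, slot₂_smul]
  exact h.smul_right c

theorem moment_self : MComm Q q (momentMat Q q) (momentMat Q q) := by
  unfold MComm
  conv => rhs; rw [momentMat, map_list_prod, List.map_map]
  refine Commute.list_prod_right _ _ fun z hz => ?_
  obtain ⟨f, hf, rfl⟩ := List.mem_map.1 hz
  exact comm_edgeMat Q q slot₂ _ f (mcomm_smul Q q _) (mcomm_proj Q q _) (moment_gen Q q f)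

theorem edge_inv (e : E) : edgeMat Q q e * edgeInv Q q e = 1 ∧ edgeInv Q q e * edgeMat Q q e = 1 := by
  rw [edgeMat, edgeInv]
  split
  next he =>
    obtain ⟨l1, l2, l3, l4⟩ := loop_D Q q e he
    obtain ⟨s1, s2, s3, s4⟩ := loop_supp Q q e he
    have a1 := pa_mul Q q e
    have a2 := a_mul Q q e
    have d1 := pd_mul Q q e
    have d2 := d_mul Q q e
    rw [← he] at a2 d1
    have hP := congrArg (scal (D Q q)) (proj_idem Q (Q.α e))
    rw [map_mul] at hP
    generalize Dmat Q q e .a = a at *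
    generalize Dmat Q q e .d = d at *
    generalize Dmat Q q e .g = g at *
    generalize Dmat Q q e .h = h at *
    generalize scal (D Q q) (proj Q (Q.α e)) = p at *
    have o : ∀ x y : Matrix Q.Idx Q.Idx (D Q q), x * y = p → y * x = p → p * x = x → x * p = x →
        p * y = y → y * p = y → (1 - p + x) * (1 - p + y) = 1 := by
      intro x y h1 h2 h3 h4 h5 h6
      simp only [add_mul, mul_add, sub_mul, mul_sub, one_mul, mul_one, h1, h4, h5, hP]
      abel
    have e1 : d * g * h * a * (g * d * a * h) = p := by
      calc d * g * h * a * (g * d * a * h) = d * g * h * (a * g) * d * a * h := by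
            simp only [mul_assoc]
        _ = d * g * (h * p) * d * a * h := by rw [l1]; simp only [mul_assoc]
        _ = d * g * (h * d) * a * h := by rw [s4]; simp only [mul_assoc]
        _ = d * (g * p) * a * h := by rw [l4]; simp only [mul_assoc]
        _ = d * (g * a) * h := by rw [s2]; simp only [mul_assoc]
        _ = p := by rw [l2, d2, l3]
    have e2 : g * d * a * h * (d * g * h * a) = p := by
      calc g * d * a * h * (d * g * h * a) = g * d * a * (h * d) * g * h * a := by
            simp only [mul_assoc]
        _ = g * d * (a * p) * g * h * a := by rw [l4]; simp only [mul_assoc]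
        _ = g * d * (a * g) * h * a := by rw [a2]; simp only [mul_assoc]
        _ = g * (d * p) * h * a := by rw [l1]; simp only [mul_assoc]
        _ = g * (d * h) * a := by rw [d2]; simp only [mul_assoc]
        _ = p := by rw [l3, s2, l2]
    have q1 : p * (d * g * h * a) = d * g * h * a := by simp only [← mul_assoc, d1]
    have q2 : d * g * h * a * p = d * g * h * a := by simp only [mul_assoc, a2]
    have q3 : p * (g * d * a * h) = g * d * a * h := by simp only [← mul_assoc, s1]
    have q4 : g * d * a * h * p = g * d * a * h := by simp only [mul_assoc, s4]
    exact ⟨o _ _ e1 e2 q1 q2 q3 q4, o _ _ e2 e1 q3 q4 q1 q2⟩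
  next he =>
    obtain ⟨l1, l2, l3, l4⟩ := g_D Q q e he
    constructor
    · rw [mul_assoc, ← mul_assoc (Dmat Q q e .g), l2, one_mul, l3]
    · rw [mul_assoc, ← mul_assoc (Dmat Q q e .h), l4, one_mul, l1]

theorem moment_inv : momentMat Q q * momentInv Q q = 1 ∧ momentInv Q q * momentMat Q q = 1 := by
  rw [momentMat, momentInv]
  generalize (Finset.univ : Finset E).sort (· ≤ ·) = l
  induction l with
  | nil => simp
  | cons e l ih =>
    obtain ⟨h1, h2⟩ := edge_inv Q q e
    simp only [List.map_cons, List.prod_cons, List.reverse_cons, List.map_append, List.prod_append,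
      List.map_nil, List.prod_nil, mul_one]
    constructor
    · rw [mul_assoc, ← mul_assoc (l.map _).prod, ih.1, one_mul, h1]
    · rw [mul_assoc, ← mul_assoc (edgeInv Q q e), h2, one_mul, ih.2]

theorem proj_supp_comm {v w : V} {Y : Matrix Q.Idx Q.Idx (D Q q)}
    (h1 : scal _ (proj Q w) * Y = Y) (h2 : Y * scal _ (proj Q w) = Y) :
    Commute (scal _ (proj Q v)) Y := by
  by_cases h : v = w
  · subst h
    exact h1.trans h2.symm
  · have z1 : scal (D Q q) (proj Q v) * Y = 0 := by
      rw [← h1, ← mul_assoc, ← map_mul, proj_orth Q h, map_zero, zero_mul]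
    have z2 : Y * scal (D Q q) (proj Q v) = 0 := by
      rw [← h2, mul_assoc, ← map_mul, proj_orth Q (Ne.symm h), map_zero, mul_zero]
    exact z1.trans z2.symm

theorem edge_block (e : E) (v : V) : Commute (scal _ (proj Q v)) (edgeMat Q q e) := by
  rw [edgeMat]
  split
  next he =>
    have a2 := a_mul Q q e
    have d1 := pd_mul Q q e
    rw [← he] at a2 d1
    refine Commute.add_right ((Commute.one_right _).sub_right ?_)
      (proj_supp_comm Q q (w := Q.α e) ?_ ?_)
    · have h := (Matrix.commute_diagonal (fun i : Q.Idx => if i.1 = v then (1 : ℂ) else 0)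
        (fun i => if i.1 = Q.α e then 1 else 0)).map (scal (D Q q))
      exact h
    · simp only [← mul_assoc, d1]
    · simp only [mul_assoc, a2]
  next he =>
    obtain ⟨l1, l2, -, -⟩ := g_D Q q e he
    have hs : ∀ Y : Matrix Q.Idx Q.Idx (D Q q), Commute (scal _ (proj Q v)) Y →
        Commute (scal _ (proj Q v)) (1 + (q - q⁻¹) • Y) := fun Y hY =>
      (Commute.one_right _).add_right (hY.smul_right _)
    have h1 : Commute (scal _ (proj Q v)) (Dmat Q q e .d * Dmat Q q e .a) :=
      proj_supp_comm Q q (w := Q.β e) (by rw [← mul_assoc, pd_mul]) (by rw [mul_assoc, a_mul])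
    have h2 : Commute (scal _ (proj Q v)) (Dmat Q q e .a * Dmat Q q e .d) :=
      proj_supp_comm Q q (w := Q.α e) (by rw [← mul_assoc, pa_mul]) (by rw [mul_assoc, d_mul])
    refine (hs _ h1).mul_right ?_
    have h3 := hs _ h2
    generalize 1 + (q - q⁻¹) • (Dmat Q q e .a * Dmat Q q e .d) = m at *
    show _ * _ = _ * _
    calc scal _ (proj Q v) * Dmat Q q e .g = Dmat Q q e .g * (m * scal _ (proj Q v)) *
          Dmat Q q e .g := by rw [← mul_assoc, l2, one_mul]
      _ = _ := by rw [← h3.eq]; simp only [mul_assoc]; rw [l1, mul_one]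

theorem moment_block (i j : Q.Idx) (h : i.1 ≠ j.1) : momentMat Q q i j = 0 := by
  have h1 : Commute (scal _ (proj Q i.1)) (momentMat Q q) := by
    refine Commute.list_prod_right _ _ fun z hz => ?_
    obtain ⟨f, hf, rfl⟩ := List.mem_map.1 hz
    exact edge_block Q q f _
  have h2 := congrFun (congrFun h1.eq i) j
  simpa [scal, proj, Matrix.mul_apply, Matrix.diagonal_apply, h, h.symm,
    apply_ite (algebraMap ℂ (D Q q)), eq_comm] using h2

theorem slot₂_mul_apply {S : Type*} [Ring S] (M : Matrix Q.Idx Q.Idx S)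
    (Z : Matrix (Q.Idx × Q.Idx) (Q.Idx × Q.Idx) S) (k i l j : Q.Idx) :
    (slot₂ M * Z) (k, i) (l, j) = ∑ m, M i m * Z (k, m) (l, j) := by
  simp [Matrix.mul_apply, Fintype.sum_prod_type, slot₂_apply]

theorem mul_slot₂_apply {S : Type*} [Ring S] (M : Matrix Q.Idx Q.Idx S)
    (Z : Matrix (Q.Idx × Q.Idx) (Q.Idx × Q.Idx) S) (k i l j : Q.Idx) :
    (Z * slot₂ M) (k, i) (l, j) = ∑ m, Z (k, i) (l, m) * M m j := by
  simp [Matrix.mul_apply, Fintype.sum_prod_type, slot₂_apply]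

theorem D.mk_surj : Function.Surjective (D.mk Q q) := RingQuot.mkAlgHom_surjective ℂ _

/-- The moment map identity on the level of the action of `U` on `𝒟_q`. -/
theorem moment_act (y : D Q q) :
    momentMat Q q * act Q q .neg y = act Q q .pos y * momentMat Q q := by
  obtain ⟨x, rfl⟩ := D.mk_surj Q q y
  induction x using FreeAlgebra.induction with
  | grade0 r =>
    rw [AlgHom.commutes, AlgHom.commutes, AlgHom.commutes]
    exact (Algebra.commutes r (momentMat Q q)).symm
  | mul a b ha hb => rw [map_mul, map_mul, map_mul, ← mul_assoc, ha, mul_assoc, hb, mul_assoc]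
  | add a b ha hb => rw [map_add, map_add, map_add, mul_add, add_mul, ha, hb]
  | grade1 x =>
    obtain ⟨e, y, k, l⟩ := x
    change momentMat Q q * act Q q .neg (Dmat Q q e y k l) =
      act Q q .pos (Dmat Q q e y k l) * momentMat Q q
    ext i j
    rw [Matrix.mul_apply, Matrix.mul_apply]
    simp only [act_Dmat]
    rw [← slot₂_mul_apply, ← mul_slot₂_apply]
    refine congrFun (congrFun ?_ _) _
    have h := congrArg tw (moment_gen Q q e y).eq
    simp only [map_mul, tw_slot₁', tw_slot₂', tw_scal, tw_tw] at h
    obtain ⟨i1, i2, i3, i4⟩ := scal_inv Q q (S := D Q q)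
    simp only [Xinv, Xmat]
    generalize slot₂ (momentMat Q q) = m at *
    generalize slot₁ (Dmat Q q e y) = b at *
    generalize scal (D Q q) (Rmat Q q) = r at *
    generalize scal (D Q q) (Rmat Q q⁻¹) = s at *
    generalize scal (D Q q) (tw (Rmat Q q)) = t at *
    generalize scal (D Q q) (tw (Rmat Q q⁻¹)) = v at *
    calc m * (t * b * v) = s * (r * m * t * b) * v := by
          simp only [← mul_assoc]; rw [i2, one_mul]
      _ = _ := by rw [h]; simp only [mul_assoc]; rw [i3, mul_one]

theorem map_slot₁ {n S S' : Type*} [Fintype n] [DecidableEq n] [Ring S] [Ring S'] (f : S →+* S')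
    (X : Matrix n n S) : f.mapMatrix (slot₁ X) = slot₁ (f.mapMatrix X) := by
  ext ⟨a, b⟩ ⟨c, e⟩
  simp only [RingHom.mapMatrix_apply, Matrix.map_apply, slot₁_apply, apply_ite f, map_zero]

theorem map_slot₂ {n S S' : Type*} [Fintype n] [DecidableEq n] [Ring S] [Ring S'] (f : S →+* S')
    (X : Matrix n n S) : f.mapMatrix (slot₂ X) = slot₂ (f.mapMatrix X) := by
  ext ⟨a, b⟩ ⟨c, e⟩
  simp only [RingHom.mapMatrix_apply, Matrix.map_apply, slot₂_apply, apply_ite f, map_zero]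

theorem map_scal {n S S' : Type*} [Fintype n] [DecidableEq n] [Ring S] [Ring S'] [Algebra ℂ S]
    [Algebra ℂ S'] (f : S →ₐ[ℂ] S') (X : Matrix n n ℂ) :
    (f : S →+* S').mapMatrix (scal S X) = scal S' X := by
  ext i j
  simp [scal]

/-- A matrix which satisfies the reflection equation, and its inverse, define a homomorphism on the
reflection equation algebra. -/
noncomputable def REA.lift {S : Type*} [Ring S] [Algebra ℂ S] (M M' : Matrix Q.Idx Q.Idx S)
    (re : scal S (tw (Rmat Q q)) * slot₁ M * scal S (Rmat Q q) * slot₂ M =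
      slot₂ M * scal S (tw (Rmat Q q)) * slot₁ M * scal S (Rmat Q q))
    (blk : ∀ i j : Q.Idx, i.1 ≠ j.1 → M i j = 0) (h : M * M' = 1) (h' : M' * M = 1) :
    REA Q q →ₐ[ℂ] S :=
  RingQuot.liftAlgHom ℂ ⟨FreeAlgebra.lift ℂ fun x =>
    match x with
    | (.l, i, j) => M i j
    | (.linv, i, j) => M' i j, by
    set f := FreeAlgebra.lift ℂ fun x : TGen Q =>
      match x with
      | (.l, i, j) => M i j
      | (.linv, i, j) => M' i j with hf
    have e1 : (f : _ →+* S).mapMatrix (freeT Q .l) = M := by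
      ext i j
      simp [freeT, hf]
    have e2 : (f : _ →+* S).mapMatrix (freeT Q .linv) = M' := by
      ext i j
      simp [freeT, hf]
    have e3 : ∀ {n : Type u} [Fintype n] [DecidableEq n]
        (Z : Matrix n n (FreeAlgebra ℂ (TGen Q))) (i j : n),
        f (Z i j) = (f : _ →+* S).mapMatrix Z i j := fun Z i j => rfl
    intro x y hxy
    cases hxy with
    | re x y =>
      rw [e3, e3]
      simp only [map_mul, map_slot₁, map_slot₂, map_scal, e1, re]
    | block i j hij => rw [e3, e1, map_zero, blk i j hij]
    | mul_inv i j => rw [e3, e3, map_mul, e1, e2, h, map_one]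
    | inv_mul i j => rw [e3, e3, map_mul, e1, e2, h', map_one]⟩

theorem REA.lift_l {S : Type*} [Ring S] [Algebra ℂ S] (M M' : Matrix Q.Idx Q.Idx S)
    (re blk h h') (i j : Q.Idx) : REA.lift Q q M M' re blk h h' (Tmat Q q .l i j) = M i j := by
  refine (RingQuot.liftAlgHom_mkAlgHom_apply ..).trans ?_
  simp [freeT]

theorem REA.lift_linv {S : Type*} [Ring S] [Algebra ℂ S] (M M' : Matrix Q.Idx Q.Idx S)
    (re blk h h') (i j : Q.Idx) : REA.lift Q q M M' re blk h h' (Tmat Q q .linv i j) = M' i j := by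
  refine (RingQuot.liftAlgHom_mkAlgHom_apply ..).trans ?_
  simp [freeT]

theorem REA.induction {P : REA Q q → Prop} (hs : ∀ c : ℂ, P (algebraMap ℂ _ c))
    (hg : ∀ b i j, P (Tmat Q q b i j)) (hm : ∀ x y, P x → P y → P (x * y))
    (ha : ∀ x y, P x → P y → P (x + y)) (x : REA Q q) : P x := by
  obtain ⟨x, rfl⟩ : ∃ y, REA.mk Q q y = x := RingQuot.mkAlgHom_surjective ℂ _ x
  induction x using FreeAlgebra.induction with
  | grade0 r => rw [AlgHom.commutes]; exact hs r
  | grade1 x => exact hg x.1 x.2.1 x.2.2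
  | mul a b h1 h2 => rw [map_mul]; exact hm _ _ h1 h2
  | add a b h1 h2 => rw [map_add]; exact ha _ _ h1 h2

/-- The moment map `μ`, a homomorphism on the reflection equation algebra. -/
noncomputable def μ : REA Q q →ₐ[ℂ] D Q q :=
  REA.lift Q q (momentMat Q q) (momentInv Q q)
    (by simpa only [MComm, Commute, SemiconjBy, mul_assoc] using moment_self Q q)
    (moment_block Q q) (moment_inv Q q).1 (moment_inv Q q).2

/-- The character `tr_ξ`, which sends `l^i_j` to `ξ_v δ^i_j` at the vertex `v`. -/
noncomputable def trξ (ξ : V → ℂˣ) : REA Q q →ₐ[ℂ] ℂ :=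
  REA.lift Q q (Matrix.diagonal fun i => (ξ i.1 : ℂ)) (Matrix.diagonal fun i => ((ξ i.1)⁻¹ : ℂˣ))
    (by
      have e : (Matrix.diagonal fun i : Q.Idx => (ξ i.1 : ℂ)) = ∑ v, (ξ v : ℂ) • proj Q v := by
        ext i j
        simp only [Matrix.sum_apply, Matrix.smul_apply, proj, Matrix.diagonal_apply, smul_eq_mul]
        split <;> simp
      have loc := isLocal_R Q q
      have c : ∀ X : Matrix (Q.Idx × Q.Idx) (Q.Idx × Q.Idx) ℂ, IsLocal Q X →
          Commute X (slot₂ (Matrix.diagonal fun i : Q.Idx => (ξ i.1 : ℂ))) := by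
        intro X hX
        rw [e, map_sum]
        refine Commute.sum_right _ _ _ fun v _ => ?_
        rw [slot₂_smul]
        exact (hX.comm₂ v).smul_right _
      have c' := commute_slot₁ (S := ℂ) (Matrix.diagonal fun i : Q.Idx => (ξ i.1 : ℂ))
        (Matrix.diagonal fun i : Q.Idx => (ξ i.1 : ℂ))
      rw [scal_complex] at c'
      simp only [scal_complex]
      have := ((c _ loc.tw).mul_left c').mul_left (c _ loc)
      rw [this.eq]
      simp only [mul_assoc])
    (fun i j h => Matrix.diagonal_apply_ne _ fun h' => h (by rw [h']))
    (by rw [Matrix.diagonal_mul_diagonal]; simp) (by rw [Matrix.diagonal_mul_diagonal]; simp)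

section Reduction
variable (ξ : V → ℂˣ)

/-- The left ideal `𝒟_q μ(ℐ_ξ)`, where `ℐ_ξ = ker tr_ξ`. -/
noncomputable def Jξ : Ideal (D Q q) := Ideal.span (μ Q q '' {x | trξ Q q ξ x = 0})

theorem μ_sub_mem (x : REA Q q) :
    μ Q q x - algebraMap ℂ _ (trξ Q q ξ x) ∈ Jξ Q q ξ := by
  have : μ Q q x - algebraMap ℂ _ (trξ Q q ξ x) = μ Q q (x - algebraMap ℂ _ (trξ Q q ξ x)) := by
    rw [map_sub, AlgHom.commutes]
  rw [this]
  refine Ideal.subset_span ⟨_, ?_, rfl⟩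
  show trξ Q q ξ _ = 0
  rw [map_sub, AlgHom.commutes]
  simp

/-- `b` represents a `U`-invariant element of the `U`-module `𝒟_q / 𝒟_q μ(ℐ_ξ)`. -/
def IsInv (b : D Q q) : Prop :=
  ∀ (s : Sgn) (i j : Q.Idx), act Q q s b i j - (if i = j then b else 0) ∈ Jξ Q q ξ

theorem J_smul (c : ℂ) {x : D Q q} (hx : x ∈ Jξ Q q ξ) : c • x ∈ Jξ Q q ξ := by
  rw [Algebra.smul_def]
  exact Ideal.mul_mem_left _ _ hx

theorem μ_l (i j : Q.Idx) : μ Q q (Tmat Q q .l i j) = momentMat Q q i j := REA.lift_l ..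

theorem μ_linv (i j : Q.Idx) : μ Q q (Tmat Q q .linv i j) = momentInv Q q i j := REA.lift_linv ..

theorem tr_l (i j : Q.Idx) : trξ Q q ξ (Tmat Q q .l i j) = if i = j then (ξ i.1 : ℂ) else 0 := by
  rw [trξ, REA.lift_l, Matrix.diagonal_apply]

theorem tr_linv (i j : Q.Idx) :
    trξ Q q ξ (Tmat Q q .linv i j) = if i = j then ((ξ i.1)⁻¹ : ℂ) else 0 := by
  rw [trξ, REA.lift_linv, Matrix.diagonal_apply, Units.val_inv_eq_inv_val]

theorem inv_moment {b : D Q q} (hb : IsInv Q q ξ b) (i j : Q.Idx) :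
    momentMat Q q i j * b - (if i = j then (ξ i.1 : ℂ) • b else 0) ∈ Jξ Q q ξ := by
  have h := congrFun (congrFun (moment_act Q q b) i) j
  rw [Matrix.mul_apply, Matrix.mul_apply] at h
  have h1 : ∑ k, momentMat Q q i k * (act Q q .neg b k j - (if k = j then b else 0)) ∈
      Jξ Q q ξ := Ideal.sum_mem _ fun k _ => Ideal.mul_mem_left _ _ (hb _ _ _)
  have h2 : ∑ k, act Q q .pos b i k * (momentMat Q q k j -
      algebraMap ℂ _ (if k = j then (ξ k.1 : ℂ) else 0)) ∈ Jξ Q q ξ :=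
    Ideal.sum_mem _ fun k _ => Ideal.mul_mem_left _ _ (by
      have := μ_sub_mem Q q ξ (Tmat Q q .l k j)
      rwa [μ_l, tr_l] at this)
  have h3 := J_smul Q q ξ (ξ j.1 : ℂ) (hb .pos i j)
  simp only [mul_sub, Finset.sum_sub_distrib, mul_ite, mul_zero, Finset.sum_ite_eq',
    Finset.mem_univ, if_true, apply_ite (algebraMap ℂ (D Q q)), map_zero] at h1 h2
  rw [h] at h1
  have h4 := (Jξ Q q ξ).add_mem ((Jξ Q q ξ).sub_mem h2 h1) h3
  convert h4 using 1
  rw [smul_sub, Algebra.smul_def (ξ j.1 : ℂ) (act Q q .pos b i j), Algebra.commutes]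
  by_cases hij : i = j
  · subst hij
    simp
  · simp [hij]

theorem inv_stable {b : D Q q} (hb : IsInv Q q ξ b) (x : REA Q q) :
    μ Q q x * b - trξ Q q ξ x • b ∈ Jξ Q q ξ := by
  induction x using REA.induction with
  | hs c => simp [Algebra.smul_def]
  | ha x y hx hy =>
    have := (Jξ Q q ξ).add_mem hx hy
    convert this using 1
    rw [map_add, map_add, add_mul, add_smul]
    abel
  | hm x y hx hy =>
    have := (Jξ Q q ξ).add_mem (Ideal.mul_mem_left _ (μ Q q x) hy)
      (J_smul Q q ξ (trξ Q q ξ y) hx)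
    convert this using 1
    rw [map_mul, map_mul, mul_sub, smul_sub, mul_smul_comm, mul_assoc, smul_smul,
      mul_comm (trξ Q q ξ y)]
    abel
  | hg s i j =>
    cases s with
    | l =>
      rw [μ_l, tr_l, ite_smul, zero_smul]
      exact inv_moment Q q ξ hb i j
    | linv =>
      rw [μ_linv, tr_linv, ite_smul, zero_smul]
      have h1 : ∑ k, momentInv Q q i k * (momentMat Q q k j * b -
          (if k = j then (ξ k.1 : ℂ) • b else 0)) ∈ Jξ Q q ξ :=
        Ideal.sum_mem _ fun k _ => Ideal.mul_mem_left _ _ (inv_moment Q q ξ hb k j)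
      have h2 := congrFun (congrFun (moment_inv Q q).2 i) j
      rw [Matrix.mul_apply] at h2
      simp only [mul_sub, ← mul_assoc, Finset.sum_sub_distrib, mul_ite, mul_zero,
        Finset.sum_ite_eq', Finset.mem_univ, if_true, ← Finset.sum_mul, h2] at h1
      have h3 := J_smul Q q ξ (-(ξ j.1 : ℂ)⁻¹) h1
      convert h3 using 1
      rw [mul_smul_comm, smul_sub, smul_smul, neg_mul, inv_mul_cancel₀ (ξ j.1).ne_zero, neg_smul,
        neg_smul, one_smul, sub_neg_eq_add, neg_add_eq_sub, Matrix.one_apply]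
      by_cases hij : i = j
      · subst hij
        simp
      · simp [hij]

theorem J_mul {a b : D Q q} (ha : a ∈ Jξ Q q ξ) (hb : IsInv Q q ξ b) : a * b ∈ Jξ Q q ξ := by
  have h : Jξ Q q ξ ≤
      Submodule.comap (LinearMap.toSpanSingleton (D Q q) (D Q q) b) (Jξ Q q ξ) := by
    refine Submodule.span_le.2 ?_
    rintro _ ⟨x, hx, rfl⟩
    have := inv_stable Q q ξ hb x
    rw [show trξ Q q ξ x = 0 from hx, zero_smul, sub_zero] at this
    exact this
  exact h ha

/-- The subalgebra of `𝒟_q` of all `b` whose class in `𝒟_q / 𝒟_q μ(ℐ_ξ)` is `U`-invariant. -/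
noncomputable def Nξ : Subalgebra ℂ (D Q q) where
  carrier := {b | IsInv Q q ξ b}
  mul_mem' := by
    intro a b ha hb s i j
    have h1 : ∑ k, act Q q s a i k * (act Q q s b k j - (if k = j then b else 0)) ∈ Jξ Q q ξ :=
      Ideal.sum_mem _ fun k _ => Ideal.mul_mem_left _ _ (hb _ _ _)
    have h2 := J_mul Q q ξ (ha s i j) hb
    convert (Jξ Q q ξ).add_mem h1 h2 using 1
    rw [map_mul, Matrix.mul_apply]
    simp [mul_sub, sub_mul, Finset.sum_sub_distrib]
  add_mem' := by
    intro a b ha hb s i j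
    convert (Jξ Q q ξ).add_mem (ha s i j) (hb s i j) using 1
    rw [map_add, Matrix.add_apply]
    split <;> abel
  algebraMap_mem' := by
    intro c s i j
    rw [AlgHom.commutes, Matrix.algebraMap_matrix_apply, sub_self]
    exact zero_mem _

/-- The two-sided ideal of `Nξ` of the elements whose class in `𝒟_q / 𝒟_q μ(ℐ_ξ)` is zero. -/
noncomputable def Nideal : Ideal (Nξ Q q ξ) := (Jξ Q q ξ).comap (Nξ Q q ξ).val

instance : (Nideal Q q ξ).IsTwoSided where
  mul_mem_of_left b ha := J_mul Q q ξ ha b.2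

/-- The algebra `𝒜 = Hom_𝒞(1, 𝒟_q / 𝒟_q μ(ℐ_ξ))` of `U`-invariants of `𝒟_q / 𝒟_q μ(ℐ_ξ)`, with the
product `[b] [b'] = [b b']`: the quantized multiplicative quiver variety. -/
def Aξ : Type u := Nξ Q q ξ ⧸ Nideal Q q ξ

noncomputable instance : Ring (Aξ Q q ξ) := inferInstanceAs (Ring (_ ⧸ Nideal Q q ξ))

end Reduction

end MomentProof

section Diagonalizable

variable {M : Type*} [AddCommGroup M] [Module ℂ M] (T : Module.End ℂ M)

theorem span_eigen_iff (Λ : Set ℂ) (m : M) :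
    m ∈ Submodule.span ℂ {x | ∃ z ∈ Λ, T x = z • x} ↔
      ∃ S : Finset ℂ, (S : Set ℂ) ⊆ Λ ∧
        Polynomial.aeval T (∏ z ∈ S, (Polynomial.X - Polynomial.C z)) m = 0 := by
  classical
  constructor
  · intro h
    have mono : ∀ (S S' : Finset ℂ) (x : M), S ⊆ S' →
        Polynomial.aeval T (∏ z ∈ S, (Polynomial.X - Polynomial.C z)) x = 0 →
        Polynomial.aeval T (∏ z ∈ S', (Polynomial.X - Polynomial.C z)) x = 0 := by
      intro S S' x h hx
      rw [← Finset.prod_sdiff h, map_mul, Module.End.mul_apply, hx, map_zero]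
    induction h using Submodule.span_induction with
    | mem x hx =>
      obtain ⟨z, hz, h⟩ := hx
      exact ⟨{z}, by simpa using hz, by simp [h, Module.algebraMap_end_apply]⟩
    | zero => exact ⟨∅, by simp, by simp⟩
    | add x y _ _ hx hy =>
      obtain ⟨S, hS, h1⟩ := hx
      obtain ⟨S', hS', h2⟩ := hy
      refine ⟨S ∪ S', by simp [hS, hS'], ?_⟩
      rw [map_add, mono S _ x Finset.subset_union_left h1,
        mono S' _ y Finset.subset_union_right h2, add_zero]
    | smul c x _ hx =>
      obtain ⟨S, hS, h1⟩ := hx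
      exact ⟨S, hS, by rw [map_smul, h1, smul_zero]⟩
  · rintro ⟨S, hS, h⟩
    induction S using Finset.induction_on generalizing m with
    | empty =>
      rw [Finset.prod_empty, map_one, Module.End.one_apply] at h
      exact h ▸ zero_mem _
    | insert z S hz ih =>
      rw [Finset.prod_insert hz] at h
      have hc : IsCoprime (Polynomial.X - Polynomial.C z)
          (∏ w ∈ S, (Polynomial.X - Polynomial.C w)) := by
        refine IsCoprime.prod_right fun w hw => ?_
        refine Polynomial.isCoprime_X_sub_C_of_isUnit_sub ?_
        refine (sub_ne_zero.2 fun h' => hz (by rw [h']; exact hw)).isUnit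
      have h' := Polynomial.sup_ker_aeval_eq_ker_aeval_mul_of_coprime T hc
      have hm : m ∈ LinearMap.ker (Polynomial.aeval T ((Polynomial.X - Polynomial.C z) *
          ∏ w ∈ S, (Polynomial.X - Polynomial.C w))) := h
      rw [← h', Submodule.mem_sup] at hm
      obtain ⟨a, ha, b, hb, rfl⟩ := hm
      refine add_mem (Submodule.subset_span ⟨z, hS (Finset.mem_insert_self _ _), ?_⟩)
        (ih _ (fun w hw => hS (Finset.mem_insert_of_mem hw)) hb)
      have : T a - z • a = 0 := by
        simpa [Module.algebraMap_end_apply] using ha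
      exact sub_eq_zero.1 this

end Diagonalizable

section Modules

variable {V E : Type u} [Fintype V] [DecidableEq V] [LinearOrder E] (Q : DimQuiver V E) (q : ℂ)
variable [NeZero q]

/-- The relations of the smash product `𝒟_q ⋊ U`: those of `U`, those of `𝒟_q`, and
`u b = ∑ (u₍₁₎ ▷ b) u₍₂₎` for the generators `u` of `U`. -/
inductive SmashRel : FreeAlgebra ℂ (U Q q ⊕ D Q q) → FreeAlgebra ℂ (U Q q ⊕ D Q q) → Prop
  | add_U (x y : U Q q) : SmashRel (FreeAlgebra.ι ℂ (Sum.inl (x + y)))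
      (FreeAlgebra.ι ℂ (Sum.inl x) + FreeAlgebra.ι ℂ (Sum.inl y))
  | mul_U (x y : U Q q) : SmashRel (FreeAlgebra.ι ℂ (Sum.inl (x * y)))
      (FreeAlgebra.ι ℂ (Sum.inl x) * FreeAlgebra.ι ℂ (Sum.inl y))
  | scalar_U (c : ℂ) : SmashRel (FreeAlgebra.ι ℂ (Sum.inl (algebraMap ℂ (U Q q) c)))
      (algebraMap ℂ _ c)
  | add_D (x y : D Q q) : SmashRel (FreeAlgebra.ι ℂ (Sum.inr (x + y)))
      (FreeAlgebra.ι ℂ (Sum.inr x) + FreeAlgebra.ι ℂ (Sum.inr y))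
  | mul_D (x y : D Q q) : SmashRel (FreeAlgebra.ι ℂ (Sum.inr (x * y)))
      (FreeAlgebra.ι ℂ (Sum.inr x) * FreeAlgebra.ι ℂ (Sum.inr y))
  | scalar_D (c : ℂ) : SmashRel (FreeAlgebra.ι ℂ (Sum.inr (algebraMap ℂ (D Q q) c)))
      (algebraMap ℂ _ c)
  | cross (s : Sgn) (i j : Q.Idx) (y : D Q q) :
      SmashRel (FreeAlgebra.ι ℂ (Sum.inl (Lmat Q q s i j)) * FreeAlgebra.ι ℂ (Sum.inr y))
        (∑ k, FreeAlgebra.ι ℂ (Sum.inr (act Q q s y i k)) *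
          FreeAlgebra.ι ℂ (Sum.inl (Lmat Q q s k j)))

/-- The smash product `𝒟_q ⋊ U`. A module over it is a `U`-module `M` with an action of `𝒟_q` whose
structure map `𝒟_q ⊗ M → M` is `U`-linear. -/
def B : Type u := RingQuot (SmashRel Q q)

noncomputable instance : Ring (B Q q) := inferInstanceAs (Ring (RingQuot _))
noncomputable instance : Algebra ℂ (B Q q) := inferInstanceAs (Algebra ℂ (RingQuot _))

/-- The quotient map onto the smash product. -/
noncomputable def B.mk : FreeAlgebra ℂ (U Q q ⊕ D Q q) →ₐ[ℂ] B Q q :=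
  RingQuot.mkAlgHom ℂ (SmashRel Q q)

theorem B.rel {x y : FreeAlgebra ℂ (U Q q ⊕ D Q q)} (h : SmashRel Q q x y) :
    B.mk Q q x = B.mk Q q y := RingQuot.mkAlgHom_rel ℂ h

/-- The homomorphism from `U` to the smash product. -/
noncomputable def ιU : U Q q →ₐ[ℂ] B Q q :=
  AlgHom.ofLinearMap
    { toFun := fun x => B.mk Q q (FreeAlgebra.ι ℂ (Sum.inl x))
      map_add' := fun x y => (B.rel Q q (.add_U x y)).trans (map_add _ _ _)
      map_smul' := fun c x => by
        rw [Algebra.smul_def, B.rel Q q (.mul_U _ _), map_mul, B.rel Q q (.scalar_U _),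
          AlgHom.commutes, RingHom.id_apply, Algebra.smul_def] }
    (by
      have := B.rel Q q (.scalar_U 1)
      rwa [map_one, map_one, map_one] at this)
    fun x y => (B.rel Q q (.mul_U x y)).trans (map_mul _ _ _)

/-- The homomorphism from `𝒟_q` to the smash product. -/
noncomputable def ιD : D Q q →ₐ[ℂ] B Q q :=
  AlgHom.ofLinearMap
    { toFun := fun x => B.mk Q q (FreeAlgebra.ι ℂ (Sum.inr x))
      map_add' := fun x y => (B.rel Q q (.add_D x y)).trans (map_add _ _ _)
      map_smul' := fun c x => by
        rw [Algebra.smul_def, B.rel Q q (.mul_D _ _), map_mul, B.rel Q q (.scalar_D _),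
          AlgHom.commutes, RingHom.id_apply, Algebra.smul_def] }
    (by
      have := B.rel Q q (.scalar_D 1)
      rwa [map_one, map_one, map_one] at this)
    fun x y => (B.rel Q q (.mul_D x y)).trans (map_mul _ _ _)

theorem smash_cross (s : Sgn) (i j : Q.Idx) (y : D Q q) :
    ιU Q q (Lmat Q q s i j) * ιD Q q y =
      ∑ k, ιD Q q (act Q q s y i k) * ιU Q q (Lmat Q q s k j) := by
  have := B.rel Q q (.cross s i j y)
  rw [map_mul, map_sum] at this
  simp only [map_mul] at this
  exact this

variable [Fintype E] (ξ : V → ℂˣ)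

open CategoryTheory CategoryTheory.Limits
open scoped ModuleCat

section Good
variable {M N : ModuleCat.{u} (B Q q)}

/-- `m` lies in a finite-dimensional `U`-submodule. -/
def LocFinite (m : M) : Prop :=
  ∃ W : Submodule ℂ M, m ∈ W ∧ FiniteDimensional ℂ W ∧ ∀ (x : U Q q), ∀ w ∈ W, ιU Q q x • w ∈ W

/-- `m` is a sum of eigenvectors of `l^{+ i}_i` whose eigenvalues are integral powers of `q`. -/
def TypeOne (m : M) : Prop :=
  ∀ i : Q.Idx, m ∈ Submodule.span ℂ
    {x : M | ∃ n : ℤ, ιU Q q (Lmat Q q .pos i i) • x = (q ^ n : ℂ) • x}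

/-- On `m` the quantum moment map, shifted by the character `tr_ξ`, agrees with the action of `U`:
`μ(l) L⁻ m = ξ L⁺ m`, where `l = L⁺ S(L⁻)` under the embedding of the reflection equation algebra
into `U`. -/
def StronglyEquivariant (m : M) : Prop :=
  ∀ i j : Q.Idx, ∑ k, ιD Q q (momentMat Q q i k) • ιU Q q (Lmat Q q .neg k j) • m =
    (ξ i.1 : ℂ) • ιU Q q (Lmat Q q .pos i j) • m

/-- The three conditions on the elements of a `𝒟_q`-module in `𝒞`. -/
structure Good (m : M) : Prop where
  locFinite : LocFinite Q q m
  typeOne : TypeOne Q q m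
  equivariant : StronglyEquivariant Q q ξ m

theorem smulC (f : M →ₗ[B Q q] N) (c : ℂ) (m : M) : f (c • m) = c • f m :=
  (f.restrictScalars ℂ).map_smul c m

/-- The action of `l^{+ i}_i`. -/
noncomputable def diagEnd (M : ModuleCat.{u} (B Q q)) (i : Q.Idx) : Module.End ℂ M :=
  Algebra.lsmul ℂ ℂ M (ιU Q q (Lmat Q q .pos i i))

variable {Q q} in
theorem typeOne_iff (m : M) : TypeOne Q q m ↔ ∀ i, ∃ S : Finset ℂ,
    (S : Set ℂ) ⊆ Set.range (fun n : ℤ => q ^ n) ∧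
    Polynomial.aeval (diagEnd Q q M i) (∏ z ∈ S, (Polynomial.X - Polynomial.C z)) m = 0 := by
  refine forall_congr' fun i => ?_
  rw [← span_eigen_iff]
  simp only [Set.exists_range_iff]
  rfl

variable {Q q ξ}

theorem Good.map (f : M →ₗ[B Q q] N) {m : M} (h : Good Q q ξ m) : Good Q q ξ (f m) where
  locFinite := by
    obtain ⟨W, hm, hf, hW⟩ := h.locFinite
    refine ⟨W.map (f.restrictScalars ℂ), ⟨m, hm, rfl⟩, inferInstance, ?_⟩
    rintro x _ ⟨w, hw, rfl⟩
    exact ⟨_, hW x w hw, f.map_smul _ _⟩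
  typeOne := by
    intro i
    have h' := Submodule.mem_map_of_mem (f := f.restrictScalars ℂ) (h.typeOne i)
    rw [Submodule.map_span] at h'
    refine Submodule.span_mono ?_ h'
    rintro _ ⟨x, ⟨n, hn⟩, rfl⟩
    refine ⟨n, ?_⟩
    show _ • f x = _ • f x
    rw [← f.map_smul, hn, smulC]
  equivariant := by
    intro i j
    have h' := congrArg f (h.equivariant i j)
    simpa only [map_sum, f.map_smul, smulC] using h'

theorem Good.of_map (f : M →ₗ[B Q q] N) (hf : Function.Injective f) {m : M}
    (h : Good Q q ξ (f m)) : Good Q q ξ m where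
  locFinite := by
    obtain ⟨W, hm, hfin, hW⟩ := h.locFinite
    refine ⟨W.comap (f.restrictScalars ℂ), hm, ?_, ?_⟩
    · let g : W.comap (f.restrictScalars ℂ) →ₗ[ℂ] W :=
        (f.restrictScalars ℂ).restrict (fun x hx => hx)
      refine FiniteDimensional.of_injective g ?_
      intro x y hxy
      exact Subtype.ext (hf (congrArg Subtype.val hxy))
    · intro x w hw
      show f _ ∈ W
      rw [f.map_smul]
      exact hW x _ hw
  typeOne := by
    have h' := h.typeOne
    rw [typeOne_iff] at h' ⊢
    intro i
    obtain ⟨S, hS, h0⟩ := h' i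
    refine ⟨S, hS, hf ?_⟩
    rw [map_zero, ← h0]
    have key : ∀ (p : Polynomial ℂ) (x : M),
        f (Polynomial.aeval (diagEnd Q q M i) p x) =
          Polynomial.aeval (diagEnd Q q N i) p (f x) := by
      intro p
      induction p using Polynomial.induction_on' with
      | add a b ha hb => intro x; simp only [map_add, LinearMap.add_apply, ha, hb]
      | monomial n c =>
        intro x
        rw [Polynomial.aeval_monomial, Polynomial.aeval_monomial, Module.End.mul_apply,
          Module.End.mul_apply, Module.algebraMap_end_apply, Module.algebraMap_end_apply, smulC]
        congr 1
        induction n with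
        | zero => rfl
        | succ n ih =>
          rw [pow_succ', pow_succ', Module.End.mul_apply, Module.End.mul_apply, ← ih]
          exact f.map_smul _ _
    exact key _ _
  equivariant := by
    intro i j
    apply hf
    simpa only [map_sum, f.map_smul, smulC] using h.equivariant i j

theorem Good.add {m n : M} (h : Good Q q ξ m) (h' : Good Q q ξ n) : Good Q q ξ (m + n) where
  locFinite := by
    obtain ⟨W, hm, hfin, hW⟩ := h.locFinite
    obtain ⟨W', hm', hfin', hW'⟩ := h'.locFinite
    refine ⟨W ⊔ W', Submodule.add_mem_sup hm hm', inferInstance, ?_⟩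
    intro x w hw
    obtain ⟨a, ha, b, hb, rfl⟩ := Submodule.mem_sup.1 hw
    rw [smul_add]
    exact Submodule.add_mem_sup (hW x a ha) (hW' x b hb)
  typeOne := fun i => add_mem (h.typeOne i) (h'.typeOne i)
  equivariant := by
    intro i j
    simp only [smul_add, Finset.sum_add_distrib]
    rw [h.equivariant i j, h'.equivariant i j]

theorem Good.zero : Good Q q ξ (0 : M) where
  locFinite := ⟨⊥, zero_mem _, inferInstance, by
    rintro x w hw
    rw [(Submodule.mem_bot ℂ).1 hw, smul_zero]
    exact zero_mem _⟩
  typeOne := fun i => zero_mem _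
  equivariant := by
    intro i j
    simp

end Good

/-- The modules over the smash product which are `𝒟_q`-modules in the category `𝒞` of locally
finite `U`-modules of type one, and which are strongly equivariant for the moment map. -/
def isEquivariant : ObjectProperty (ModuleCat.{u} (B Q q)) := fun M => ∀ m : M, Good Q q ξ m

/-- The category `𝒟_q-mod_𝒞` of equivariant `𝒟_q`-modules in `𝒞`. -/
abbrev DMod : Type (u + 1) := (isEquivariant Q q ξ).FullSubcategory

instance : (isEquivariant Q q ξ).IsClosedUnderSubobjects where
  prop_of_mono f _ h m := Good.of_map f.hom ((ModuleCat.mono_iff_injective f).1 inferInstance)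
    (h (f.hom m))

instance : (isEquivariant Q q ξ).IsClosedUnderQuotients where
  prop_of_epi f _ h m := by
    obtain ⟨x, rfl⟩ := (ModuleCat.epi_iff_surjective f).1 inferInstance m
    exact Good.map f.hom (h x)

instance : (isEquivariant Q q ξ).ContainsZero where
  exists_zero := ⟨ModuleCat.of _ PUnit, ModuleCat.isZero_of_subsingleton _, fun m => by
    rw [Subsingleton.elim m 0]
    exact Good.zero⟩

instance : (isEquivariant Q q ξ).IsClosedUnderLimitsOfShape (Discrete WalkingPair) where
  limitsOfShape_le := by
    rintro X ⟨p⟩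
    refine ObjectProperty.prop_of_iso _ (IsLimit.conePointUniqueUpToIso
      (ModuleCat.binaryProductLimitCone (p.diag.obj (.mk .left))
        (p.diag.obj (.mk .right))).isLimit
      ((IsLimit.postcomposeHomEquiv (diagramIsoPair p.diag) _).2 p.isLimit)) ?_
    rintro ⟨a, b⟩
    have h1 := Good.map (ξ := ξ) (N := ModuleCat.of _ (_ × _)) (LinearMap.inl (B Q q)
      (p.diag.obj (.mk .left)) (p.diag.obj (.mk .right))) (p.prop_diag_obj (.mk .left) a)
    have h2 := Good.map (ξ := ξ) (N := ModuleCat.of _ (_ × _)) (LinearMap.inr (B Q q)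
      (p.diag.obj (.mk .left)) (p.diag.obj (.mk .right))) (p.prop_diag_obj (.mk .right) b)
    have h3 := Good.add h1 h2
    simp only [LinearMap.inl_apply, LinearMap.inr_apply] at h3
    have h4 : ((a, 0) + (0, b) : p.diag.obj (.mk .left) × p.diag.obj (.mk .right)) = (a, b) := by
      simp
    rw [← h4]
    exact h3

instance : (isEquivariant Q q ξ).IsClosedUnderFiniteProducts := .mk'

section Invariants

variable {Q q ξ}

/-- The invariants of the `U`-module `M`, that is `Hom_U(1, M)` for the trivial module `1`. -/
def invariants (M : ModuleCat.{u} (B Q q)) : AddSubgroup M where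
  carrier := {m | ∀ (s : Sgn) (i j : Q.Idx), ιU Q q (Lmat Q q s i j) • m = if i = j then m else 0}
  zero_mem' := by
    intro s i j
    simp
  add_mem' := by
    intro a b ha hb s i j
    rw [smul_add, ha, hb]
    split <;> simp
  neg_mem' := by
    intro a ha s i j
    rw [smul_neg, ha]
    split <;> simp

theorem μ_smul (M : DMod Q q ξ) {m : M.obj} (hm : m ∈ invariants M.obj) (x : REA Q q) :
    ιD Q q (μ Q q x) • m = trξ Q q ξ x • m := by
  have h0 : ∀ i j : Q.Idx, ιD Q q (momentMat Q q i j) • m = if i = j then (ξ i.1 : ℂ) • m else 0 := by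
    intro i j
    have h := (M.property m).equivariant i j
    simp only [hm _ _ _, smul_ite, smul_zero, Finset.sum_ite_eq', Finset.mem_univ, if_true] at h
    exact h
  have hc : ∀ (c : ℂ) (y : B Q q) (x : M.obj), y • c • x = c • y • x := fun c y x =>
    smul_comm y c x
  induction x using REA.induction with
  | hs c =>
    rw [AlgHom.commutes, AlgHom.commutes, AlgHom.commutes, algebraMap_smul]
    rfl
  | ha x y hx hy => simp only [map_add, add_smul, hx, hy]
  | hm x y hx hy => rw [map_mul, map_mul, mul_smul, hy, hc, hx, map_mul, smul_smul, mul_comm]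
  | hg s i j =>
    cases s with
    | l => rw [μ_l, tr_l, h0, ite_smul, zero_smul]
    | linv =>
      rw [μ_linv, tr_linv, ite_smul, zero_smul]
      have h2 := congrArg (fun y => ιD Q q y • m)
        (congrFun (congrFun (moment_inv Q q).2 i) j)
      simp only [Matrix.mul_apply, map_sum, map_mul, Finset.sum_smul, mul_smul, h0, smul_ite,
        smul_zero, Finset.sum_ite_eq', Finset.mem_univ, if_true, hc] at h2
      rw [← inv_smul_smul₀ (ξ j.1).ne_zero (ιD Q q (momentInv Q q i j) • m), h2]
      by_cases hij : i = j
      · subst hij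
        simp
      · simp [hij]

theorem J_smul_eq_zero (M : DMod Q q ξ) {m : M.obj} (hm : m ∈ invariants M.obj) {x : D Q q}
    (hx : x ∈ Jξ Q q ξ) : ιD Q q x • m = 0 := by
  induction hx using Submodule.span_induction with
  | mem x hx =>
    obtain ⟨y, hy, rfl⟩ := hx
    rw [μ_smul M hm, show trξ Q q ξ y = 0 from hy, zero_smul]
  | zero => rw [map_zero, zero_smul]
  | add x y _ _ hx hy => rw [map_add, add_smul, hx, hy, add_zero]
  | smul a x _ hx => rw [smul_eq_mul, map_mul, mul_smul, hx, smul_zero]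

theorem smul_mem_invariants (M : DMod Q q ξ) {m : M.obj} (hm : m ∈ invariants M.obj)
    {b : D Q q} (hb : b ∈ Nξ Q q ξ) : ιD Q q b • m ∈ invariants M.obj := by
  intro s i j
  rw [← mul_smul, smash_cross, Finset.sum_smul]
  simp only [mul_smul, hm _ _ _, smul_ite, smul_zero, Finset.sum_ite_eq', Finset.mem_univ, if_true]
  have h := J_smul_eq_zero M hm (hb s i j)
  rw [map_sub, sub_smul, sub_eq_zero] at h
  rw [h]
  split <;> simp

/-- The action of the subalgebra `Nξ` of `𝒟_q` on the invariants. -/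
noncomputable def actN (M : DMod Q q ξ) : Nξ Q q ξ →+* AddMonoid.End (invariants M.obj) where
  toFun b :=
    { toFun := fun m => ⟨ιD Q q b • m.1, smul_mem_invariants M m.2 b.2⟩
      map_zero' := Subtype.ext (smul_zero _)
      map_add' := fun m n => Subtype.ext (smul_add _ _ _) }
  map_one' := by
    ext m
    show ιD Q q 1 • m.1 = m.1
    rw [map_one, one_smul]
  map_mul' a b := by
    ext m
    show ιD Q q (a.1 * b.1) • m.1 = ιD Q q a.1 • ιD Q q b.1 • m.1
    rw [map_mul, mul_smul]
  map_zero' := by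
    ext m
    show ιD Q q 0 • m.1 = 0
    rw [map_zero, zero_smul]
  map_add' a b := by
    ext m
    show ιD Q q (a.1 + b.1) • m.1 = ιD Q q a.1 • m.1 + ιD Q q b.1 • m.1
    rw [map_add, add_smul]

/-- The action of `𝒜` on the invariants: `[b] m = b m`. -/
noncomputable def actA (M : DMod Q q ξ) : Aξ Q q ξ →+* AddMonoid.End (invariants M.obj) :=
  Ideal.Quotient.lift (Nideal Q q ξ) (actN M) fun b hb => by
    ext m
    exact J_smul_eq_zero M m.2 hb

noncomputable instance (M : DMod Q q ξ) : Module (Aξ Q q ξ) (invariants M.obj) :=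
  Module.compHom _ (actA M)

end Invariants

/-- The functor `M ↦ Hom_𝒞(1, M)` from equivariant `𝒟_q`-modules to `𝒜`-modules. -/
noncomputable def H : DMod Q q ξ ⥤ ModuleCat.{u} (Aξ Q q ξ) where
  obj M := ModuleCat.of _ (invariants M.obj)
  map {M N} f := ModuleCat.ofHom
    { toFun := fun m => ⟨f.hom.hom m.1, fun s i j => by
        rw [← map_smul, m.2 s i j]
        split <;> simp⟩
      map_add' := fun m n => Subtype.ext (map_add _ _ _)
      map_smul' := fun a m => by
        obtain ⟨b, rfl⟩ := Ideal.Quotient.mk_surjective a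
        exact Subtype.ext (map_smul f.hom.hom (ιD Q q b.1) m.1) }

/-- A module is aspherical if it has no nonzero invariants. -/
def aspherical : ObjectProperty (DMod Q q ξ) := fun M => ∀ m ∈ invariants M.obj, m = 0

end Modules

end QuiverQuantization

open CategoryTheory QuiverQuantization

/-!
Write `P = 𝒟_q / 𝒟_q μ(ℐ_ξ)`, with generator `e`, the class of `1`. The functor `ℍ` is
representable: a homomorphism `P → M` of equivariant modules is the same as an invariant of `M`,
the image of `e`, and the invariants of `P` itself are `𝒜`. So `ℍ` is the functor `Hom(P, -)`,
and what has to be shown is that `P` behaves like a compact projective object; it need not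
generate `𝒟_q-mod_𝒞`, which is why a quotient category appears. Three facts carry the proof.

*Invariants are exact* (`exists_mem_invariants`). A linear map `f : M → N` of modules over the
smash product, with `M` in `𝒞`, maps the invariants of `M` onto the invariants in its image. There
is no need for the classification of the finite-dimensional modules of `U`. Inside a
finite-dimensional submodule, a preimage `w` of an invariant vector is made invariant vertex by
vertex, and at each vertex under `U_q(𝔤𝔩_n)` for increasing `n`. For the step from `n` to `n + 1`,
a polynomial in `l^{+ n}_n` makes the weight of `w` zero. Then the part `T = ∑ q^(-2i) F_i E_i` of
the quantum Casimir element, where `E_i = l^{+ i}_n` and `F_i = l^{- n}_i`, preserves the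
`U_q(𝔤𝔩_n)`-invariant vectors of weight zero (`IsGL.IsStep.casimir`) and kills the
`U_q(𝔤𝔩_(n+1))`-invariant ones. If `E_0^(a+1) w = 0`, then `E_0^a T w` is `t` times `E_0^a w` for
an explicit scalar `t` (`IsGL.IsStep.pow_cas`), which is not zero if `a > 0`, since `q` is not a
root of unity. So `w - t⁻¹ T w` has the same image as `w` and is killed by `E_0^a`. In
the end `E_0 w = 0`, and a computation in the manner of `U_q(𝔰𝔩_2)` shows that all the `E_i` and
`F_i` kill `w`.

*`P` is an object of `𝒟_q-mod_𝒞`* (`isEquivariant_cyc`). The relations of `U` on `𝒟_q` follow from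
the Yang–Baxter equation (`act_braid`). The left ideal is stable under `U`, since `L^±` acts on the
matrix `μ(l)` by conjugation with an `R`-matrix, and the diagonal matrix to which `μ(l)` is congruent
commutes with the `R`-matrix (`act_mem_J`). Local finiteness and the type one condition hold on the
generators of `𝒟_q` and pass to products, and strong equivariance is the moment map identity.

*`ℍ` has a fully faithful left adjoint.* An `𝒜`-module `N` is sent to the quotient of the direct
sum of copies of `P`, indexed by the elements of `N`, by the relations of `N` (`leftObj`). By
exactness of the invariants, the unit `N → ℍ(leftObj N)` is bijective (`unitMap_bijective`); this
gives essential surjectivity. A functor with a fully faithful left adjoint is the localization at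
the morphisms which it inverts, and since `ℍ` is exact, these are the morphisms with kernel and
cokernel in `Ker ℍ`.
-/

namespace QuiverQuantization

/-! ### Commutation relations in `U_q(𝔤𝔩_d)` -/

/-- Elements `L s i j` of an algebra which satisfy the defining relations of `U_q(𝔤𝔩_d)`. The row
and column indices are natural numbers; only those below `d` are required to be invertible on the
diagonal. -/
structure IsGL {A : Type*} [Ring A] [Algebra ℂ A] (q : ℂ) (d : ℕ) (L : Sgn → ℕ → ℕ → A) :
    Prop where
  rtt (s : Sgn) (a b c e : ℕ) :
    (if c = e then q else 1) • (L s a c * L s b e) +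
      (if c < e then q - q⁻¹ else 0) • (L s a e * L s b c) =
    (if a = b then q else 1) • (L s b e * L s a c) +
      (if b < a then q - q⁻¹ else 0) • (L s a e * L s b c)
  rtt' (a b c e : ℕ) :
    (if c = e then q else 1) • (L .neg a c * L .pos b e) +
      (if c < e then q - q⁻¹ else 0) • (L .neg a e * L .pos b c) =
    (if a = b then q else 1) • (L .pos b e * L .neg a c) +
      (if b < a then q - q⁻¹ else 0) • (L .pos a e * L .neg b c)
  upper (i j : ℕ) (h : j < i) : L .pos i j = 0
  lower (i j : ℕ) (h : i < j) : L .neg i j = 0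
  diag (i : ℕ) (h : i < d) : L .pos i i * L .neg i i = 1
  diag' (i : ℕ) (h : i < d) : L .neg i i * L .pos i i = 1

/-- `m` is invariant under the subalgebra `U_q(𝔤𝔩_k)` generated by the `L s i j` with `i, j < k`. -/
def InvBelow {M : Type*} [AddCommGroup M] [Module ℂ M] (L : Sgn → ℕ → ℕ → Module.End ℂ M) (k : ℕ)
    (m : M) : Prop :=
  ∀ (s : Sgn) (i j : ℕ), i < k → j < k → L s i j m = if i = j then m else 0

namespace IsGL

variable {M : Type*} [AddCommGroup M] [Module ℂ M] {q : ℂ} {d n : ℕ}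
  {L : Sgn → ℕ → ℕ → Module.End ℂ M}

section Commutation

variable (h : IsGL q d L)
include h

theorem rtt_apply (s : Sgn) (a b c e : ℕ) (y : M) :
    (if c = e then q else 1) • L s a c (L s b e y) +
      (if c < e then q - q⁻¹ else 0) • L s a e (L s b c y) =
    (if a = b then q else 1) • L s b e (L s a c y) +
      (if b < a then q - q⁻¹ else 0) • L s a e (L s b c y) := by
  exact congrArg (· y) (h.rtt s a b c e)

theorem rtt'_apply (a b c e : ℕ) (y : M) :
    (if c = e then q else 1) • L .neg a c (L .pos b e y) +
      (if c < e then q - q⁻¹ else 0) • L .neg a e (L .pos b c y) =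
    (if a = b then q else 1) • L .pos b e (L .neg a c y) +
      (if b < a then q - q⁻¹ else 0) • L .pos a e (L .neg b c y) := by
  exact congrArg (· y) (h.rtt' a b c e)

theorem upper_apply {i j : ℕ} (hij : j < i) (y : M) : L .pos i j y = 0 := by
  rw [h.upper i j hij, LinearMap.zero_apply]

theorem lower_apply {i j : ℕ} (hij : i < j) (y : M) : L .neg i j y = 0 := by
  rw [h.lower i j hij, LinearMap.zero_apply]

/-- The commutation of `l^{+ a}_b`, `b < n`, with `E_j = l^{+ j}_n`. The lemmas below do the same
for `l^{- a}_b` and for `F_i = l^{- n}_i`. -/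
theorem pos_E {a b j : ℕ} (hb : b < n) (y : M) :
    L .pos a b (L .pos j n y) = (if a = j then q else 1) • L .pos j n (L .pos a b y) -
      (if a ≤ j then q - q⁻¹ else 0) • L .pos a n (L .pos j b y) := by
  have h1 := h.rtt_apply .pos a j b n y
  simp only [hb.ne, hb, if_true, if_false, one_smul] at h1
  by_cases hja : j < a
  · simp only [hja, hja.not_ge, if_true, if_false, zero_smul, sub_zero] at h1 ⊢
    exact add_right_cancel h1
  · simp only [hja, not_lt.1 hja, if_true, if_false, zero_smul, add_zero] at h1 ⊢
    rw [← h1, add_sub_cancel_right]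

theorem neg_E {a b j : ℕ} (ha : a < n) (hb : b < n) (y : M) :
    L .neg a b (L .pos j n y) = (if a = j then q else 1) • L .pos j n (L .neg a b y) +
      (if j < a then q - q⁻¹ else 0) • L .pos a n (L .neg j b y) := by
  have h1 := h.rtt'_apply a j b n y
  simpa only [hb.ne, hb, if_true, if_false, one_smul, h.lower_apply ha, map_zero, smul_zero,
    add_zero] using h1

theorem pos_F {a b i : ℕ} (ha : a < n) (hb : b < n) (y : M) :
    L .pos a b (L .neg n i y) = (if i = b then q else 1) • L .neg n i (L .pos a b y) +
      (if i < b then q - q⁻¹ else 0) • L .neg n b (L .pos a i y) := by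
  have h1 := h.rtt'_apply n a i b y
  simpa only [ha.ne', ha, if_true, if_false, one_smul, h.upper_apply hb, map_zero, smul_zero,
    add_zero] using h1.symm

theorem neg_F {a b i : ℕ} (ha : a < n) (y : M) :
    L .neg a b (L .neg n i y) = (if i = b then q else 1) • L .neg n i (L .neg a b y) -
      (if b ≤ i then q - q⁻¹ else 0) • L .neg n b (L .neg a i y) := by
  have h1 := h.rtt_apply .neg n a i b y
  simp only [ha.ne', ha, if_true, if_false, one_smul] at h1
  by_cases hib : i < b
  · simp only [hib, hib.not_ge, if_true, if_false, zero_smul, sub_zero] at h1 ⊢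
    exact (add_right_cancel h1).symm
  · simp only [hib, not_lt.1 hib, if_true, if_false, zero_smul, add_zero] at h1 ⊢
    rw [h1, add_sub_cancel_right]

theorem F_E {i j : ℕ} (hi : i < n) (hj : j < n) (y : M) :
    L .neg n i (L .pos j n y) + (q - q⁻¹) • L .neg n n (L .pos j i y) =
      L .pos j n (L .neg n i y) + (q - q⁻¹) • L .pos n n (L .neg j i y) := by
  have h1 := h.rtt'_apply n j i n y
  simpa only [hi.ne, hj.ne', hi, hj, if_true, if_false, one_smul] using h1

theorem E_E {i j : ℕ} (hij : i < j) (y : M) :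
    L .pos i n (L .pos j n y) = q⁻¹ • L .pos j n (L .pos i n y) := by
  have h1 := h.rtt_apply .pos j i n n y
  simp only [hij, hij.ne', lt_irrefl, if_true, if_false, one_smul, zero_smul, add_zero] at h1
  linear_combination (norm := module) -h1

theorem nn_E (hq : q ≠ 0) {i : ℕ} (hi : i < n) (y : M) :
    L .pos n n (L .pos i n y) = q • L .pos i n (L .pos n n y) := by
  have h1 := h.rtt_apply .pos n i n n y
  simp only [hi, hi.ne', lt_irrefl, if_true, if_false, one_smul, zero_smul, add_zero] at h1
  have h2 := congrArg (q • ·) h1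
  simp only [smul_add, smul_smul, mul_sub, mul_inv_cancel₀ hq] at h2
  linear_combination (norm := module) h2

theorem nn_F (hq : q ≠ 0) {i : ℕ} (hi : i < n) (y : M) :
    L .pos n n (L .neg n i y) = q⁻¹ • L .neg n i (L .pos n n y) := by
  have h1 := h.rtt'_apply n n i n y
  simp only [hi, hi.ne, lt_irrefl, if_true, if_false, one_smul, zero_smul, add_zero,
    h.upper_apply hi, map_zero, smul_zero] at h1
  rw [h1, smul_smul (q⁻¹ : ℂ), inv_mul_cancel₀ hq, one_smul]

theorem nn_comm (s : Sgn) {a b : ℕ} (ha : a < n) (hb : b < n) (y : M) :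
    L s a b (L .pos n n y) = L .pos n n (L s a b y) := by
  cases s with
  | pos =>
    have h1 := h.rtt_apply .pos a n b n y
    simpa only [ha.ne, hb.ne, ha.not_gt, hb, if_true, if_false, one_smul, zero_smul, add_zero,
      h.upper_apply hb, map_zero, smul_zero] using h1
  | neg =>
    have h1 := h.rtt'_apply a n b n y
    simpa only [ha.ne, hb.ne, ha.not_gt, hb, if_true, if_false, one_smul, zero_smul, add_zero,
      h.lower_apply ha, map_zero, smul_zero] using h1

theorem neg_of_pos {i : ℕ} (hi : i < d) {c : ℂ} (hc : c ≠ 0) {y : M}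
    (hy : L .pos i i y = c • y) : L .neg i i y = c⁻¹ • y := by
  have h1 : L .neg i i (L .pos i i y) = y := congrArg (· y) (h.diag' i hi)
  rw [hy, map_smul] at h1
  conv_rhs => rw [← h1]
  rw [smul_smul, inv_mul_cancel₀ hc, one_smul]

end Commutation

/-! ### The Casimir operator -/

/-- `w` is invariant under `U_q(𝔤𝔩_n)` and has weight `0` for the next diagonal generator. -/
structure IsStep (L : Sgn → ℕ → ℕ → Module.End ℂ M) (n : ℕ) (w : M) : Prop where
  inv : InvBelow L n w
  wt : L .pos n n w = w

/-- The part `∑ q^(-2i) F_i E_i` of the quantum Casimir operator of `U_q(𝔤𝔩_(n+1))`, where `E_i =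
l^{+ i}_n` and `F_i = l^{- n}_i`. -/
noncomputable def casimir (q : ℂ) (L : Sgn → ℕ → ℕ → Module.End ℂ M) (n : ℕ) : Module.End ℂ M :=
  ∑ i ∈ Finset.range n, (q⁻¹ ^ (2 * i)) • (L .neg n i * L .pos i n)

theorem casimir_apply (w : M) : casimir q L n w =
    ∑ i ∈ Finset.range n, (q⁻¹ ^ (2 * i)) • L .neg n i (L .pos i n w) := by
  simp [casimir, LinearMap.sum_apply]

section Step

variable (h : IsGL q d L) (hq : q ≠ 0) (hn : n < d) {w : M} (hw : IsStep L n w)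

include hq in
/-- The partial sums of the coefficients of `F_b E_a` in `l^{+ a}_b T w`, see `IsStep.L_FE_pos`. The
sum telescopes and vanishes as soon as `k > b`. -/
theorem cas_coeff (a b k : ℕ) (hab : a < b) :
    ∑ i ∈ Finset.range k, q⁻¹ ^ (2 * i) * ((if i = a then (q - q⁻¹) * q else 0) -
      (if i = b then (q - q⁻¹) * q else 0) - (if a ≤ i ∧ i < b then (q - q⁻¹) ^ 2 else 0)) =
    if a < k ∧ k ≤ b then (q - q⁻¹) * q * q⁻¹ ^ (2 * k) else 0 := by
  have hq' : q * q⁻¹ = 1 := mul_inv_cancel₀ hq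
  induction k with
  | zero => simp
  | succ k ih =>
    rw [Finset.sum_range_succ, ih]
    rw [mul_add 2 k 1, pow_add q⁻¹ (2 * k)]
    generalize q⁻¹ ^ (2 * k) = x
    generalize q⁻¹ = p at *
    rcases lt_trichotomy k a with h1 | rfl | h1
    · simp [h1.ne, (h1.trans hab).ne, h1.not_ge, h1.not_gt, show ¬ (a < k + 1) by omega]
    · have h2 : k + 1 ≤ b := hab
      simp [hab, hab.ne, h2]
      linear_combination (x * p ^ 2 - x * (p * q)) * hq'
    · rcases lt_trichotomy k b with h2 | rfl | h2
      · have h3 : k + 1 ≤ b := h2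
        simp [h1, h1.ne', h2, h2.ne, h2.le, h1.le, h3, h1.trans (Nat.lt_succ_self _)]
        linear_combination -(x * (q - p) * p) * hq'
      · simp [h1, h1.ne']; ring
      · simp [h1.ne', h2.ne', h2.not_ge, h2.not_gt, show ¬ (k + 1 ≤ b) by omega]

include h hw

/-- Under `U_q(𝔤𝔩_n)`, the vectors `E_i w` transform as in the vector representation. -/
theorem IsStep.L_E (s : Sgn) {a b i : ℕ} (ha : a < n) (hb : b < n) (hi : i < n) :
    L s a b (L .pos i n w) = match s with
      | .pos => (if a = i then q else 1) • (if a = b then L .pos i n w else 0) -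
          (if a ≤ i then q - q⁻¹ else 0) • (if i = b then L .pos a n w else 0)
      | .neg => (if a = i then q else 1) • (if a = b then L .pos i n w else 0) +
          (if i < a then q - q⁻¹ else 0) • (if i = b then L .pos a n w else 0) := by
  cases s with
  | pos =>
    dsimp only
    rw [h.pos_E hb, hw.inv _ _ _ ha hb, hw.inv _ _ _ hi hb]
    split_ifs <;> simp
  | neg =>
    dsimp only
    rw [h.neg_E ha hb, hw.inv _ _ _ ha hb, hw.inv _ _ _ hi hb]
    split_ifs <;> simp

include hq in
theorem IsStep.L_FE_diag (s : Sgn) {a i : ℕ} (ha : a < n) (hi : i < n) :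
    L s a a (L .neg n i (L .pos i n w)) = L .neg n i (L .pos i n w) := by
  have hq' : q * q⁻¹ = 1 := mul_inv_cancel₀ hq
  have key : ∀ y : M, q • (q • y) - q • ((q - q⁻¹) • y) = y := by
    intro y
    rw [← smul_sub, ← sub_smul, sub_sub_cancel, smul_smul, hq', one_smul]
  have key' : ∀ y : M, q • (q • y) - (q - q⁻¹) • q • y = y := by
    intro y
    rw [← sub_smul, sub_sub_cancel, smul_smul, inv_mul_cancel₀ hq, one_smul]
  cases s with
  | pos =>
    rw [h.pos_F ha ha, hw.L_E h _ ha ha hi, hw.L_E h _ ha hi hi]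
    rcases lt_trichotomy i a with h1 | rfl | h1
    · simp [h1, h1.ne, h1.ne', h1.not_ge]
    · simp [key, smul_sub]
    · simp [h1, h1.ne, h1.ne', h1.not_gt, h1.le]
  | neg =>
    rw [h.neg_F ha, hw.L_E h _ ha ha hi, hw.L_E h _ ha hi hi]
    rcases lt_trichotomy i a with h1 | rfl | h1
    · simp [h1, h1.ne, h1.ne', h1.not_ge]
    · simp [key']
    · simp [h1, h1.ne, h1.ne', h1.not_gt, h1.le]

theorem IsStep.L_FE_pos {a b i : ℕ} (hab : a < b) (hb : b < n) (hi : i < n) :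
    L .pos a b (L .neg n i (L .pos i n w)) = ((if i = a then (q - q⁻¹) * q else 0) -
      (if i = b then (q - q⁻¹) * q else 0) - (if a ≤ i ∧ i < b then (q - q⁻¹) ^ 2 else 0)) •
        L .neg n b (L .pos a n w) := by
  have ha := hab.trans hb
  rw [h.pos_F ha hb, hw.L_E h _ ha hb hi, hw.L_E h _ ha hi hi]
  rcases lt_trichotomy i a with h1 | rfl | h1
  · simp [h1, h1.ne, h1.ne', h1.not_ge, hab.ne, (h1.trans hab).ne]
  · simp [hab, hab.ne]
    module
  · rcases lt_trichotomy i b with h2 | rfl | h2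
    · simp [h1.ne', h1.ne, h2.ne, h2, h1.le, hab.ne]
      module
    · simp [h1.ne', h1.ne, h1.le]
      module
    · simp [h1.ne', h1.ne, h2.ne', h2.not_gt, hab.ne]

theorem IsStep.L_FE_neg {a b i : ℕ} (hab : a < b) (hb : b < n) (hi : i < n) :
    L .neg b a (L .neg n i (L .pos i n w)) = ((if i = a then (q - q⁻¹) * q else 0) -
      (if i = b then (q - q⁻¹) * q else 0) - (if a ≤ i ∧ i < b then (q - q⁻¹) ^ 2 else 0)) •
        L .neg n a (L .pos b n w) := by
  have ha := hab.trans hb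
  rw [h.neg_F hb, hw.L_E h _ hb ha hi, hw.L_E h _ hb hi hi]
  rcases lt_trichotomy i a with h1 | rfl | h1
  · simp [h1, h1.ne, h1.ne', h1.not_ge, hab.ne', (h1.trans hab).ne, (h1.trans hab).ne']
  · simp [hab, hab.ne, hab.ne']
    module
  · rcases lt_trichotomy i b with h2 | rfl | h2
    · simp [h1.ne', h1.ne, h2.ne, h2.ne', h2, h1.le, hab.ne']
      module
    · simp [h1.ne', h1.ne, h1.le]
      module
    · simp [h1.ne', h1.ne, h2.ne', h2.ne, h2.not_gt, hab.ne']

include hq in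
/-- The operator `casimir` preserves the vectors which are invariant under `U_q(𝔤𝔩_n)` and have
weight `0`. -/
theorem IsStep.casimir : IsStep L n (IsGL.casimir q L n w) where
  wt := by
    rw [casimir_apply, map_sum]
    refine Finset.sum_congr rfl fun i hi => ?_
    have hi := Finset.mem_range.1 hi
    rw [map_smul, h.nn_F hq hi, h.nn_E hq hi, hw.wt, map_smul, smul_smul q⁻¹, inv_mul_cancel₀ hq,
      one_smul]
  inv := by
    intro s a b ha hb
    rcases lt_trichotomy a b with hab | rfl | hab
    · rw [if_neg hab.ne]
      cases s with
      | neg => exact h.lower_apply hab _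
      | pos =>
        have h1 := cas_coeff hq a b n hab
        rw [if_neg (fun h2 => h2.2.not_gt hb)] at h1
        rw [casimir_apply, map_sum, ← zero_smul ℂ (L .neg n b (L .pos a n w)), ← h1, Finset.sum_smul]
        refine Finset.sum_congr rfl fun i hi => ?_
        rw [map_smul, hw.L_FE_pos h hab hb (Finset.mem_range.1 hi), smul_smul]
    · rw [if_pos rfl, casimir_apply, map_sum]
      refine Finset.sum_congr rfl fun i hi => ?_
      rw [map_smul, hw.L_FE_diag h hq s ha (Finset.mem_range.1 hi)]
    · rw [if_neg hab.ne']
      cases s with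
      | pos => exact h.upper_apply hab _
      | neg =>
        have h1 := cas_coeff hq b a n hab
        rw [if_neg (fun h2 => h2.2.not_gt ha)] at h1
        rw [casimir_apply, map_sum, ← zero_smul ℂ (L .neg n b (L .pos a n w)), ← h1, Finset.sum_smul]
        refine Finset.sum_congr rfl fun i hi => ?_
        rw [map_smul, hw.L_FE_neg h hab ha (Finset.mem_range.1 hi), smul_smul]

end Step

/-! ### Powers of `E_0` and `F_0` -/

theorem geom_sum_inv {q : ℂ} (hq : q ≠ 0) (k : ℕ) (hk : 0 < k) :
    (q - q⁻¹) * ∑ i ∈ Finset.range k, (if i = 0 then 0 else q⁻¹ ^ (2 * i)) =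
      q⁻¹ - q * q⁻¹ ^ (2 * k) := by
  have hq' : q * q⁻¹ = 1 := mul_inv_cancel₀ hq
  induction k, hk using Nat.le_induction with
  | base => simp; linear_combination q⁻¹ * hq'
  | succ k hk ih =>
    rw [Finset.sum_range_succ, mul_add, ih, if_neg (by omega), mul_add 2 k, pow_add]
    linear_combination q⁻¹ ^ (2 * k) * q⁻¹ * hq'

section Power

variable (h : IsGL q d L) (hq : q ≠ 0) (hn : n < d) {w : M} (hw : IsStep L n w)
include h hq hn hw

theorem IsStep.neg_nn : L .neg n n w = w := by
  have := h.neg_of_pos hn one_ne_zero (y := w) (by rw [hw.wt, one_smul])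
  simpa using this

theorem IsStep.F_E_comm {i : ℕ} (hi : i < n) :
    L .neg n i (L .pos i n w) = L .pos i n (L .neg n i w) := by
  have h1 := h.F_E hi hi w
  rw [hw.inv _ _ _ hi hi, hw.inv _ _ _ hi hi, if_pos rfl, hw.wt, hw.neg_nn h hq hn] at h1
  exact add_right_cancel h1

variable (h0 : 0 < n)
include h0

theorem IsStep.nn_pow (m : ℕ) :
    L .pos n n ((L .pos 0 n ^ m) w) = q ^ m • (L .pos 0 n ^ m) w := by
  induction m with
  | zero => simp [hw.wt]
  | succ m ih =>
    rw [pow_succ', Module.End.mul_apply, h.nn_E hq h0, ih, map_smul, smul_smul, pow_succ']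

theorem IsStep.neg_nn_pow (m : ℕ) :
    L .neg n n ((L .pos 0 n ^ m) w) = q⁻¹ ^ m • (L .pos 0 n ^ m) w := by
  rw [h.neg_of_pos hn (pow_ne_zero m hq) (hw.nn_pow h hq hn h0 m), inv_pow]

theorem IsStep.diag_pow {i : ℕ} (hi : i < n) (hi0 : 0 < i) (m : ℕ) :
    L .pos i i ((L .pos 0 n ^ m) w) = (L .pos 0 n ^ m) w := by
  induction m with
  | zero => simp [hw.inv _ _ _ hi hi]
  | succ m ih =>
    rw [pow_succ', Module.End.mul_apply, h.pos_E hi, ih]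
    simp [hi0.ne']

theorem IsStep.neg_diag_pow {i : ℕ} (hi : i < n) (hi0 : 0 < i) (m : ℕ) :
    L .neg i i ((L .pos 0 n ^ m) w) = (L .pos 0 n ^ m) w := by
  have h1 := hw.diag_pow h hq hn h0 hi hi0 m
  rw [← one_smul ℂ ((L .pos 0 n ^ m) w), map_smul, one_smul] at h1
  simpa using h.neg_of_pos (hi.trans hn) one_ne_zero h1

theorem IsStep.zero_pow (m : ℕ) :
    L .pos 0 0 ((L .pos 0 n ^ m) w) = q⁻¹ ^ m • (L .pos 0 n ^ m) w := by
  induction m with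
  | zero => simp [hw.inv _ _ _ h0 h0]
  | succ m ih =>
    rw [pow_succ', Module.End.mul_apply, h.pos_E h0, ih]
    simp only [if_true, le_refl, map_smul, pow_succ q⁻¹]
    module

theorem IsStep.neg_zero_pow (m : ℕ) :
    L .neg 0 0 ((L .pos 0 n ^ m) w) = q ^ m • (L .pos 0 n ^ m) w := by
  rw [h.neg_of_pos (h0.trans hn) (pow_ne_zero m (inv_ne_zero hq)) (hw.zero_pow h hq hn h0 m),
    inv_pow, inv_inv]

theorem IsStep.pos_zero_pow {i : ℕ} (hi : i < n) (hi0 : 0 < i) (m : ℕ) :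
    L .pos 0 i ((L .pos 0 n ^ m) w) = 0 := by
  induction m with
  | zero => simp [hw.inv _ _ _ h0 hi, hi0.ne]
  | succ m ih =>
    rw [pow_succ', Module.End.mul_apply, h.pos_E hi, ih]
    simp

/-- The operator `l^{- i}_0` changes one factor `E_0` into `E_i`. -/
theorem IsStep.neg_pow_zero {i : ℕ} (hi : i < n) (hi0 : 0 < i) (m : ℕ) :
    L .neg i 0 ((L .pos 0 n ^ (m + 1)) w) =
      (q ^ (m + 1) - q⁻¹ ^ (m + 1)) • L .pos i n ((L .pos 0 n ^ m) w) := by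
  induction m with
  | zero =>
    rw [zero_add, pow_one, h.neg_E hi h0]
    simp [hw.inv _ _ _ hi h0, hw.inv _ _ _ h0 h0, hi0, hi0.ne']
  | succ m ih =>
    rw [pow_succ', Module.End.mul_apply, h.neg_E hi h0, ih, hw.neg_zero_pow h hq hn h0,
      if_neg hi0.ne', if_pos hi0, map_smul, map_smul, h.E_E hi0, ← Module.End.mul_apply (L .pos 0 n),
      ← pow_succ']
    have hq' : q * q⁻¹ = 1 := mul_inv_cancel₀ hq
    simp only [smul_smul, ← add_smul, one_mul]
    congr 1
    rw [pow_succ q (m + 1), pow_succ q⁻¹ (m + 1), pow_succ q m, pow_succ q⁻¹ m]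
    ring

/-- If `E_0^(a+1)` kills `w`, then all the `E_i` kill `E_0^a w`. -/
theorem IsStep.E_pow_eq_zero (hq1 : ∀ k : ℕ, 0 < k → q ^ k ≠ 1) {a : ℕ}
    (ha : (L .pos 0 n ^ (a + 1)) w = 0) {i : ℕ} (hi : i < n) :
    L .pos i n ((L .pos 0 n ^ a) w) = 0 := by
  rcases Nat.eq_zero_or_pos i with rfl | hi0
  · rwa [← Module.End.mul_apply, ← pow_succ']
  · have h1 := hw.neg_pow_zero h hq hn h0 hi hi0 a
    rw [ha, map_zero] at h1
    refine (smul_eq_zero.1 h1.symm).resolve_left fun h2 => hq1 (2 * (a + 1)) (by omega) ?_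
    rw [sub_eq_zero, inv_pow] at h2
    rw [two_mul, pow_add]
    nth_rewrite 2 [h2]
    exact mul_inv_cancel₀ (pow_ne_zero _ hq)

theorem IsStep.pow_E {i : ℕ} (hi0 : 0 < i) (a : ℕ) (y : M) :
    (L .pos 0 n ^ a) (L .pos i n y) = q⁻¹ ^ a • L .pos i n ((L .pos 0 n ^ a) y) := by
  induction a with
  | zero => simp
  | succ a ih =>
    rw [pow_succ', Module.End.mul_apply, ih, map_smul, h.E_E hi0, smul_smul, pow_succ q⁻¹,
      Module.End.mul_apply]

theorem IsStep.pow_F {i : ℕ} (hi : i < n) (hi0 : 0 < i) (a : ℕ) :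
    (L .pos 0 n ^ a) (L .neg n i w) = L .neg n i ((L .pos 0 n ^ a) w) := by
  induction a with
  | zero => simp
  | succ a ih =>
    have h1 := h.F_E hi h0 ((L .pos 0 n ^ a) w)
    rw [hw.pos_zero_pow h hq hn h0 hi hi0, h.lower_apply hi0] at h1
    rw [pow_succ', Module.End.mul_apply, ih, Module.End.mul_apply]
    simpa using h1.symm

theorem IsStep.F_zero_pow (a : ℕ) :
    L .pos 0 n (L .neg n 0 ((L .pos 0 n ^ a) w)) = L .neg n 0 ((L .pos 0 n ^ (a + 1)) w) +
      ((q - q⁻¹) * (q⁻¹ ^ (2 * a) - q ^ (2 * a))) • (L .pos 0 n ^ a) w := by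
  have h1 := h.F_E h0 h0 ((L .pos 0 n ^ a) w)
  rw [hw.zero_pow h hq hn h0, hw.neg_zero_pow h hq hn h0, map_smul, map_smul,
    hw.nn_pow h hq hn h0, hw.neg_nn_pow h hq hn h0, ← Module.End.mul_apply (L .pos 0 n),
      ← pow_succ'] at h1
  rw [two_mul, pow_add q⁻¹, pow_add q]
  linear_combination (norm := module) (-1 : ℂ) • h1

/-- Moving the power of `E_0` across `F_0`. -/
theorem IsStep.pow_F_zero (a : ℕ) :
    (L .pos 0 n ^ (a + 1)) (L .neg n 0 w) = L .neg n 0 ((L .pos 0 n ^ (a + 1)) w) -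
      ((q ^ (a + 1) - q⁻¹ ^ (a + 1)) * (q ^ a - q⁻¹ ^ a)) • (L .pos 0 n ^ a) w := by
  have hq' : q * q⁻¹ = 1 := mul_inv_cancel₀ hq
  induction a with
  | zero =>
    have h1 := hw.F_zero_pow h hq hn h0 0
    simpa using h1
  | succ a ih =>
    rw [pow_succ' _ (a + 1), Module.End.mul_apply, ih, map_sub, map_smul,
      hw.F_zero_pow h hq hn h0, ← Module.End.mul_apply (L .pos 0 n), ← pow_succ', ← pow_succ',
      add_sub_assoc, ← sub_smul, sub_eq_add_neg _ (_ • _), ← neg_smul]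
    congr 2
    have hx : q ^ a * q⁻¹ ^ a = 1 := by rw [← mul_pow, hq', one_pow]
    simp only [two_mul, pow_add, pow_one]
    generalize q ^ a = x at *
    generalize q⁻¹ ^ a = y at *
    generalize q⁻¹ = p at *
    linear_combination (x * q - y * p) * (x - y) * hq'

theorem IsStep.E_F_E_pow (hq1 : ∀ k : ℕ, 0 < k → q ^ k ≠ 1) {a : ℕ}
    (ha : (L .pos 0 n ^ (a + 1)) w = 0) {i : ℕ} (hi : i < n) (hi0 : 0 < i) :
    (L .pos 0 n ^ a) (L .neg n i (L .pos i n w)) =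
      (q⁻¹ ^ a * ((q - q⁻¹) * (q⁻¹ ^ a - q ^ a))) • (L .pos 0 n ^ a) w := by
  have h1 := h.F_E hi hi ((L .pos 0 n ^ a) w)
  rw [hw.E_pow_eq_zero h hq hn h0 hq1 ha hi, hw.diag_pow h hq hn h0 hi hi0,
    hw.neg_diag_pow h hq hn h0 hi hi0, hw.neg_nn_pow h hq hn h0, hw.nn_pow h hq hn h0, map_zero,
    zero_add] at h1
  rw [hw.F_E_comm h hq hn hi, hw.pow_E h hq hn h0 hi0, hw.pow_F h hq hn h0 hi hi0, mul_smul]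
  congr 1
  linear_combination (norm := module) -h1

/-- If `E_0^(a+1)` kills `w`, then `E_0^a T w` is a multiple of `E_0^a w` for the operator
`T = casimir`; the scalar vanishes only for `a = 0` if `q` is not a root of unity. -/
theorem IsStep.pow_cas (hq1 : ∀ k : ℕ, 0 < k → q ^ k ≠ 1) {a : ℕ}
    (ha : (L .pos 0 n ^ (a + 1)) w = 0) :
    (L .pos 0 n ^ a) (IsGL.casimir q L n w) =
      (-(q ^ a - q⁻¹ ^ a) * (q ^ (a + 1) - q * q⁻¹ ^ (a + 2 * n))) • (L .pos 0 n ^ a) w := by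
  have h2 : ∀ i ∈ Finset.range n, (L .pos 0 n ^ a) (q⁻¹ ^ (2 * i) • L .neg n i (L .pos i n w)) =
      ((if i = 0 then -((q ^ (a + 1) - q⁻¹ ^ (a + 1)) * (q ^ a - q⁻¹ ^ a)) else 0) +
        (q⁻¹ ^ a * (q⁻¹ ^ a - q ^ a)) * ((q - q⁻¹) * if i = 0 then 0 else q⁻¹ ^ (2 * i))) •
        (L .pos 0 n ^ a) w := by
    intro i hi
    have hi := Finset.mem_range.1 hi
    rcases Nat.eq_zero_or_pos i with rfl | hi0
    · rw [hw.F_E_comm h hq hn hi, map_smul, ← Module.End.mul_apply (_ ^ a), ← pow_succ,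
        hw.pow_F_zero h hq hn h0, ha]
      simp
    · rw [map_smul, hw.E_F_E_pow h hq hn h0 hq1 ha hi hi0, smul_smul, if_neg hi0.ne',
        if_neg hi0.ne']
      congr 1
      ring
  rw [casimir_apply, map_sum, Finset.sum_congr rfl h2, ← Finset.sum_smul, Finset.sum_add_distrib,
    ← Finset.mul_sum, ← Finset.mul_sum, geom_sum_inv hq n h0, Finset.sum_ite_eq',
    if_pos (Finset.mem_range.2 h0)]
  congr 1
  rw [pow_add q⁻¹, pow_add]
  ring

theorem IsStep.nn_F_pow (m : ℕ) :
    L .pos n n ((L .neg n 0 ^ m) w) = q⁻¹ ^ m • (L .neg n 0 ^ m) w := by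
  induction m with
  | zero => simp [hw.wt]
  | succ m ih =>
    rw [pow_succ', Module.End.mul_apply, h.nn_F hq h0, ih, map_smul, smul_smul, pow_succ']

theorem IsStep.zero_F_pow (m : ℕ) :
    L .pos 0 0 ((L .neg n 0 ^ m) w) = q ^ m • (L .neg n 0 ^ m) w := by
  induction m with
  | zero => simp [hw.inv _ _ _ h0 h0]
  | succ m ih =>
    rw [pow_succ', Module.End.mul_apply, h.pos_F h0 h0, ih]
    simp [smul_smul, pow_succ']

/-- On a vector killed by `E_0`, the powers of `F_0` behave as in `U_q(𝔰𝔩_2)`. -/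
theorem IsStep.E_F_pow (hE : L .pos 0 n w = 0) (b : ℕ) :
    L .pos 0 n ((L .neg n 0 ^ (b + 1)) w) =
      ((q ^ (b + 1) - q⁻¹ ^ (b + 1)) * (q ^ b - q⁻¹ ^ b)) • (L .neg n 0 ^ b) w := by
  have hq' : q * q⁻¹ = 1 := mul_inv_cancel₀ hq
  have hF := fun b => h.F_E h0 h0 ((L .neg n 0 ^ b) w)
  have hn' := fun b => h.neg_of_pos hn (pow_ne_zero b (inv_ne_zero hq)) (hw.nn_F_pow h hq hn h0 b)
  have hz' := fun b => h.neg_of_pos (h0.trans hn) (pow_ne_zero b hq) (hw.zero_F_pow h hq hn h0 b)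
  simp only [hw.nn_F_pow h hq hn h0, hw.zero_F_pow h hq hn h0, hn', hz', map_smul] at hF
  induction b with
  | zero =>
    have h1 := hF 0
    simp only [pow_zero, Module.End.one_apply, hE, map_zero, inv_one, one_smul, zero_add] at h1
    rw [zero_add, pow_one]
    simpa using h1
  | succ b ih =>
    have h1 := hF (b + 1)
    rw [ih, map_smul, ← Module.End.mul_apply (L .neg n 0), ← pow_succ'] at h1
    rw [pow_succ' _ (b + 1), Module.End.mul_apply]
    have h2 : ((q ^ (b + 1 + 1) - q⁻¹ ^ (b + 1 + 1)) * (q ^ (b + 1) - q⁻¹ ^ (b + 1))) =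
        (q ^ (b + 1) - q⁻¹ ^ (b + 1)) * (q ^ b - q⁻¹ ^ b) +
          (q - q⁻¹) * (q ^ (b + 1) * q ^ (b + 1) - q⁻¹ ^ (b + 1) * q⁻¹ ^ (b + 1)) := by
      have hx : q ^ b * q⁻¹ ^ b = 1 := by rw [← mul_pow, hq', one_pow]
      simp only [pow_add, pow_one]
      generalize q ^ b = x at *
      generalize q⁻¹ ^ b = y at *
      generalize q⁻¹ = p at *
      linear_combination (x * q - y * p) * (x - y) * hq'
    rw [h2]
    simp only [inv_pow, inv_inv] at h1 ⊢
    linear_combination (norm := module) (-1 : ℂ) • h1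

end Power
end IsGL

/-! ### Lifting invariants over `U_q(𝔤𝔩_d)` -/

theorem map_aeval_apply {M N : Type*} [AddCommGroup M] [Module ℂ M] [AddCommGroup N] [Module ℂ N]
    (f : M →ₗ[ℂ] N) (T : Module.End ℂ M) (T' : Module.End ℂ N) (h : ∀ x, f (T x) = T' (f x))
    (p : Polynomial ℂ) (x : M) :
    f (Polynomial.aeval T p x) = Polynomial.aeval T' p (f x) := by
  induction p using Polynomial.induction_on' with
  | add a b ha hb => simp only [map_add, LinearMap.add_apply, ha, hb]
  | monomial n c =>
    simp only [Polynomial.aeval_monomial, Module.End.mul_apply, Module.algebraMap_end_apply,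
      map_smul]
    congr 1
    induction n with
    | zero => rfl
    | succ n ih => rw [pow_succ', pow_succ', Module.End.mul_apply, Module.End.mul_apply, h, ih]

theorem aeval_apply_of_fixed {M : Type*} [AddCommGroup M] [Module ℂ M] (T : Module.End ℂ M) {x : M}
    (h : T x = x) (p : Polynomial ℂ) : Polynomial.aeval T p x = p.eval 1 • x := by
  have h1 := map_aeval_apply (LinearMap.toSpanSingleton ℂ M x) 1 T (by simp [h]) p 1
  simp only [LinearMap.toSpanSingleton_apply, one_smul] at h1
  rw [← h1, ← map_one (algebraMap ℂ (Module.End ℂ ℂ)), Polynomial.aeval_algebraMap_apply,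
    Module.algebraMap_end_apply, smul_eq_mul, mul_one, Polynomial.coe_aeval_eq_eval]

/-- The projection to an eigenspace: if `w` is annihilated by a product of distinct linear factors
in `T`, then some polynomial in `T` which fixes the `1`-eigenvectors maps `w` to such a vector. -/
theorem exists_aeval_fixed {M : Type*} [AddCommGroup M] [Module ℂ M] (T : Module.End ℂ M) {w : M}
    {S : Finset ℂ} (h : Polynomial.aeval T (∏ z ∈ S, (Polynomial.X - Polynomial.C z)) w = 0) :
    ∃ p : Polynomial ℂ, p.eval 1 = 1 ∧ T (Polynomial.aeval T p w) = Polynomial.aeval T p w := by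
  classical
  set r := ∏ z ∈ S.erase 1, (Polynomial.X - Polynomial.C z) with hr
  have h1 : r.eval 1 ≠ 0 := by
    rw [hr, Polynomial.eval_prod, Finset.prod_ne_zero_iff]
    intro z hz
    simpa [sub_ne_zero] using (Finset.ne_of_mem_erase hz).symm
  refine ⟨Polynomial.C (r.eval 1)⁻¹ * r, by simp [h1], ?_⟩
  have h2 : Polynomial.aeval T ((Polynomial.X - Polynomial.C 1) * r) w = 0 := by
    by_cases h3 : (1 : ℂ) ∈ S
    · rwa [hr, Finset.mul_prod_erase S (fun z => Polynomial.X - Polynomial.C z) h3]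
    · rw [hr, Finset.erase_eq_of_notMem h3, map_mul, Module.End.mul_apply, h, map_zero]
  rw [map_mul, Module.End.mul_apply] at h2
  rw [map_mul, Module.End.mul_apply, Polynomial.aeval_C, Module.algebraMap_end_apply, map_smul]
  congr 1
  simpa [sub_eq_zero] using h2

/-- A chain of eigenvectors with distinct eigenvalues in a finite-dimensional space stops. -/
theorem exists_eq_zero_of_eigen {M : Type*} [AddCommGroup M] [Module ℂ M] (T : Module.End ℂ M)
    (K : Submodule ℂ M) [FiniteDimensional ℂ K] (x : ℕ → M) (hx : ∀ m, x m ∈ K) (c : ℕ → ℂ)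
    (hc : Function.Injective c) (h : ∀ m, T (x m) = c m • x m) : ∃ m, x m = 0 := by
  by_contra! h0
  have h1 : LinearIndependent ℂ x := Module.End.eigenvectors_linearIndependent' T c hc x
    fun m => ⟨Module.End.mem_eigenspace_iff.2 (h m), h0 m⟩
  have h2 : LinearIndependent ℂ fun m => (⟨x m, hx m⟩ : K) :=
    LinearIndependent.of_comp K.subtype h1
  have := h2.finite
  exact not_finite ℕ

theorem pow_injective_of_ne_one {q : ℂ} (hq : q ≠ 0) (hq1 : ∀ k : ℕ, 0 < k → q ^ k ≠ 1) :
    Function.Injective fun m : ℕ => q ^ m := by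
  have key : ∀ a b : ℕ, a < b → q ^ a ≠ q ^ b := by
    intro a b hab h
    refine hq1 (b - a) (by omega) ?_
    have h1 : q ^ a * q ^ (b - a) = q ^ a * 1 := by
      rw [← pow_add, Nat.add_sub_cancel' hab.le, ← h, mul_one]
    exact mul_left_cancel₀ (pow_ne_zero _ hq) h1
  intro a b hab
  rcases lt_trichotomy a b with h | h | h
  · exact (key a b h hab).elim
  · exact h
  · exact (key b a h hab.symm).elim

theorem pow_sub_inv_pow_ne_zero {q : ℂ} (hq : q ≠ 0) (hq1 : ∀ k : ℕ, 0 < k → q ^ k ≠ 1) {a : ℕ}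
    (ha : 0 < a) : q ^ a - q⁻¹ ^ a ≠ 0 := by
  intro h
  refine hq1 (2 * a) (by omega) ?_
  rw [sub_eq_zero, inv_pow] at h
  rw [two_mul, pow_add]
  nth_rewrite 2 [h]
  exact mul_inv_cancel₀ (pow_ne_zero _ hq)

namespace IsGL

variable {M : Type*} [AddCommGroup M] [Module ℂ M] {q : ℂ} {d n : ℕ}
  {L : Sgn → ℕ → ℕ → Module.End ℂ M}

theorem InvBelow.mono {k l : ℕ} (hkl : k ≤ l) {m : M} (h : InvBelow L l m) : InvBelow L k m :=
  fun s i j hi hj => h s i j (hi.trans_le hkl) (hj.trans_le hkl)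

theorem IsStep.sub {w w' : M} (h : IsStep L n w) (h' : IsStep L n w') : IsStep L n (w - w') where
  inv s i j hi hj := by
    rw [map_sub, h.inv s i j hi hj, h'.inv s i j hi hj]
    split_ifs <;> simp
  wt := by rw [map_sub, h.wt, h'.wt]

theorem IsStep.smul {w : M} (h : IsStep L n w) (c : ℂ) : IsStep L n (c • w) where
  inv s i j hi hj := by
    rw [map_smul, h.inv s i j hi hj]
    split_ifs <;> simp
  wt := by rw [map_smul, h.wt]

section Reynolds

variable (h : IsGL q d L) (hq : q ≠ 0) (hq1 : ∀ k : ℕ, 0 < k → q ^ k ≠ 1) (hn : n < d)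
include h hq hq1 hn

/-- A vector killed by `E_0` is invariant under `U_q(𝔤𝔩_(n+1))`. -/
theorem IsStep.invBelow_succ {w : M} (hw : IsStep L n w) (hE : 0 < n → L .pos 0 n w = 0)
    (K : Submodule ℂ M) [FiniteDimensional ℂ K] (hK : ∀ s i j, ∀ x ∈ K, L s i j x ∈ K)
    (hwK : w ∈ K) : InvBelow L (n + 1) w := by
  have hEi : ∀ i < n, L .pos i n w = 0 := by
    intro i hi
    have h0 : 0 < n := by omega
    simpa using hw.E_pow_eq_zero h hq hn h0 hq1 (a := 0) (by simpa using hE h0) hi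
  have hF0 : ∀ h0 : 0 < n, L .neg n 0 w = 0 := by
    intro h0
    have hmem : ∀ m, (L .neg n 0 ^ m) w ∈ K := by
      intro m
      induction m with
      | zero => exact hwK
      | succ m ih => rw [pow_succ']; exact hK _ _ _ _ ih
    obtain ⟨m, hm⟩ := exists_eq_zero_of_eigen (L .pos 0 0) K _ hmem _
      (pow_injective_of_ne_one hq hq1) (hw.zero_F_pow h hq hn h0)
    -- the coefficient in `IsStep.E_F_pow` vanishes only for the first power
    induction m with
    | zero => rw [show w = 0 from hm, map_zero]
    | succ m ih =>
      rcases Nat.eq_zero_or_pos m with rfl | hm0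
      · simpa using hm
      · apply ih
        have h1 := hw.E_F_pow h hq hn h0 (hE h0) m
        rw [hm, map_zero] at h1
        exact (smul_eq_zero.1 h1.symm).resolve_left (mul_ne_zero
          (pow_sub_inv_pow_ne_zero hq hq1 (by omega)) (pow_sub_inv_pow_ne_zero hq hq1 hm0))
  have hFi : ∀ i < n, L .neg n i w = 0 := by
    intro i hi
    have h0 : 0 < n := by omega
    rcases Nat.eq_zero_or_pos i with rfl | hi0
    · exact hF0 h0
    · have h1 := h.pos_F h0 hi (i := 0) w
      simp only [hF0 h0, map_zero, if_pos hi0, hw.inv _ _ _ h0 hi, hw.inv _ _ _ h0 h0,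
        if_neg hi0.ne, smul_zero, zero_add, if_true] at h1
      refine (smul_eq_zero.1 h1.symm).resolve_left ?_
      simpa using pow_sub_inv_pow_ne_zero hq hq1 one_pos
  intro s i j hi hj
  rcases Nat.lt_succ_iff_lt_or_eq.1 hi with hi' | rfl <;>
    rcases Nat.lt_succ_iff_lt_or_eq.1 hj with hj' | rfl
  · exact hw.inv s i j hi' hj'
  · cases s with
    | pos => rw [hEi i hi', if_neg hi'.ne]
    | neg => rw [h.lower_apply hi', if_neg hi'.ne]
  · cases s with
    | pos => rw [h.upper_apply hj', if_neg hj'.ne']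
    | neg => rw [hFi j hj', if_neg hj'.ne']
  · cases s with
    | pos => rw [hw.wt, if_pos rfl]
    | neg => rw [hw.neg_nn h hq hn, if_pos rfl]

variable {N : Type*} [AddCommGroup N] [Module ℂ N] {L' : Sgn → ℕ → ℕ → Module.End ℂ N}
  (f : M →ₗ[ℂ] N) (hf : ∀ s i j x, f (L s i j x) = L' s i j (f x))
  (K : Submodule ℂ M) [FiniteDimensional ℂ K] (hK : ∀ s i j, ∀ x ∈ K, L s i j x ∈ K)
include hf hK

/-- Subtracting a multiple of `casimir q L n w`, whose image under `f` is zero, from `w` lowers the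
exponent of the power of `E_0` which kills `w`. -/
theorem exists_killed (a : ℕ) {w : M} (hw : IsStep L n w) (hwK : w ∈ K) (h0 : 0 < n)
    (hv : InvBelow L' (n + 1) (f w)) (ha : (L .pos 0 n ^ (a + 1)) w = 0) :
    ∃ w' ∈ K, IsStep L n w' ∧ f w' = f w ∧ L .pos 0 n w' = 0 := by
  induction a generalizing w with
  | zero => exact ⟨w, hwK, hw, rfl, by simpa using ha⟩
  | succ a ih =>
    set t : ℂ := -(q ^ (a + 1) - q⁻¹ ^ (a + 1)) *
      (q ^ (a + 1 + 1) - q * q⁻¹ ^ (a + 1 + 2 * n)) with ht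
    have ht0 : t ≠ 0 := by
      refine mul_ne_zero (neg_ne_zero.2 (pow_sub_inv_pow_ne_zero hq hq1 (by omega))) ?_
      intro h1
      refine hq1 (2 * (a + 1 + n)) (by omega) ?_
      have h2 : q ^ (a + 1) = q⁻¹ ^ (a + 1 + 2 * n) := by
        rw [pow_succ', ← mul_sub] at h1
        exact sub_eq_zero.1 ((mul_eq_zero.1 h1).resolve_left hq)
      rw [show 2 * (a + 1 + n) = (a + 1) + (a + 1 + 2 * n) by ring, pow_add, h2, ← mul_pow,
        inv_mul_cancel₀ hq, one_pow]
    have hC : IsGL.casimir q L n w ∈ K := by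
      rw [casimir_apply]
      exact Submodule.sum_mem _ fun i _ => K.smul_mem _ (hK _ _ _ _ (hK _ _ _ _ hwK))
    have hfC : f (IsGL.casimir q L n w) = 0 := by
      rw [casimir_apply, map_sum]
      refine Finset.sum_eq_zero fun i hi => ?_
      have hi := Finset.mem_range.1 hi
      rw [map_smul, hf, hf, hv _ _ _ (by omega) (by omega), if_neg hi.ne, map_zero, smul_zero]
    have hfw : f (w - t⁻¹ • IsGL.casimir q L n w) = f w := by
      rw [map_sub, map_smul, hfC, smul_zero, sub_zero]
    obtain ⟨w', h1, h2, h3, h4⟩ := ih (w := w - t⁻¹ • IsGL.casimir q L n w)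
      (hw.sub ((hw.casimir h hq).smul _)) (K.sub_mem hwK (K.smul_mem _ hC)) (by rwa [hfw]) (by
        rw [map_sub, map_smul, hw.pow_cas h hq hn h0 hq1 ha, smul_smul, ← ht,
          inv_mul_cancel₀ ht0, one_smul, sub_self])
    exact ⟨w', h1, h2, h3.trans hfw, h4⟩

/-- The step from `U_q(𝔤𝔩_n)` to `U_q(𝔤𝔩_(n+1))`. -/
theorem exists_invBelow_succ (hT : ∀ i, ∀ x ∈ K, ∃ S : Finset ℂ,
      Polynomial.aeval (L .pos i i) (∏ z ∈ S, (Polynomial.X - Polynomial.C z)) x = 0)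
    {w : M} (hwK : w ∈ K) (hw : InvBelow L n w) (hv : InvBelow L' (n + 1) (f w)) :
    ∃ w' ∈ K, InvBelow L (n + 1) w' ∧ f w' = f w := by
  obtain ⟨S, hS⟩ := hT n w hwK
  obtain ⟨p, hp1, hp⟩ := exists_aeval_fixed (L .pos n n) hS
  set x := Polynomial.aeval (L .pos n n) p w with hx
  have hfx : f x = f w := by
    rw [hx, map_aeval_apply f _ (L' .pos n n) (hf _ _ _), aeval_apply_of_fixed, hp1, one_smul]
    rw [hv _ _ _ (by omega) (by omega), if_pos rfl]
  have hxK : x ∈ K := by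
    have h1 := map_aeval_apply K.subtype ((L .pos n n).restrict (hK .pos n n)) (L .pos n n)
      (fun _ => rfl) p ⟨w, hwK⟩
    rw [hx]
    exact h1 ▸ Subtype.property _
  have hxs : IsStep L n x := by
    refine ⟨fun s i j hi hj => ?_, hp⟩
    rw [hx, map_aeval_apply (L s i j) _ _ (h.nn_comm s hi hj), hw s i j hi hj]
    split_ifs <;> simp
  obtain ⟨w', h1, h2, h3, h4⟩ : ∃ w' ∈ K, IsStep L n w' ∧ f w' = f x ∧
      (0 < n → L .pos 0 n w' = 0) := by
    rcases Nat.eq_zero_or_pos n with hn0 | h0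
    · exact ⟨x, hxK, hxs, rfl, fun h0 => absurd h0 (by omega)⟩
    · have hmem : ∀ m, (L .pos 0 n ^ m) x ∈ K := by
        intro m
        induction m with
        | zero => exact hxK
        | succ m ih => rw [pow_succ']; exact hK _ _ _ _ ih
      obtain ⟨m, hm⟩ := exists_eq_zero_of_eigen (L .pos n n) K _ hmem _
        (pow_injective_of_ne_one hq hq1) (hxs.nn_pow h hq hn h0)
      obtain ⟨w', h1, h2, h3, h4⟩ := exists_killed h hq hq1 hn f hf K hK m hxs hxK h0
        (by rwa [hfx]) (by rw [pow_succ', Module.End.mul_apply, hm, map_zero])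
      exact ⟨w', h1, h2, h3, fun _ => h4⟩
  exact ⟨w', h1, h2.invBelow_succ h hq hq1 hn h4 K hK h1, h3.trans hfx⟩

omit hn in
/-- Complete reducibility, in the form in which it is needed: if the image of `w` is invariant under
`U_q(𝔤𝔩_k)`, then it is the image of an invariant vector. -/
theorem exists_invBelow (hT : ∀ i, ∀ x ∈ K, ∃ S : Finset ℂ,
      Polynomial.aeval (L .pos i i) (∏ z ∈ S, (Polynomial.X - Polynomial.C z)) x = 0)
    {w : M} (hwK : w ∈ K) (k : ℕ) (hk : k ≤ d) (hv : InvBelow L' k (f w)) :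
    ∃ w' ∈ K, InvBelow L k w' ∧ f w' = f w := by
  induction k with
  | zero => exact ⟨w, hwK, fun s i j hi => absurd hi (by omega), rfl⟩
  | succ k ih =>
    obtain ⟨w', h1, h2, h3⟩ := ih (by omega) (InvBelow.mono (by omega) hv)
    obtain ⟨w'', h4, h5, h6⟩ := exists_invBelow_succ h hq hq1 (by omega) f hf K hK hT h1 h2
      (by rwa [h3])
    exact ⟨w'', h4, h5, h6.trans h3⟩

end Reynolds
end IsGL

/-! ### Lifting invariants over `U` -/

section Entries

variable {V E : Type u} [Fintype V] [DecidableEq V] {Q : DimQuiver V E} {q : ℂ}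
  {S : Type*} [Ring S] [Algebra ℂ S]

/-- Multiplication by the `R`-matrix, in entries. -/
theorem mul_scal_Rmat {m : Type*} (M : Matrix m (Q.Idx × Q.Idx) S) (x : m) (k l : Q.Idx) :
    (M * scal S (Rmat Q q)) x (k, l) = (if k = l then q else 1) • M x (k, l) +
      (if below Q k l then q - q⁻¹ else 0) • M x (l, k) := by
  rw [Matrix.mul_apply]
  simp only [scal, RingHom.mapMatrix_apply, Matrix.map_apply, ← Algebra.commutes,
    ← Algebra.smul_def]
  simp only [Rmat, Matrix.of_apply, add_smul, Finset.sum_add_distrib, ite_and, ite_smul, zero_smul]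
  simp

theorem scal_Rmat_mul {m : Type*} (M : Matrix (Q.Idx × Q.Idx) m S) (x : m) (k l : Q.Idx) :
    (scal S (Rmat Q q) * M) (k, l) x = (if k = l then q else 1) • M (k, l) x +
      (if below Q l k then q - q⁻¹ else 0) • M (l, k) x := by
  have h1 : ∀ r : Q.Idx × Q.Idx, ((k, l) = r.swap) ↔ r = (l, k) := by
    intro r
    constructor
    · intro h
      rw [← Prod.swap_swap r, ← h]
      rfl
    · rintro rfl
      rfl
  rw [Matrix.mul_apply]
  simp only [scal, RingHom.mapMatrix_apply, Matrix.map_apply, ← Algebra.smul_def]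
  simp only [Rmat, Matrix.of_apply, add_smul, Finset.sum_add_distrib, ite_and, ite_smul, zero_smul,
    h1]
  simp [eq_comm]

theorem slot₁_mul_slot₂_apply {n : Type*} [Fintype n] [DecidableEq n] (X Y : Matrix n n S)
    (a b c e : n) : (slot₁ X * slot₂ Y) (a, b) (c, e) = X a c * Y b e := by
  simp [Matrix.mul_apply, Fintype.sum_prod_type, slot₁_apply, slot₂_apply]

theorem slot₂_mul_slot₁_apply {n : Type*} [Fintype n] [DecidableEq n] (X Y : Matrix n n S)
    (a b c e : n) : (slot₂ Y * slot₁ X) (a, b) (c, e) = Y b e * X a c := by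
  simp [Matrix.mul_apply, Fintype.sum_prod_type, slot₁_apply, slot₂_apply]

end Entries

section URelations

variable {V E : Type u} [Fintype V] [DecidableEq V] (Q : DimQuiver V E) (q : ℂ)

theorem U.rel {x y : FreeAlgebra ℂ (UGen Q)} (h : URel Q q x y) : U.mk Q q x = U.mk Q q y :=
  RingQuot.mkAlgHom_rel ℂ h

theorem Lmat_rtt (s : Sgn) (a b c e : Q.Idx) :
    (if c = e then q else 1) • (Lmat Q q s a c * Lmat Q q s b e) +
      (if below Q c e then q - q⁻¹ else 0) • (Lmat Q q s a e * Lmat Q q s b c) =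
    (if a = b then q else 1) • (Lmat Q q s b e * Lmat Q q s a c) +
      (if below Q b a then q - q⁻¹ else 0) • (Lmat Q q s a e * Lmat Q q s b c) := by
  have h := U.rel Q q (URel.rtt s (a, b) (c, e))
  rw [mul_assoc (scal _ _), mul_scal_Rmat, scal_Rmat_mul] at h
  simp only [slot₁_mul_slot₂_apply, slot₂_mul_slot₁_apply, map_add, map_smul, map_mul] at h
  exact h

theorem Lmat_rtt' (a b c e : Q.Idx) :
    (if c = e then q else 1) • (Lmat Q q .neg a c * Lmat Q q .pos b e) +
      (if below Q c e then q - q⁻¹ else 0) • (Lmat Q q .neg a e * Lmat Q q .pos b c) =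
    (if a = b then q else 1) • (Lmat Q q .pos b e * Lmat Q q .neg a c) +
      (if below Q b a then q - q⁻¹ else 0) • (Lmat Q q .pos a e * Lmat Q q .neg b c) := by
  have h := U.rel Q q (URel.rtt' (a, b) (c, e))
  rw [mul_assoc (scal _ _), mul_scal_Rmat, scal_Rmat_mul] at h
  simp only [slot₁_mul_slot₂_apply, slot₂_mul_slot₁_apply, map_add, map_smul, map_mul] at h
  exact h

theorem Lmat_block (s : Sgn) {i j : Q.Idx} (h : i.1 ≠ j.1) : Lmat Q q s i j = 0 := by
  have h1 : i ≠ j := fun h' => h (by rw [h'])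
  cases s with
  | pos => exact (U.rel Q q (URel.upper i j h1 fun h' => h h'.1)).trans (map_zero _)
  | neg => exact (U.rel Q q (URel.lower i j h1 fun h' => h h'.1.symm)).trans (map_zero _)

theorem Lmat_comm (s t : Sgn) {i j k l : Q.Idx} (hij : i.1 = j.1) (hkl : k.1 = l.1)
    (hik : i.1 ≠ k.1) : Lmat Q q s i j * Lmat Q q t k l = Lmat Q q t k l * Lmat Q q s i j := by
  have key : ∀ {i j k l : Q.Idx}, i.1 = j.1 → k.1 = l.1 → i.1 ≠ k.1 →
      i ≠ k ∧ j ≠ l ∧ ¬ below Q j l ∧ ¬ below Q k i := by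
    intro i j k l hij hkl hik
    refine ⟨fun h => hik (by rw [h]), fun h => hik (by rw [hij, hkl, h]),
      fun h => hik (hij.trans (h.1.trans hkl.symm)), fun h => hik h.1.symm⟩
  obtain ⟨h1, h2, h3, h4⟩ := key hij hkl hik
  obtain ⟨h1', h2', h3', h4'⟩ := key hkl hij hik.symm
  have e1 := fun s => Lmat_rtt Q q s i k j l
  have e2 := Lmat_rtt' Q q i k j l
  have e3 := Lmat_rtt' Q q k i l j
  simp only [h1, h2, h3, h4, if_false, one_smul, zero_smul, add_zero] at e1 e2
  simp only [h1', h2', h3', h4', if_false, one_smul, zero_smul, add_zero] at e3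
  cases s <;> cases t
  · exact e1 _
  · exact e3.symm
  · exact e2
  · exact e1 _

/-- The generators of the factor `U_q(𝔤𝔩_(d_v))`, extended by zero to all natural indices. -/
noncomputable def blockL (v : V) (s : Sgn) (i j : ℕ) : U Q q :=
  if h : i < Q.dim v ∧ j < Q.dim v then Lmat Q q s ⟨v, i, h.1⟩ ⟨v, j, h.2⟩ else 0

theorem isGL_blockL (v : V) : IsGL q (Q.dim v) (blockL Q q v) where
  rtt s a b c e := by
    by_cases h : (a < Q.dim v ∧ b < Q.dim v) ∧ c < Q.dim v ∧ e < Q.dim v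
    · obtain ⟨⟨ha, hb⟩, hc, he⟩ := h
      simpa [blockL, ha, hb, hc, he, below] using
        Lmat_rtt Q q s ⟨v, a, ha⟩ ⟨v, b, hb⟩ ⟨v, c, hc⟩ ⟨v, e, he⟩
    · have h0 : ∀ x y z w : ℕ, ¬ ((x < Q.dim v ∧ y < Q.dim v) ∧ z < Q.dim v ∧ w < Q.dim v) →
          blockL Q q v s x y * blockL Q q v s z w = 0 := by
        intro x y z w h
        by_cases h1 : x < Q.dim v ∧ y < Q.dim v
        · have h2 : ¬ (z < Q.dim v ∧ w < Q.dim v) := fun h2 => h ⟨h1, h2⟩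
          rw [blockL, blockL, dif_neg h2, mul_zero]
        · rw [blockL, dif_neg h1, zero_mul]
      rw [h0 a c b e (by tauto), h0 a e b c (by tauto), h0 b e a c (by tauto)]
      simp
  rtt' a b c e := by
    by_cases h : (a < Q.dim v ∧ b < Q.dim v) ∧ c < Q.dim v ∧ e < Q.dim v
    · obtain ⟨⟨ha, hb⟩, hc, he⟩ := h
      simpa [blockL, ha, hb, hc, he, below] using
        Lmat_rtt' Q q ⟨v, a, ha⟩ ⟨v, b, hb⟩ ⟨v, c, hc⟩ ⟨v, e, he⟩
    · have h0 : ∀ (s t : Sgn) (x y z w : ℕ),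
          ¬ ((x < Q.dim v ∧ y < Q.dim v) ∧ z < Q.dim v ∧ w < Q.dim v) →
          blockL Q q v s x y * blockL Q q v t z w = 0 := by
        intro s t x y z w h
        by_cases h1 : x < Q.dim v ∧ y < Q.dim v
        · have h2 : ¬ (z < Q.dim v ∧ w < Q.dim v) := fun h2 => h ⟨h1, h2⟩
          rw [blockL, blockL, dif_neg h2, mul_zero]
        · rw [blockL, dif_neg h1, zero_mul]
      rw [h0 _ _ a c b e (by tauto), h0 _ _ a e b c (by tauto), h0 _ _ b e a c (by tauto),
        h0 _ _ a e b c (by tauto)]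
      simp
  upper i j h := by
    unfold blockL
    split_ifs with h1
    · refine (U.rel Q q (URel.upper _ _ (fun h2 => ?_) fun h2 => ?_)).trans (map_zero _)
      · simp at h2; omega
      · have := h2.2; dsimp only at this; omega
    · rfl
  lower i j h := by
    unfold blockL
    split_ifs with h1
    · refine (U.rel Q q (URel.lower _ _ (fun h2 => ?_) fun h2 => ?_)).trans (map_zero _)
      · simp at h2; omega
      · have := h2.2; dsimp only at this; omega
    · rfl
  diag i h := by
    simp only [blockL, h, and_self, dif_pos]
    exact ((map_mul _ _ _).symm.trans (U.rel Q q (URel.diag _))).trans (map_one _)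
  diag' i h := by
    simp only [blockL, h, and_self, dif_pos]
    exact ((map_mul _ _ _).symm.trans (U.rel Q q (URel.diag' _))).trans (map_one _)

end URelations

theorem IsGL.map {A A' : Type*} [Ring A] [Algebra ℂ A] [Ring A'] [Algebra ℂ A'] {q : ℂ} {d : ℕ}
    {L : Sgn → ℕ → ℕ → A} (h : IsGL q d L) (f : A →ₐ[ℂ] A') :
    IsGL q d fun s i j => f (L s i j) where
  rtt s a b c e := by simpa only [map_add, map_smul, map_mul] using congrArg f (h.rtt s a b c e)
  rtt' a b c e := by simpa only [map_add, map_smul, map_mul] using congrArg f (h.rtt' a b c e)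
  upper i j hij := by rw [h.upper i j hij, map_zero]
  lower i j hij := by rw [h.lower i j hij, map_zero]
  diag i hi := by rw [← map_mul, h.diag i hi, map_one]
  diag' i hi := by rw [← map_mul, h.diag' i hi, map_one]

section Lifting

open CategoryTheory CategoryTheory.Limits
open scoped ModuleCat

variable {V E : Type u} [Fintype V] [DecidableEq V] [LinearOrder E] {Q : DimQuiver V E} {q : ℂ}
variable [NeZero q] [Fintype E] {ξ : V → ℂˣ}

/-- The action of `U` on a module over the smash product. -/
noncomputable def opU (M : ModuleCat.{u} (B Q q)) : U Q q →ₐ[ℂ] Module.End ℂ M :=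
  (Algebra.lsmul ℂ ℂ M).comp (ιU Q q)

theorem opU_apply (M : ModuleCat.{u} (B Q q)) (x : U Q q) (m : M) :
    opU M x m = ιU Q q x • m := rfl

theorem mem_invariants_iff {M : ModuleCat.{u} (B Q q)} (m : M) : m ∈ invariants M ↔
    ∀ v, InvBelow (fun s i j => opU M (blockL Q q v s i j)) (Q.dim v) m := by
  constructor
  · intro h v s i j hi hj
    have := h s ⟨v, i, hi⟩ ⟨v, j, hj⟩
    simpa [opU_apply, blockL, hi, hj] using this
  · rintro h s ⟨v, i⟩ ⟨w, j⟩
    by_cases hvw : v = w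
    · subst hvw
      have := h v s i j i.2 j.2
      simpa [opU_apply, blockL, Fin.ext_iff] using this
    · rw [Lmat_block Q q s hvw, map_zero, zero_smul, if_neg fun h' => hvw (congrArg Sigma.fst h')]

/-- The vectors of `W` which are invariant under the factors of `U` at the vertices in `Z`. -/
def invSub {M : ModuleCat.{u} (B Q q)} (W : Submodule ℂ M) (Z : Finset V) : Submodule ℂ M where
  carrier := {x | x ∈ W ∧
    ∀ v ∈ Z, InvBelow (fun s i j => opU M (blockL Q q v s i j)) (Q.dim v) x}
  zero_mem' := ⟨zero_mem _, fun v _ s i j _ _ => by simp⟩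
  add_mem' := by
    rintro a b ⟨ha, ha'⟩ ⟨hb, hb'⟩
    refine ⟨add_mem ha hb, fun v hv s i j hi hj => ?_⟩
    rw [map_add, ha' v hv s i j hi hj, hb' v hv s i j hi hj]
    split <;> simp
  smul_mem' := by
    rintro c a ⟨ha, ha'⟩
    refine ⟨W.smul_mem c ha, fun v hv s i j hi hj => ?_⟩
    rw [map_smul, ha' v hv s i j hi hj]
    split <;> simp

/-- The functor of invariants is exact: an invariant vector in the image of a homomorphism is the
image of an invariant vector. -/
theorem exists_mem_invariants (hq1 : ∀ n : ℕ, 0 < n → q ^ n ≠ 1) {M N : ModuleCat.{u} (B Q q)}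
    (hM : isEquivariant Q q ξ M) (f : M →ₗ[B Q q] N) (m : M) (hm : f m ∈ invariants N) :
    ∃ m' ∈ invariants M, f m' = f m := by
  classical
  obtain ⟨W, hmW, hfin, hW⟩ := (hM m).locFinite
  have key : ∀ Z : Finset V, ∃ m' ∈ invSub W Z, f m' = f m := by
    intro Z
    -- The factors of `U` at distinct vertices commute, so that invariance under `Z` is kept.
    induction Z using Finset.induction_on with
    | empty => exact ⟨m, ⟨hmW, fun v hv => absurd hv (Finset.notMem_empty v)⟩, rfl⟩
    | insert v Z hv ih =>
      obtain ⟨m', hm', hfm'⟩ := ih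
      have : FiniteDimensional ℂ (invSub W Z) :=
        Submodule.finiteDimensional_of_le (fun x hx => hx.1 : invSub W Z ≤ W)
      have hK : ∀ s i j, ∀ x ∈ invSub W Z, opU M (blockL Q q v s i j) x ∈ invSub W Z := by
        rintro s i j x ⟨hx, hx'⟩
        refine ⟨hW _ x hx, fun w hw t k l hk hl => ?_⟩
        have hc : blockL Q q w t k l * blockL Q q v s i j =
            blockL Q q v s i j * blockL Q q w t k l := by
          by_cases h1 : i < Q.dim v ∧ j < Q.dim v
          · rw [blockL, dif_pos ⟨hk, hl⟩, blockL, dif_pos h1]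
            refine Lmat_comm Q q t s rfl rfl ?_
            rintro rfl
            exact hv hw
          · rw [blockL, blockL, dif_neg h1, mul_zero, zero_mul]
        rw [← Module.End.mul_apply, ← map_mul, hc, map_mul, Module.End.mul_apply,
          hx' w hw t k l hk hl]
        split <;> simp
      obtain ⟨m'', h1, h2, h3⟩ := ((isGL_blockL Q q v).map (opU M)).exists_invBelow
        (L' := fun s i j => opU N (blockL Q q v s i j)) (NeZero.ne q) hq1
        (f.restrictScalars ℂ) (fun s i j x => f.map_smul _ _) (invSub W Z) hK
        (by
          intro i x _
          by_cases hi : i < Q.dim v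
          · obtain ⟨S, _, hS⟩ := (typeOne_iff x).1 (hM x).typeOne ⟨v, i, hi⟩
            refine ⟨S, ?_⟩
            simp only [blockL, hi, and_self, dif_pos]
            exact hS
          · refine ⟨{0}, ?_⟩
            simp [blockL, hi])
        hm' (Q.dim v) le_rfl (by
          have := (mem_invariants_iff _).1 hm v
          rw [← hfm'] at this
          exact this)
      refine ⟨m'', ⟨h1.1, fun w hw => ?_⟩, h3.trans hfm'⟩
      rcases Finset.mem_insert.1 hw with rfl | hw
      · exact h2
      · exact h1.2 w hw
  obtain ⟨m', h1, h2⟩ := key Finset.univ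
  exact ⟨m', (mem_invariants_iff _).2 fun v => h1.2 v (Finset.mem_univ v), h2⟩

end Lifting

/-! ### The action of the generators of `U` on `𝒟_q` -/

section ActionOfU

variable {V E : Type u} [Fintype V] [DecidableEq V] [LinearOrder E] (Q : DimQuiver V E) (q : ℂ)

variable {Q q} in
theorem D.induction {P : D Q q → Prop} (hs : ∀ c : ℂ, P (algebraMap ℂ _ c))
    (hg : ∀ e y k l, P (Dmat Q q e y k l)) (hm : ∀ x y, P x → P y → P (x * y))
    (ha : ∀ x y, P x → P y → P (x + y)) (x : D Q q) : P x := by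
  obtain ⟨x, rfl⟩ : ∃ y, D.mk Q q y = x := RingQuot.mkAlgHom_surjective ℂ _ x
  induction x using FreeAlgebra.induction with
  | grade0 r => rw [AlgHom.commutes]; exact hs r
  | grade1 x => exact hg x.1 x.2.1 x.2.2.1 x.2.2.2
  | mul a b h1 h2 => rw [map_mul]; exact hm _ _ h1 h2
  | add a b h1 h2 => rw [map_add]; exact ha _ _ h1 h2

variable {Q q} in
theorem U.induction {P : U Q q → Prop} (hs : ∀ c : ℂ, P (algebraMap ℂ _ c))
    (hg : ∀ s i j, P (Lmat Q q s i j)) (hm : ∀ x y, P x → P y → P (x * y))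
    (ha : ∀ x y, P x → P y → P (x + y)) (x : U Q q) : P x := by
  obtain ⟨x, rfl⟩ : ∃ y, U.mk Q q y = x := RingQuot.mkAlgHom_surjective ℂ _ x
  induction x using FreeAlgebra.induction with
  | grade0 r => rw [AlgHom.commutes]; exact hs r
  | grade1 x => exact hg x.1 x.2.1 x.2.2
  | mul a b h1 h2 => rw [map_mul]; exact hm _ _ h1 h2
  | add a b h1 h2 => rw [map_add]; exact ha _ _ h1 h2

theorem mul_scal_tw_Rmat {S : Type*} [Ring S] [Algebra ℂ S] {m : Type*}
    (M : Matrix m (Q.Idx × Q.Idx) S) (x : m) (k l : Q.Idx) :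
    (M * scal S (tw (Rmat Q q))) x (k, l) = (if k = l then q else 1) • M x (k, l) +
      (if below Q l k then q - q⁻¹ else 0) • M x (l, k) := by
  have h := mul_scal_Rmat (q := q) (Matrix.of fun (x : m) (p : Q.Idx × Q.Idx) => M x p.swap) x l k
  have h2 : (M * scal S (tw (Rmat Q q))) x (k, l) =
      ((Matrix.of fun (x : m) (p : _ × _) => M x p.swap) * scal S (Rmat Q q)) x (l, k) := by
    rw [Matrix.mul_apply, Matrix.mul_apply, ← (Equiv.prodComm _ _).sum_comp]
    simp [tw, Matrix.reindexRingEquiv, scal]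
  rw [h2, h]
  simp [eq_comm]

theorem scal_tw_Rmat_mul {S : Type*} [Ring S] [Algebra ℂ S] {m : Type*}
    (M : Matrix (Q.Idx × Q.Idx) m S) (x : m) (k l : Q.Idx) :
    (scal S (tw (Rmat Q q)) * M) (k, l) x = (if k = l then q else 1) • M (k, l) x +
      (if below Q k l then q - q⁻¹ else 0) • M (l, k) x := by
  have h := scal_Rmat_mul (q := q) (Matrix.of fun (p : Q.Idx × Q.Idx) (x : m) => M p.swap x) x l k
  have h2 : (scal S (tw (Rmat Q q)) * M) (k, l) x =
      (scal S (Rmat Q q) * Matrix.of fun (p : _ × _) (x : m) => M p.swap x) (l, k) x := by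
    rw [Matrix.mul_apply, Matrix.mul_apply, ← (Equiv.prodComm _ _).sum_comp]
    simp [tw, Matrix.reindexRingEquiv, scal]
  rw [h2, h]
  simp [eq_comm]

variable [NeZero q]

theorem act_pos_Dmat (e : E) (y : Sym) (k l i j : Q.Idx) :
    act Q q .pos (Dmat Q q e y k l) i j =
      (if k = i then q⁻¹ else 1) • ((if l = j then q else 1) • (if i = j then Dmat Q q e y k l else 0)
        + (if below Q l j then q - q⁻¹ else 0) • (if i = l then Dmat Q q e y k j else 0)) +
      (if below Q i k then q⁻¹ - q else 0) •
        ((if l = j then q else 1) • (if k = j then Dmat Q q e y i l else 0)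
        + (if below Q l j then q - q⁻¹ else 0) • (if k = l then Dmat Q q e y i j else 0)) := by
  rw [act_Dmat, mul_assoc]
  simp only [Xinv, Xmat]
  rw [scal_Rmat_mul, mul_scal_Rmat, mul_scal_Rmat]
  simp only [slot₁_apply, inv_inv]

theorem act_neg_Dmat (e : E) (y : Sym) (k l i j : Q.Idx) :
    act Q q .neg (Dmat Q q e y k l) i j =
      (if k = i then q else 1) • ((if l = j then q⁻¹ else 1) • (if i = j then Dmat Q q e y k l else 0)
        + (if below Q j l then q⁻¹ - q else 0) • (if i = l then Dmat Q q e y k j else 0)) +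
      (if below Q k i then q - q⁻¹ else 0) •
        ((if l = j then q⁻¹ else 1) • (if k = j then Dmat Q q e y i l else 0)
        + (if below Q j l then q⁻¹ - q else 0) • (if k = l then Dmat Q q e y i j else 0)) := by
  rw [act_Dmat, mul_assoc]
  simp only [Xinv, Xmat]
  rw [scal_tw_Rmat_mul, mul_scal_tw_Rmat, mul_scal_tw_Rmat]
  simp only [slot₁_apply, inv_inv]

/-- `i` may be a row and `j` a column index of a nonzero entry of `L^±`. -/
def triLE (Q : DimQuiver V E) : Sgn → Q.Idx → Q.Idx → Prop
  | .pos, i, j => i = j ∨ below Q i j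
  | .neg, i, j => i = j ∨ below Q j i

omit [LinearOrder E] in
theorem triLE.trans {s : Sgn} {i j k : Q.Idx} (h : triLE Q s i j) (h' : triLE Q s j k) :
    triLE Q s i k := by
  cases s with
  | pos =>
    rcases h with rfl | h
    · exact h'
    · rcases h' with rfl | h'
      · exact Or.inr h
      · exact Or.inr (h.trans h')
  | neg =>
    rcases h with rfl | h
    · exact h'
    · rcases h' with rfl | h'
      · exact Or.inr h
      · exact Or.inr (h'.trans h)

omit [LinearOrder E] in
theorem triLE.antisymm {s : Sgn} {i j : Q.Idx} (h : triLE Q s i j) (h' : triLE Q s j i) :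
    i = j := by
  have key : ∀ {i j : Q.Idx}, below Q i j → ¬ below Q j i := fun h h' => (h.trans h').irr
  cases s with
  | pos =>
    rcases h with rfl | h
    · rfl
    · rcases h' with rfl | h'
      · rfl
      · exact (key h h').elim
  | neg =>
    rcases h with rfl | h
    · rfl
    · rcases h' with rfl | h'
      · rfl
      · exact (key h h').elim

omit [LinearOrder E] in
theorem triLE.block {s : Sgn} {i j : Q.Idx} (h : triLE Q s i j) : i.1 = j.1 := by
  cases s with
  | pos =>
    rcases h with rfl | h
    · rfl
    · exact h.1
  | neg =>
    rcases h with rfl | h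
    · rfl
    · exact h.1.symm

/-- The matrices `L^± ▷ y` are triangular. -/
theorem act_tri (s : Sgn) (y : D Q q) : ∀ {i j : Q.Idx}, ¬ triLE Q s i j → act Q q s y i j = 0 := by
  induction y using D.induction with
  | hs c =>
    intro i j h
    rw [AlgHom.commutes, Matrix.algebraMap_matrix_apply, if_neg]
    rintro rfl
    cases s <;> exact h (Or.inl rfl)
  | ha x y hx hy => intro i j h; rw [map_add, Matrix.add_apply, hx h, hy h, add_zero]
  | hm x y hx hy =>
    intro i j h
    rw [map_mul, Matrix.mul_apply]
    refine Finset.sum_eq_zero fun k _ => ?_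
    by_cases h1 : triLE Q s i k
    · rw [hy fun h2 => h (h1.trans Q h2), mul_zero]
    · rw [hx h1, zero_mul]
  | hg e y k l =>
    intro i j h
    cases s with
    | pos =>
      rw [act_pos_Dmat]
      have h1 : i ≠ j := fun h' => h (Or.inl h')
      have h2 : ¬ below Q i j := fun h' => h (Or.inr h')
      have h3 : below Q i l → ¬ below Q l j := fun h' h'' => h2 (h'.trans h'')
      split_ifs <;> simp_all
    | neg =>
      rw [act_neg_Dmat]
      have h1 : i ≠ j := fun h' => h (Or.inl h')
      have h2 : ¬ below Q j i := fun h' => h (Or.inr h')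
      have h3 : below Q l i → ¬ below Q j l := fun h' h'' => h2 (h''.trans h')
      split_ifs <;> simp_all

/-- The diagonal entries of `L^± ▷ y` are multiplicative in `y`, since the matrices are
triangular. -/
theorem act_diag_mul (s : Sgn) (x y : D Q q) (i : Q.Idx) :
    act Q q s (x * y) i i = act Q q s x i i * act Q q s y i i := by
  rw [map_mul, Matrix.mul_apply]
  refine Finset.sum_eq_single i (fun k _ hk => ?_) (by simp)
  by_cases h1 : triLE Q s i k
  · rw [act_tri Q q s y fun h2 => hk (h1.antisymm Q h2).symm, mul_zero]
  · rw [act_tri Q q s x h1, zero_mul]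

/-- The generators of `𝒟_q` are weight vectors. -/
theorem act_diag_Dmat (s : Sgn) (e : E) (y : Sym) (k l i : Q.Idx) :
    act Q q s (Dmat Q q e y k l) i i = (match s with
      | .pos => (if k = i then q⁻¹ else 1) * (if l = i then q else 1)
      | .neg => (if k = i then q else 1) * (if l = i then q⁻¹ else 1)) • Dmat Q q e y k l := by
  have h1 : ∀ {i : Q.Idx}, ¬ below Q i i := fun h => h.irr
  have h2 : ∀ {i j : Q.Idx}, below Q i j → ¬ below Q j i := fun h h' => (h.trans h').irr
  cases s with
  | pos =>
    rw [act_pos_Dmat, mul_smul]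
    by_cases h3 : i = l
    · subst h3
      by_cases h4 : k = i
      · subst h4; simp [h1]
      · simp [h1, h4]
    · by_cases h4 : k = i
      · subst h4; simp [h1, h3, Ne.symm h3]
      · by_cases h5 : k = l
        · subst h5
          by_cases h6 : below Q i k
          · simp [h1, h3, Ne.symm h3, h2 h6]
          · simp [h1, h3, Ne.symm h3, h6]
        · simp [h1, h3, Ne.symm h3, h4, h5]
  | neg =>
    rw [act_neg_Dmat, mul_smul]
    by_cases h3 : i = l
    · subst h3
      by_cases h4 : k = i
      · subst h4; simp [h1]
      · simp [h1, h4]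
    · by_cases h4 : k = i
      · subst h4; simp [h1, h3, Ne.symm h3]
      · by_cases h5 : k = l
        · subst h5
          by_cases h6 : below Q k i
          · simp [h1, h3, Ne.symm h3, h2 h6]
          · simp [h1, h3, Ne.symm h3, h6]
        · simp [h1, h3, Ne.symm h3, h4, h5]

theorem act_diag_inv (s t : Sgn) (hst : s ≠ t) (y : D Q q) (i : Q.Idx) :
    act Q q s (act Q q t y i i) i i = y := by
  induction y using D.induction with
  | hs c => simp [Matrix.algebraMap_matrix_apply, AlgHom.commutes]
  | ha x y hx hy => rw [map_add, Matrix.add_apply, map_add, Matrix.add_apply, hx, hy]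
  | hm x y hx hy => rw [act_diag_mul, act_diag_mul, hx, hy]
  | hg e y k l =>
    have hq := NeZero.ne q
    rw [act_diag_Dmat, map_smul, Matrix.smul_apply, act_diag_Dmat, smul_smul]
    cases s <;> cases t <;> first | exact (hst rfl).elim | (dsimp only; split_ifs <;> simp [hq])

end ActionOfU

/-! ### The relations of `U` on `𝒟_q` -/

section ActU

variable {V E : Type u} [Fintype V] [DecidableEq V] [LinearOrder E] (Q : DimQuiver V E) (q : ℂ)
variable [NeZero q]

/-- `act`, applied to the entries of a matrix over `𝒟_q`. -/
noncomputable def actD (s : Sgn) (n : Type*) [Fintype n] [DecidableEq n] :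
    Matrix n n (D Q q) →+* Matrix (n × Q.Idx) (n × Q.Idx) (D Q q) :=
  (Matrix.compRingEquiv n Q.Idx (D Q q)).toRingHom.comp (act Q q s).toRingHom.mapMatrix

theorem actD_apply (s : Sgn) {n : Type*} [Fintype n] [DecidableEq n]
    (Y : Matrix n n (D Q q)) (i j : n) (a b : Q.Idx) :
    actD Q q s n Y (i, a) (j, b) = act Q q s (Y i j) a b := rfl

theorem actD_Dmat (s : Sgn) (e : E) (y : Sym) :
    actD Q q s _ (Dmat Q q e y) = conjX Q q s (D Q q) (Dmat Q q e y) := by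
  ext ⟨i, a⟩ ⟨j, b⟩
  rw [actD_apply, act_Dmat, conjX_apply]

theorem actD_scal₁ (s : Sgn) (C : Matrix Q.Idx Q.Idx ℂ) :
    actD Q q s _ (scal _ C) = slot₁ (scal _ C) := by
  ext ⟨i, a⟩ ⟨j, b⟩
  simp only [actD_apply, scal, slot₁_apply, RingHom.mapMatrix_apply, Matrix.map_apply,
    AlgHom.commutes, Matrix.algebraMap_matrix_apply]

theorem actD_scal₂ (s : Sgn) (C : Matrix (Q.Idx × Q.Idx) (Q.Idx × Q.Idx) ℂ) :
    actD Q q s _ (scal _ C) = slot₁₂ (scal _ C) := by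
  ext ⟨⟨i, k⟩, a⟩ ⟨⟨j, l⟩, b⟩
  simp only [actD_apply, scal, slot₁₂_apply, RingHom.mapMatrix_apply, Matrix.map_apply,
    AlgHom.commutes, Matrix.algebraMap_matrix_apply]

theorem actD_slot₁ (s : Sgn) (Y : Matrix Q.Idx Q.Idx (D Q q)) :
    actD Q q s _ (slot₁ Y) = slot₁₃ (actD Q q s _ Y) := by
  ext ⟨⟨i, k⟩, a⟩ ⟨⟨j, l⟩, b⟩
  simp only [actD_apply, slot₁_apply, slot₁₃_apply]
  split <;> simp

/-- Acting by `l^s` and then by `l^t` on the matrix of generators is conjugation by the product of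
`X^t₁₃` and `X^s₁₂`. -/
theorem actD_actD_Dmat (s t : Sgn) (e : E) (y : Sym) :
    actD Q q t _ (actD Q q s _ (Dmat Q q e y)) =
      slot₁₂ (scal _ (Xinv Q q s)) * slot₁₃ (scal _ (Xinv Q q t)) * slot₁₂ (slot₁ (Dmat Q q e y)) *
        (slot₁₃ (scal _ (Xmat Q q t)) * slot₁₂ (scal _ (Xmat Q q s))) := by
  rw [actD_Dmat, conjX_apply, map_mul, map_mul, actD_slot₁, actD_Dmat, actD_scal₂, actD_scal₂,
    conjX_apply, map_mul, map_mul, slot₁₃_slot₁]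
  simp only [mul_assoc]

/-- Interchange of the last two of three tensor factors. -/
def swap₂₃ {n S : Type*} [Fintype n] [DecidableEq n] [Ring S] :
    Matrix ((n × n) × n) ((n × n) × n) S →+* Matrix ((n × n) × n) ((n × n) × n) S :=
  (Matrix.reindexRingEquiv S
    ⟨fun x => ((x.1.1, x.2), x.1.2), fun x => ((x.1.1, x.2), x.1.2), fun _ => rfl,
      fun _ => rfl⟩).toRingHom

theorem swap₂₃_apply {n S : Type*} [Fintype n] [DecidableEq n] [Ring S]
    (X : Matrix ((n × n) × n) ((n × n) × n) S) (a b c a' b' c' : n) :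
    swap₂₃ X ((a, b), c) ((a', b'), c') = X ((a, c), b) ((a', c'), b') := by
  simp [swap₂₃, Matrix.reindexRingEquiv]

theorem swap₂₃_slot₁₂ {n S : Type*} [Fintype n] [DecidableEq n] [Ring S]
    (X : Matrix (n × n) (n × n) S) : swap₂₃ (slot₁₂ X) = slot₁₃ X := by
  ext ⟨⟨a, b⟩, c⟩ ⟨⟨a', b'⟩, c'⟩
  simp [swap₂₃_apply, slot₁₂_apply, slot₁₃_apply]

theorem swap₂₃_slot₁₃ {n S : Type*} [Fintype n] [DecidableEq n] [Ring S]
    (X : Matrix (n × n) (n × n) S) : swap₂₃ (slot₁₃ X) = slot₁₂ X := by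
  ext ⟨⟨a, b⟩, c⟩ ⟨⟨a', b'⟩, c'⟩
  simp [swap₂₃_apply, slot₁₂_apply, slot₁₃_apply]

/-- The Yang–Baxter equation for the matrices through which `U` acts, for the pairs of signs for
which `L^s₁ L^t₂ R = R L^t₂ L^s₁` is among the relations of `U`. -/
theorem Xmat_braid (s t : Sgn) (hst : s = t ∨ s = .neg ∧ t = .pos) :
    slot₁₂ (Xmat Q q s) * slot₁₃ (Xmat Q q t) * slot₂₃ (Rmat Q q) =
      slot₂₃ (Rmat Q q) * (slot₁₃ (Xmat Q q t) * slot₁₂ (Xmat Q q s)) := by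
  have hq := NeZero.ne q
  have yb := yang_baxter (Q := Q) hq (1 : Matrix ((Q.Idx × Q.Idx) × Q.Idx) _ ℂ)
  simp only [one_mul] at yb
  cases s <;> cases t
  · simpa only [Xmat, mul_assoc] using yb
  · simp at hst
  · have h := congrArg swap₁₂ yb
    simp only [map_mul, swap_slot₁₂, swap_slot₁₃, swap_slot₂₃] at h
    have h1 := congrArg slot₁₂ (tw_inv_mul (Q := Q) hq)
    have h2 := congrArg slot₁₂ (tw_mul_inv (Q := Q) hq)
    rw [map_mul, map_one] at h1 h2
    simp only [Xmat]
    generalize slot₁₂ (tw (Rmat Q q⁻¹)) = u' at *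
    generalize slot₁₂ (tw (Rmat Q q)) = u at *
    generalize slot₁₃ (Rmat Q q) = b at *
    generalize slot₂₃ (Rmat Q q) = c at *
    calc u' * b * c = u' * (b * c * u) * u' := by simp only [mul_assoc]; rw [h2, mul_one]
      _ = c * (b * u') := by rw [← h]; simp only [← mul_assoc]; rw [h1, one_mul]
  · have h := congrArg cycl (congrArg cycl yb)
    simp only [map_mul, cycl_slot₁₂, cycl_slot₁₃, cycl_slot₂₃, tw_tw] at h
    simp only [Xmat]
    refine (inv_conj (x := slot₁₃ (tw (Rmat Q q))) (y := slot₁₂ (tw (Rmat Q q)))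
      ?_ ?_ ?_ ?_ (by simpa only [mul_assoc] using h)).symm
    all_goals simp only [← map_mul, tw_inv_mul hq, tw_mul_inv hq, map_one]

theorem Xinv_braid (s t : Sgn) (hst : s = t ∨ s = .neg ∧ t = .pos) :
    slot₂₃ (Rmat Q q) * (slot₁₂ (Xinv Q q s) * slot₁₃ (Xinv Q q t)) =
      slot₁₃ (Xinv Q q t) * slot₁₂ (Xinv Q q s) * slot₂₃ (Rmat Q q) := by
  refine inv_conj (x := slot₁₂ (Xmat Q q s)) (y := slot₁₃ (Xmat Q q t)) ?_ ?_ ?_ ?_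
    (Xmat_braid Q q s t hst).symm
  all_goals simp only [← map_mul, (compat Q q _).mul_inv, (compat Q q _).inv_mul, map_one]

theorem slot₂₃_mul {m : Type*} {n S : Type*} [Fintype n] [DecidableEq n] [Ring S]
    (M : Matrix ((n × n) × n) m S) (X : Matrix (n × n) (n × n) S) (x : m) (k l r : n) :
    (slot₂₃ X * M) ((k, l), r) x =
      (X * (Matrix.of fun (p : _ × _) (x : m) => M ((k, p.1), p.2) x) : Matrix (n × n) m S)
        (l, r) x := by
  simp [Matrix.mul_apply, Fintype.sum_prod_type, slot₂₃_apply]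

/-- The actions of the generators satisfy the relations of `U`. -/
theorem act_braid (s t : Sgn) (hst : s = t ∨ s = .neg ∧ t = .pos) (y : D Q q) :
    (Matrix.of fun (p r : Q.Idx × Q.Idx) => act Q q s (act Q q t y p.2 r.2) p.1 r.1) *
        scal (D Q q) (Rmat Q q) =
      scal (D Q q) (Rmat Q q) *
        Matrix.of fun (p r : Q.Idx × Q.Idx) => act Q q t (act Q q s y p.1 r.1) p.2 r.2 := by
  induction y using D.induction with
  | hs c =>
    have h1 : ∀ s t : Sgn, ∀ p r : Q.Idx × Q.Idx,
        act Q q s (act Q q t (algebraMap ℂ _ c) p.2 r.2) p.1 r.1 =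
          algebraMap ℂ (Matrix (Q.Idx × Q.Idx) (Q.Idx × Q.Idx) (D Q q)) c p r := by
      rintro s t ⟨a, b⟩ ⟨c', e⟩
      simp only [AlgHom.commutes, Matrix.algebraMap_matrix_apply, Prod.mk.injEq, ite_and]
      split_ifs <;> simp_all [Matrix.algebraMap_matrix_apply]
    have h2 : ∀ s t : Sgn, ∀ p r : Q.Idx × Q.Idx,
        act Q q t (act Q q s (algebraMap ℂ _ c) p.1 r.1) p.2 r.2 =
          algebraMap ℂ (Matrix (Q.Idx × Q.Idx) (Q.Idx × Q.Idx) (D Q q)) c p r := by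
      rintro s t ⟨a, b⟩ ⟨c', e⟩
      simp only [AlgHom.commutes, Matrix.algebraMap_matrix_apply, Prod.mk.injEq, ite_and]
      split_ifs <;> simp_all [Matrix.algebraMap_matrix_apply]
    simp only [h1, h2]
    exact Algebra.commutes c (scal (D Q q) (Rmat Q q))
  | ha x y hx hy =>
    have h1 : (Matrix.of fun (p r : Q.Idx × Q.Idx) => act Q q s (act Q q t (x + y) p.2 r.2) p.1 r.1)
        = (Matrix.of fun (p r : Q.Idx × Q.Idx) => act Q q s (act Q q t x p.2 r.2) p.1 r.1) +
          Matrix.of fun (p r : Q.Idx × Q.Idx) => act Q q s (act Q q t y p.2 r.2) p.1 r.1 := by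
      ext p r
      simp
    have h2 : (Matrix.of fun (p r : Q.Idx × Q.Idx) => act Q q t (act Q q s (x + y) p.1 r.1) p.2 r.2)
        = (Matrix.of fun (p r : Q.Idx × Q.Idx) => act Q q t (act Q q s x p.1 r.1) p.2 r.2) +
          Matrix.of fun (p r : Q.Idx × Q.Idx) => act Q q t (act Q q s y p.1 r.1) p.2 r.2 := by
      ext p r
      simp
    rw [h1, h2, add_mul, mul_add, hx, hy]
  | hm x y hx hy =>
    have h1 : (Matrix.of fun (p r : Q.Idx × Q.Idx) => act Q q s (act Q q t (x * y) p.2 r.2) p.1 r.1)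
        = (Matrix.of fun (p r : Q.Idx × Q.Idx) => act Q q s (act Q q t x p.2 r.2) p.1 r.1) *
          Matrix.of fun (p r : Q.Idx × Q.Idx) => act Q q s (act Q q t y p.2 r.2) p.1 r.1 := by
      ext p r
      simp only [Matrix.of_apply, map_mul, Matrix.mul_apply, map_sum, Matrix.sum_apply,
        Fintype.sum_prod_type]
      exact Finset.sum_comm
    have h2 : (Matrix.of fun (p r : Q.Idx × Q.Idx) => act Q q t (act Q q s (x * y) p.1 r.1) p.2 r.2)
        = (Matrix.of fun (p r : Q.Idx × Q.Idx) => act Q q t (act Q q s x p.1 r.1) p.2 r.2) *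
          Matrix.of fun (p r : Q.Idx × Q.Idx) => act Q q t (act Q q s y p.1 r.1) p.2 r.2 := by
      ext p r
      simp only [Matrix.of_apply, map_mul, Matrix.mul_apply, map_sum, Matrix.sum_apply,
        Fintype.sum_prod_type]
    rw [h1, h2, mul_assoc, hy, ← mul_assoc, hx, mul_assoc]
  | hg e y k l =>
    have h1 := congrArg swap₂₃ (actD_actD_Dmat Q q t s e y)
    have h2 := actD_actD_Dmat Q q s t e y
    have c1 := commute_slot₁₂₁ (Dmat Q q e y) (Rmat Q q)
    have b1 := congrArg (scal (D Q q)) (Xmat_braid Q q s t hst)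
    have b2 := congrArg (scal (D Q q)) (Xinv_braid Q q s t hst)
    simp only [map_mul, swap₂₃_slot₁₂, swap₂₃_slot₁₃, ← slot₁₃_slot₁] at h1
    simp only [map_mul, ← slot₁₂_scal, ← slot₁₃_scal, ← slot₂₃_scal] at b1 b2
    have key : swap₂₃ (actD Q q s _ (actD Q q t _ (Dmat Q q e y))) * slot₂₃ (scal _ (Rmat Q q)) =
        slot₂₃ (scal _ (Rmat Q q)) * actD Q q t _ (actD Q q s _ (Dmat Q q e y)) := by
      rw [h1, h2, slot₁₃_slot₁]
      simp only [Commute, SemiconjBy] at c1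
      generalize slot₁₂ (slot₁ (Dmat Q q e y)) = Y at *
      generalize slot₂₃ (scal (D Q q) (Rmat Q q)) = R at *
      generalize slot₁₂ (scal (D Q q) (Xmat Q q s)) = x at *
      generalize slot₁₃ (scal (D Q q) (Xmat Q q t)) = z at *
      generalize slot₁₂ (scal (D Q q) (Xinv Q q s)) = x' at *
      generalize slot₁₃ (scal (D Q q) (Xinv Q q t)) = z' at *
      calc z' * x' * Y * (x * z) * R = z' * x' * Y * (x * z * R) := by simp only [mul_assoc]
        _ = z' * x' * (Y * R) * (z * x) := by rw [b1]; simp only [mul_assoc]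
        _ = z' * x' * R * Y * (z * x) := by rw [c1]; simp only [mul_assoc]
        _ = _ := by rw [← b2]; simp only [mul_assoc]
    ext ⟨a, b⟩ ⟨c, e'⟩
    have h3 := congrFun (congrFun key ((k, a), b)) ((l, c), e')
    rw [mul_slot₂₃, slot₂₃_mul] at h3
    rw [Matrix.mul_apply] at h3 ⊢
    rw [Matrix.mul_apply] at h3 ⊢
    exact h3

end ActU

/-! ### Homomorphisms out of `U` and the smash product -/

section Lifts

variable {V E : Type u} [Fintype V] [DecidableEq V] [LinearOrder E] (Q : DimQuiver V E) (q : ℂ)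
variable {S : Type*} [Ring S] [Algebra ℂ S]

/-- Elements which satisfy the defining relations of `U`, written out in entries, define a
homomorphism on `U`. -/
noncomputable def U.lift (L : Sgn → Q.Idx → Q.Idx → S)
    (rtt : ∀ s t : Sgn, s = t ∨ s = .neg ∧ t = .pos → ∀ a b c e : Q.Idx,
      (if c = e then q else 1) • (L s a c * L t b e) +
        (if below Q c e then q - q⁻¹ else 0) • (L s a e * L t b c) =
      (if a = b then q else 1) • (L t b e * L s a c) +
        (if below Q b a then q - q⁻¹ else 0) • (L t a e * L s b c))
    (tri : ∀ s i j, ¬ triLE Q s i j → L s i j = 0)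
    (diag : ∀ s t i, s ≠ t → L s i i * L t i i = 1) : U Q q →ₐ[ℂ] S :=
  RingQuot.liftAlgHom ℂ ⟨FreeAlgebra.lift ℂ fun x => L x.1 x.2.1 x.2.2, by
    set f := FreeAlgebra.lift ℂ fun x : UGen Q => L x.1 x.2.1 x.2.2 with hf
    have e1 : ∀ s i j, f (freeL Q s i j) = L s i j := by
      intro s i j
      simp [freeL, hf]
    intro x y hxy
    cases hxy with
    | rtt s x y =>
      obtain ⟨a, b⟩ := x
      obtain ⟨c, e⟩ := y
      rw [mul_assoc (scal _ _), mul_scal_Rmat, scal_Rmat_mul]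
      simp only [slot₁_mul_slot₂_apply, slot₂_mul_slot₁_apply, map_add, map_smul, map_mul, e1]
      exact rtt s s (Or.inl rfl) a b c e
    | rtt' x y =>
      obtain ⟨a, b⟩ := x
      obtain ⟨c, e⟩ := y
      rw [mul_assoc (scal _ _), mul_scal_Rmat, scal_Rmat_mul]
      simp only [slot₁_mul_slot₂_apply, slot₂_mul_slot₁_apply, map_add, map_smul, map_mul, e1]
      exact rtt _ _ (Or.inr ⟨rfl, rfl⟩) a b c e
    | upper i j h h' => rw [e1, map_zero, tri _ _ _ (by rintro (h1 | h1); exacts [h h1, h' h1])]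
    | lower i j h h' => rw [e1, map_zero, tri _ _ _ (by rintro (h1 | h1); exacts [h h1, h' h1])]
    | diag i => rw [map_mul, e1, e1, map_one, diag _ _ _ (by simp)]
    | diag' i => rw [map_mul, e1, e1, map_one, diag _ _ _ (by simp)]⟩

theorem U.lift_Lmat (L : Sgn → Q.Idx → Q.Idx → S) (rtt tri diag) (s : Sgn) (i j : Q.Idx) :
    U.lift Q q L rtt tri diag (Lmat Q q s i j) = L s i j := by
  refine (RingQuot.liftAlgHom_mkAlgHom_apply ..).trans ?_
  simp [freeL]

variable [NeZero q]

/-- Homomorphisms on `U` and on `𝒟_q` which are compatible with the action of `U` on `𝒟_q` define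
a homomorphism on the smash product. -/
noncomputable def B.lift (f : U Q q →ₐ[ℂ] S) (g : D Q q →ₐ[ℂ] S)
    (cross : ∀ s i j y, f (Lmat Q q s i j) * g y =
      ∑ k, g (act Q q s y i k) * f (Lmat Q q s k j)) : B Q q →ₐ[ℂ] S :=
  RingQuot.liftAlgHom ℂ ⟨FreeAlgebra.lift ℂ (Sum.elim f g), by
    intro x y hxy
    cases hxy with
    | add_U x y => simp
    | mul_U x y => simp
    | scalar_U c => simp
    | add_D x y => simp
    | mul_D x y => simp
    | scalar_D c => simp
    | cross s i j y => simpa using cross s i j y⟩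

theorem B.lift_ιU (f : U Q q →ₐ[ℂ] S) (g : D Q q →ₐ[ℂ] S) (cross) (x : U Q q) :
    B.lift Q q f g cross (ιU Q q x) = f x := by
  refine (RingQuot.liftAlgHom_mkAlgHom_apply ..).trans ?_
  simp

theorem B.lift_ιD (f : U Q q →ₐ[ℂ] S) (g : D Q q →ₐ[ℂ] S) (cross) (x : D Q q) :
    B.lift Q q f g cross (ιD Q q x) = g x := by
  refine (RingQuot.liftAlgHom_mkAlgHom_apply ..).trans ?_
  simp

variable {Q q} in
theorem B.induction {P : B Q q → Prop} (hs : ∀ c : ℂ, P (algebraMap ℂ _ c))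
    (hU : ∀ s i j, P (ιU Q q (Lmat Q q s i j))) (hD : ∀ y, P (ιD Q q y))
    (hm : ∀ x y, P x → P y → P (x * y)) (ha : ∀ x y, P x → P y → P (x + y)) (x : B Q q) : P x := by
  obtain ⟨x, rfl⟩ : ∃ y, B.mk Q q y = x := RingQuot.mkAlgHom_surjective ℂ _ x
  induction x using FreeAlgebra.induction with
  | grade0 r => rw [AlgHom.commutes]; exact hs r
  | grade1 x =>
    cases x with
    | inl x =>
      change P (ιU Q q x)
      induction x using U.induction with
      | hs c => rw [AlgHom.commutes]; exact hs c
      | hg s i j => exact hU s i j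
      | hm x y hx hy => rw [map_mul]; exact hm _ _ hx hy
      | ha x y hx hy => rw [map_add]; exact ha _ _ hx hy
    | inr x => exact hD x
  | mul a b h1 h2 => rw [map_mul]; exact hm _ _ h1 h2
  | add a b h1 h2 => rw [map_add]; exact ha _ _ h1 h2

end Lifts

/-! ### Stability of the left ideal -/

section Stable

variable {V E : Type u} [Fintype V] [DecidableEq V] [LinearOrder E] (Q : DimQuiver V E) (q : ℂ)
variable [NeZero q]

theorem isLocal_Xmat (s : Sgn) : IsLocal Q (Xmat Q q s) := by
  cases s
  · exact isLocal_R Q q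
  · exact (isLocal_R Q q⁻¹).tw

/-- Conjugation by `X` is trivial on the scalar matrices which commute with it. -/
theorem conjX_scal (s : Sgn) (C : Matrix Q.Idx Q.Idx ℂ)
    (h : Commute (Xmat Q q s) (slot₁ C)) :
    conjX Q q s (D Q q) (scal _ C) = slot₁ (scal _ C) := by
  rw [conjX_apply, slot₁_scal, mul_assoc, ← map_mul, ← h.eq, map_mul, ← mul_assoc, ← map_mul,
    (compat Q q s).inv_mul, map_one, one_mul]

/-- `L^±` acts on the edge matrices by conjugation, as it does on the generators: the matrices on
which this holds form a subring. -/
theorem actD_edgeMat (s : Sgn) (e : E) :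
    actD Q q s _ (edgeMat Q q e) = conjX Q q s (D Q q) (edgeMat Q q e) := by
  have h1 : ∀ y, Dmat Q q e y ∈ (actD Q q s _).eqLocus (conjX Q q s (D Q q)) :=
    fun y => actD_Dmat Q q s e y
  have h2 : ∀ C : Matrix Q.Idx Q.Idx ℂ, Commute (Xmat Q q s) (slot₁ C) →
      scal _ C ∈ (actD Q q s _).eqLocus (conjX Q q s (D Q q)) :=
    fun C h => (actD_scal₁ Q q s C).trans (conjX_scal Q q s C h).symm
  have h3 := h2 _ ((isLocal_Xmat Q q s).comm₁ (Q.α e))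
  have h4 : ∀ (c : ℂ) (Y : Matrix Q.Idx Q.Idx (D Q q)),
      Y ∈ (actD Q q s _).eqLocus (conjX Q q s (D Q q)) →
      c • Y ∈ (actD Q q s _).eqLocus (conjX Q q s (D Q q)) := by
    intro c Y hY
    have : c • Y = scal _ (c • 1) * Y := by
      ext i j
      rw [scal_smul, map_one, smul_mul_assoc, one_mul]
    rw [this]
    refine mul_mem (h2 _ ?_) hY
    have : slot₁ (c • (1 : Matrix Q.Idx Q.Idx ℂ)) = c • 1 := by
      ext ⟨a, b⟩ ⟨a', b'⟩
      simp [slot₁_apply, Matrix.one_apply, ← ite_and, and_comm]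
    rw [this]
    exact (Commute.one_right _).smul_right c
  show edgeMat Q q e ∈ (actD Q q s _).eqLocus (conjX Q q s (D Q q))
  rw [edgeMat]
  split
  · exact add_mem (sub_mem (one_mem _) h3) (mul_mem (mul_mem (mul_mem (h1 _) (h1 _)) (h1 _)) (h1 _))
  · exact mul_mem (add_mem (one_mem _) (h4 _ _ (mul_mem (h1 _) (h1 _)))) (h1 _)

variable [Fintype E]

theorem actD_momentMat (s : Sgn) :
    actD Q q s _ (momentMat Q q) = conjX Q q s (D Q q) (momentMat Q q) := by
  show _ ∈ (actD Q q s _).eqLocus (conjX Q q s (D Q q))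
  refine list_prod_mem fun y hy => ?_
  obtain ⟨e, -, rfl⟩ := List.mem_map.1 hy
  exact actD_edgeMat Q q s e

theorem actD_momentInv (s : Sgn) :
    actD Q q s _ (momentInv Q q) = conjX Q q s (D Q q) (momentInv Q q) := by
  have h1 := congrArg (actD Q q s _) (moment_inv Q q).1
  have h2 := congrArg (conjX Q q s (D Q q)) (moment_inv Q q).2
  rw [map_mul, map_one] at h1 h2
  rw [← actD_momentMat] at h2
  exact (left_inv_eq_right_inv h2 h1).symm

variable (ξ : V → ℂˣ)

theorem J_of_scal {n : Type*} [Fintype n] [DecidableEq n] (A C : Matrix n n ℂ)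
    (Y : Matrix n n (D Q q)) (hY : ∀ i j, Y i j ∈ Jξ Q q ξ) (i j : n) :
    (scal (D Q q) A * Y * scal (D Q q) C : Matrix n n (D Q q)) i j ∈ Jξ Q q ξ := by
  rw [Matrix.mul_apply]
  refine Ideal.sum_mem _ fun k _ => ?_
  rw [Matrix.mul_apply, Finset.sum_mul]
  refine Ideal.sum_mem _ fun l _ => ?_
  simp only [scal, RingHom.mapMatrix_apply, Matrix.map_apply]
  rw [mul_assoc, ← Algebra.commutes]
  exact Ideal.mul_mem_left _ _ (Ideal.mul_mem_left _ _ (hY _ _))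

/-- Let `L^±` act on the matrix `M` by conjugation, and let `M` be congruent modulo the left ideal
to the diagonal matrix `z`, which is constant on the vertices. Then `M` is invariant modulo the
left ideal. -/
theorem act_congr (s : Sgn) (M : Matrix Q.Idx Q.Idx (D Q q))
    (hM : actD Q q s _ M = conjX Q q s (D Q q) M) (z : V → ℂ)
    (h : ∀ i j : Q.Idx, M i j - algebraMap ℂ _ (if i = j then z i.1 else 0) ∈ Jξ Q q ξ)
    (k l i j : Q.Idx) :
    act Q q s (M k l) i j - algebraMap ℂ _ (if i = j then if k = l then z k.1 else 0 else 0) ∈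
      Jξ Q q ξ := by
  have e : (Matrix.diagonal fun i : Q.Idx => z i.1) = ∑ v, z v • proj Q v := by
    ext i j
    simp only [Matrix.sum_apply, Matrix.smul_apply, proj, Matrix.diagonal_apply, smul_eq_mul]
    split <;> simp
  have hc : Commute (Xmat Q q s) (slot₁ (Matrix.diagonal fun i : Q.Idx => z i.1)) := by
    rw [e, map_sum]
    refine Commute.sum_right _ _ _ fun v _ => ?_
    have : slot₁ (z v • proj Q v) = z v • slot₁ (n := Q.Idx) (proj Q v) := by
      ext ⟨a, b⟩ ⟨a', b'⟩
      simp [slot₁_apply]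
    rw [this]
    exact ((isLocal_Xmat Q q s).comm₁ v).smul_right _
  have h1 := J_of_scal Q q ξ (Xinv Q q s) (Xmat Q q s)
    (slot₁ (M - scal _ (Matrix.diagonal fun i : Q.Idx => z i.1))) (by
      rintro ⟨a, b⟩ ⟨a', b'⟩
      rw [slot₁_apply]
      split
      · exact h a a'
      · exact zero_mem _) (k, i) (l, j)
  rw [← conjX_apply, map_sub, conjX_scal Q q s _ hc, ← hM, Matrix.sub_apply, actD_apply,
    slot₁_apply] at h1
  convert h1 using 2
  by_cases hij : i = j
  · simp [hij, scal, Matrix.diagonal_apply]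
  · simp [hij]

/-- The image of the moment map is invariant modulo the left ideal. -/
theorem act_μ (s : Sgn) (x : REA Q q) : ∀ i j : Q.Idx,
    act Q q s (μ Q q x) i j - algebraMap ℂ _ (if i = j then trξ Q q ξ x else 0) ∈ Jξ Q q ξ := by
  induction x using REA.induction with
  | hs c =>
    intro i j
    rw [AlgHom.commutes, AlgHom.commutes, AlgHom.commutes, Matrix.algebraMap_matrix_apply,
      apply_ite (algebraMap ℂ (D Q q)), map_zero]
    simp
  | ha x y hx hy =>
    intro i j
    convert add_mem (hx i j) (hy i j) using 1
    rw [map_add, map_add, map_add, Matrix.add_apply]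
    split <;> simp only [map_add, map_zero] <;> abel
  | hm x y hx hy =>
    intro i j
    have h1 : ∑ k, act Q q s (μ Q q x) i k * (act Q q s (μ Q q y) k j -
        algebraMap ℂ _ (if k = j then trξ Q q ξ y else 0)) ∈ Jξ Q q ξ :=
      Ideal.sum_mem _ fun k _ => Ideal.mul_mem_left _ _ (hy k j)
    have h2 := J_smul Q q ξ (trξ Q q ξ y) (hx i j)
    convert add_mem h1 h2 using 1
    rw [map_mul, map_mul, map_mul, Matrix.mul_apply, Algebra.smul_def, Algebra.commutes]
    simp only [mul_sub, Finset.sum_sub_distrib, apply_ite (algebraMap ℂ (D Q q)), map_zero,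
      mul_ite, mul_zero, Finset.sum_ite_eq', Finset.mem_univ, if_true, sub_mul, ite_mul, zero_mul,
      map_mul]
    abel
  | hg b k l =>
    intro i j
    cases b with
    | l =>
      rw [μ_l, tr_l]
      refine act_congr Q q ξ s _ (actD_momentMat Q q s) (fun v => (ξ v : ℂ)) (fun i j => ?_) k l i j
      have := μ_sub_mem Q q ξ (Tmat Q q .l i j)
      rwa [μ_l, tr_l] at this
    | linv =>
      rw [μ_linv, tr_linv]
      refine act_congr Q q ξ s _ (actD_momentInv Q q s) (fun v => (ξ v : ℂ)⁻¹) (fun i j => ?_)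
        k l i j
      have := μ_sub_mem Q q ξ (Tmat Q q .linv i j)
      rwa [μ_linv, tr_linv] at this

/-- The left ideal `𝒟_q μ(ℐ_ξ)` is a `U`-submodule. -/
theorem act_mem_J (s : Sgn) {y : D Q q} (hy : y ∈ Jξ Q q ξ) : ∀ i j : Q.Idx,
    act Q q s y i j ∈ Jξ Q q ξ := by
  induction hy using Submodule.span_induction with
  | mem y hy =>
    obtain ⟨x, hx, rfl⟩ := hy
    intro i j
    have := act_μ Q q ξ s x i j
    rwa [show trξ Q q ξ x = 0 from hx, ite_self, map_zero, sub_zero] at this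
  | zero => intro i j; rw [map_zero]; exact zero_mem _
  | add x y _ _ hx hy => intro i j; rw [map_add]; exact add_mem (hx i j) (hy i j)
  | smul a x _ hx =>
    intro i j
    rw [smul_eq_mul, map_mul, Matrix.mul_apply]
    exact Ideal.sum_mem _ fun k _ => Ideal.mul_mem_left _ _ (hx k j)

end Stable

/-! ### The cyclic module `𝒟_q / 𝒟_q μ(ℐ_ξ)` -/

section Cyclic

variable {V E : Type u} [Fintype V] [DecidableEq V] [LinearOrder E] (Q : DimQuiver V E) (q : ℂ)
variable [NeZero q] [Fintype E] (ξ : V → ℂˣ)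

/-- The underlying space of the module `𝒟_q / 𝒟_q μ(ℐ_ξ)`. -/
def PD : Type u := D Q q ⧸ (Jξ Q q ξ).restrictScalars ℂ

noncomputable instance : AddCommGroup (PD Q q ξ) :=
  inferInstanceAs (AddCommGroup (D Q q ⧸ (Jξ Q q ξ).restrictScalars ℂ))

/-- The complex vector space structure on `PD`, used to define the operators on it. -/
@[reducible] noncomputable def PD.complexModule : Module ℂ (PD Q q ξ) :=
  inferInstanceAs (Module ℂ (D Q q ⧸ (Jξ Q q ξ).restrictScalars ℂ))

attribute [local instance] PD.complexModule

/-- The class of an element. -/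
noncomputable def PD.mk : D Q q →ₗ[ℂ] PD Q q ξ := Submodule.mkQ _

theorem PD.mk_surjective : Function.Surjective (PD.mk Q q ξ) := Submodule.mkQ_surjective _

theorem PD.mk_eq_zero (y : D Q q) : PD.mk Q q ξ y = 0 ↔ y ∈ Jξ Q q ξ :=
  Submodule.Quotient.mk_eq_zero _

/-- An operator on `𝒟_q` which preserves the left ideal induces one on the quotient. -/
noncomputable def PD.op (T : Module.End ℂ (D Q q)) (h : ∀ y ∈ Jξ Q q ξ, T y ∈ Jξ Q q ξ) :
    Module.End ℂ (PD Q q ξ) := Submodule.mapQ _ _ T h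

variable {Q q ξ} in
theorem PD.ext {S T : Module.End ℂ (PD Q q ξ)}
    (h : ∀ y, S (PD.mk Q q ξ y) = T (PD.mk Q q ξ y)) : S = T := by
  refine LinearMap.ext fun x => ?_
  obtain ⟨y, rfl⟩ := PD.mk_surjective Q q ξ x
  exact h y

/-- The action of `l^{± i}_j` on the quotient. -/
noncomputable def PD.actL (s : Sgn) (i j : Q.Idx) : Module.End ℂ (PD Q q ξ) :=
  PD.op Q q ξ (Matrix.entryLinearMap ℂ (D Q q) i j ∘ₗ (act Q q s).toLinearMap)
    fun _ hy => act_mem_J Q q ξ s hy i j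

theorem PD.actL_mk (s : Sgn) (i j : Q.Idx) (y : D Q q) :
    PD.actL Q q ξ s i j (PD.mk Q q ξ y) = PD.mk Q q ξ (act Q q s y i j) := rfl

/-- The action of `U` on the quotient. -/
noncomputable def PD.actU : U Q q →ₐ[ℂ] Module.End ℂ (PD Q q ξ) :=
  U.lift Q q (PD.actL Q q ξ)
    (fun s t hst a b c e => PD.ext fun y => by
      have h := congrFun (congrFun (act_braid Q q s t hst y) (a, b)) (c, e)
      rw [mul_scal_Rmat, scal_Rmat_mul] at h
      simp only [LinearMap.add_apply, LinearMap.smul_apply, Module.End.mul_apply, PD.actL_mk,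
        ← map_smul, ← map_add]
      exact congrArg _ h)
    (fun s i j h => PD.ext fun y => by
      rw [PD.actL_mk, act_tri Q q s y h, map_zero]
      rfl)
    (fun s t i h => PD.ext fun y => by
      rw [Module.End.mul_apply, PD.actL_mk, PD.actL_mk, act_diag_inv Q q s t h]
      rfl)

/-- The action of `𝒟_q` on the quotient. -/
noncomputable def PD.actD : D Q q →ₐ[ℂ] Module.End ℂ (PD Q q ξ) :=
  AlgHom.ofLinearMap
    { toFun := fun y => PD.op Q q ξ (LinearMap.mulLeft ℂ y) fun _ hx => Ideal.mul_mem_left _ y hx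
      map_add' := fun x y => PD.ext fun z => by
        exact (congrArg (PD.mk Q q ξ) (add_mul x y z)).trans (map_add _ _ _)
      map_smul' := fun c y => PD.ext fun z => by
        exact (congrArg (PD.mk Q q ξ) (smul_mul_assoc c y z)).trans (map_smul _ _ _) }
    (PD.ext fun z => congrArg (PD.mk Q q ξ) (one_mul z))
    (fun x y => PD.ext fun z => congrArg (PD.mk Q q ξ) (mul_assoc x y z))

theorem PD.actD_mk (x y : D Q q) :
    PD.actD Q q ξ x (PD.mk Q q ξ y) = PD.mk Q q ξ (x * y) := rfl

theorem PD.actU_mk (s : Sgn) (i j : Q.Idx) (y : D Q q) :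
    PD.actU Q q ξ (Lmat Q q s i j) (PD.mk Q q ξ y) = PD.mk Q q ξ (act Q q s y i j) := by
  rw [PD.actU, U.lift_Lmat, PD.actL_mk]

/-- The action of the smash product on the quotient. -/
noncomputable def PD.actB : B Q q →ₐ[ℂ] Module.End ℂ (PD Q q ξ) :=
  B.lift Q q (PD.actU Q q ξ) (PD.actD Q q ξ) fun s i j x => PD.ext fun y => by
    rw [Module.End.mul_apply, PD.actD_mk, PD.actU_mk, LinearMap.sum_apply]
    simp only [Module.End.mul_apply, PD.actU_mk, PD.actD_mk]
    rw [map_mul, Matrix.mul_apply, map_sum]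

noncomputable instance : Module (B Q q) (PD Q q ξ) :=
  Module.compHom _ (PD.actB Q q ξ).toRingHom

theorem PD.ιD_smul_mk (x y : D Q q) : ιD Q q x • PD.mk Q q ξ y = PD.mk Q q ξ (x * y) := by
  change PD.actB Q q ξ (ιD Q q x) (PD.mk Q q ξ y) = _
  rw [PD.actB, B.lift_ιD, PD.actD_mk]

theorem PD.ιU_smul_mk (s : Sgn) (i j : Q.Idx) (y : D Q q) :
    ιU Q q (Lmat Q q s i j) • PD.mk Q q ξ y = PD.mk Q q ξ (act Q q s y i j) := by
  change PD.actB Q q ξ (ιU Q q (Lmat Q q s i j)) (PD.mk Q q ξ y) = _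
  rw [PD.actB, B.lift_ιU, PD.actU_mk]

end Cyclic

section CyclicModule

open CategoryTheory
open scoped ModuleCat

variable {V E : Type u} [Fintype V] [DecidableEq V] [LinearOrder E] (Q : DimQuiver V E) (q : ℂ)
variable [NeZero q] [Fintype E] (ξ : V → ℂˣ)

/-- The `𝒟_q`-module `𝒟_q / 𝒟_q μ(ℐ_ξ)` with its action of `U`. -/
noncomputable def cyc : ModuleCat.{u} (B Q q) := ModuleCat.of (B Q q) (PD Q q ξ)

/-- The class of `1`. -/
noncomputable def cycGen : cyc Q q ξ := PD.mk Q q ξ 1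

theorem ιD_smul_cycGen (y : D Q q) : ιD Q q y • cycGen Q q ξ = PD.mk Q q ξ y :=
  (PD.ιD_smul_mk Q q ξ y 1).trans (by rw [mul_one])

theorem exists_ιD_smul_cycGen (p : cyc Q q ξ) : ∃ y, ιD Q q y • cycGen Q q ξ = p := by
  obtain ⟨y, hy⟩ := PD.mk_surjective Q q ξ p
  exact ⟨y, (ιD_smul_cycGen Q q ξ y).trans hy⟩

theorem ιD_smul_cycGen_eq_zero (y : D Q q) : ιD Q q y • cycGen Q q ξ = 0 ↔ y ∈ Jξ Q q ξ := by
  rw [ιD_smul_cycGen]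
  exact PD.mk_eq_zero Q q ξ y

theorem cycGen_mem_invariants : cycGen Q q ξ ∈ invariants (cyc Q q ξ) := by
  intro s i j
  refine (PD.ιU_smul_mk Q q ξ s i j 1).trans ?_
  rw [map_one, Matrix.one_apply]
  split
  · rfl
  · exact map_zero _

variable {Q q ξ}

theorem ιU_smul_ιD_smul {M : ModuleCat.{u} (B Q q)} {m : M} (hm : m ∈ invariants M) (s : Sgn)
    (i j : Q.Idx) (y : D Q q) :
    ιU Q q (Lmat Q q s i j) • ιD Q q y • m = ιD Q q (act Q q s y i j) • m := by
  rw [← mul_smul, smash_cross, Finset.sum_smul]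
  simp only [mul_smul, hm _ _ _, smul_ite, smul_zero, Finset.sum_ite_eq', Finset.mem_univ, if_true]

/-- The submodule generated by an invariant is generated by it over `𝒟_q`, with relations which do
not depend on the module. -/
theorem exists_smul_eq (b : B Q q) (d : D Q q) : ∃ y : D Q q,
    ∀ (M : ModuleCat.{u} (B Q q)), ∀ m ∈ invariants M, b • ιD Q q d • m = ιD Q q y • m := by
  induction b using B.induction generalizing d with
  | hs c =>
    refine ⟨algebraMap ℂ _ c * d, fun M m _ => ?_⟩
    rw [map_mul, AlgHom.commutes, mul_smul]
  | hU s i j => exact ⟨act Q q s d i j, fun M m hm => ιU_smul_ιD_smul hm s i j d⟩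
  | hD x => exact ⟨x * d, fun M m _ => by rw [map_mul, mul_smul]⟩
  | hm x y hx hy =>
    obtain ⟨d', hd'⟩ := hy d
    obtain ⟨d'', hd''⟩ := hx d'
    exact ⟨d'', fun M m hm => by rw [mul_smul, hd' M m hm, hd'' M m hm]⟩
  | ha x y hx hy =>
    obtain ⟨d', hd'⟩ := hx d
    obtain ⟨d'', hd''⟩ := hy d
    exact ⟨d' + d'', fun M m hm => by
      rw [add_smul, hd' M m hm, hd'' M m hm, map_add, add_smul]⟩

/-- The homomorphism out of `𝒟_q / 𝒟_q μ(ℐ_ξ)` which sends the class of `1` to the invariant `m`. -/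
noncomputable def invHom (M : DMod Q q ξ) (m : M.obj) (hm : m ∈ invariants M.obj) :
    cyc Q q ξ →ₗ[B Q q] M.obj :=
  Submodule.liftQ (LinearMap.ker (LinearMap.toSpanSingleton (B Q q) (cyc Q q ξ) (cycGen Q q ξ)))
    (LinearMap.toSpanSingleton (B Q q) M.obj m) (by
      intro b hb
      have hb' : b • cycGen Q q ξ = 0 := hb
      show b • m = 0
      obtain ⟨y, hy⟩ := exists_smul_eq b 1
      have h1 := hy _ _ (cycGen_mem_invariants Q q ξ)
      have h2 := hy _ _ hm
      rw [map_one, one_smul] at h1 h2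
      rw [h1, ιD_smul_cycGen_eq_zero] at hb'
      rw [h2, J_smul_eq_zero M hm hb']) ∘ₗ
  ((LinearMap.toSpanSingleton (B Q q) (cyc Q q ξ) (cycGen Q q ξ)).quotKerEquivOfSurjective
    fun p => (exists_ιD_smul_cycGen Q q ξ p).imp' _ fun _ h => h).symm.toLinearMap

theorem invHom_cycGen (M : DMod Q q ξ) (m : M.obj) (hm : m ∈ invariants M.obj) :
    invHom M m hm (cycGen Q q ξ) = m := by
  have h : ((LinearMap.toSpanSingleton (B Q q) (cyc Q q ξ) (cycGen Q q ξ)).quotKerEquivOfSurjective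
    fun p => (exists_ιD_smul_cycGen Q q ξ p).imp' _ fun _ h => h).symm (cycGen Q q ξ) =
      Submodule.Quotient.mk 1 := by
    rw [LinearEquiv.symm_apply_eq]
    exact (one_smul (B Q q) (cycGen Q q ξ)).symm
  rw [invHom, LinearMap.comp_apply, LinearEquiv.coe_coe, h]
  exact one_smul (B Q q) m

section GoodCyclic

variable (Q q) in
/-- The action of `U` on `𝒟_q` is locally finite. -/
theorem exists_finite_act (y : D Q q) : ∃ W : Submodule ℂ (D Q q), y ∈ W ∧ W.FG ∧
    ∀ s i j, ∀ w ∈ W, act Q q s w i j ∈ W := by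
  induction y using D.induction with
  | hs c =>
    refine ⟨1, Submodule.mem_one.2 ⟨c, rfl⟩,
      (Submodule.one_eq_span (R := ℂ) (A := D Q q)) ▸ Submodule.fg_span_singleton 1, ?_⟩
    intro s i j w hw
    obtain ⟨z, rfl⟩ := Submodule.mem_one.1 hw
    rw [AlgHom.commutes, Matrix.algebraMap_matrix_apply]
    split
    · exact hw
    · exact zero_mem _
  | hg e y k l =>
    set W : Submodule ℂ (D Q q) :=
      Submodule.span ℂ (Set.range fun p : Q.Idx × Q.Idx => Dmat Q q e y p.1 p.2) with hW
    have hmem : ∀ a b, Dmat Q q e y a b ∈ W := fun a b => Submodule.subset_span ⟨(a, b), rfl⟩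
    refine ⟨W, hmem k l, Submodule.fg_span (Set.finite_range _), ?_⟩
    intro s i j w hw
    induction hw using Submodule.span_induction with
    | mem x hx =>
      obtain ⟨⟨a, b⟩, rfl⟩ := hx
      have h0 : ∀ (p : Prop) [Decidable p] (a b), (if p then Dmat Q q e y a b else 0) ∈ W := by
        intro p _ a b
        split
        · exact hmem _ _
        · exact zero_mem _
      cases s
      · rw [act_pos_Dmat]
        refine add_mem ?_ ?_ <;> refine W.smul_mem _ (add_mem ?_ ?_) <;>
          exact W.smul_mem _ (h0 _ _ _)
      · rw [act_neg_Dmat]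
        refine add_mem ?_ ?_ <;> refine W.smul_mem _ (add_mem ?_ ?_) <;>
          exact W.smul_mem _ (h0 _ _ _)
    | zero => rw [map_zero]; exact zero_mem _
    | add a b _ _ ha hb => rw [map_add]; exact add_mem ha hb
    | smul c a _ ha => rw [map_smul]; exact W.smul_mem c ha
  | ha x y hx hy =>
    obtain ⟨W, h1, h2, h3⟩ := hx
    obtain ⟨W', h1', h2', h3'⟩ := hy
    refine ⟨W ⊔ W', Submodule.add_mem_sup h1 h1', h2.sup h2', ?_⟩
    intro s i j w hw
    obtain ⟨a, ha, b, hb, rfl⟩ := Submodule.mem_sup.1 hw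
    rw [map_add]
    exact Submodule.add_mem_sup (h3 s i j a ha) (h3' s i j b hb)
  | hm x y hx hy =>
    obtain ⟨W, h1, h2, h3⟩ := hx
    obtain ⟨W', h1', h2', h3'⟩ := hy
    refine ⟨W * W', Submodule.mul_mem_mul h1 h1', h2.mul h2', ?_⟩
    intro s i j w hw
    induction hw using Submodule.mul_induction_on' with
    | mem_mul_mem a ha b hb =>
      rw [map_mul, Matrix.mul_apply]
      exact sum_mem fun k _ => Submodule.mul_mem_mul (h3 s i k a ha) (h3' s k j b hb)
    | add a _ b _ ha hb => rw [map_add]; exact add_mem ha hb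

variable (Q q) in
/-- The action of `U` on `𝒟_q` is of type one. -/
theorem mem_span_act_diag (y : D Q q) (i : Q.Idx) :
    y ∈ Submodule.span ℂ {x : D Q q | ∃ n : ℤ, act Q q .pos x i i = (q ^ n : ℂ) • x} := by
  have hq := NeZero.ne q
  induction y using D.induction with
  | hs c =>
    refine Submodule.subset_span ⟨0, ?_⟩
    rw [AlgHom.commutes, Matrix.algebraMap_matrix_apply, if_pos rfl, zpow_zero, one_smul]
  | hg e y k l =>
    refine Submodule.subset_span ⟨(if k = i then -1 else 0) + (if l = i then 1 else 0), ?_⟩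
    rw [act_diag_Dmat, zpow_add₀ hq]
    dsimp only
    split_ifs <;> simp
  | ha x y hx hy => exact add_mem hx hy
  | hm x y hx hy =>
    have h := Submodule.mul_mem_mul hx hy
    rw [Submodule.span_mul_span] at h
    refine Submodule.span_mono ?_ h
    rintro _ ⟨a, ⟨n, hn⟩, b, ⟨m, hm⟩, rfl⟩
    refine ⟨n + m, ?_⟩
    dsimp only
    rw [act_diag_mul, hn, hm, smul_mul_smul_comm, zpow_add₀ hq]

/-- The map `y ↦ y m`. -/
noncomputable def orbitMap {M : ModuleCat.{u} (B Q q)} (m : M) : D Q q →ₗ[ℂ] M where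
  toFun y := ιD Q q y • m
  map_add' x y := by rw [map_add, add_smul]
  map_smul' c y := by rw [map_smul, RingHom.id_apply, smul_assoc]

/-- An invariant on which the moment map acts by the character `tr_ξ` generates an equivariant
module. -/
theorem good_of_invariant {M : ModuleCat.{u} (B Q q)} {m : M} (hm : m ∈ invariants M)
    (h0 : ∀ y ∈ Jξ Q q ξ, ιD Q q y • m = 0) (y : D Q q) : Good Q q ξ (ιD Q q y • m) where
  locFinite := by
    obtain ⟨W, h1, h2, h3⟩ := exists_finite_act Q q y
    refine ⟨W.map (orbitMap m), ⟨y, h1, rfl⟩, Module.Finite.iff_fg.2 (h2.map _), ?_⟩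
    intro x w hw
    induction x using U.induction generalizing w with
    | hs c =>
      rw [AlgHom.commutes, algebraMap_smul]
      exact Submodule.smul_mem _ c hw
    | hg s i j =>
      obtain ⟨z, hz, rfl⟩ := hw
      exact ⟨_, h3 s i j z hz, (ιU_smul_ιD_smul hm s i j z).symm⟩
    | hm a b ha hb => rw [map_mul, mul_smul]; exact ha _ (hb _ hw)
    | ha a b ha hb => rw [map_add, add_smul]; exact add_mem (ha _ hw) (hb _ hw)
  typeOne := by
    intro i
    have h := Submodule.mem_map_of_mem (f := orbitMap m) (mem_span_act_diag Q q y i)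
    rw [Submodule.map_span] at h
    refine Submodule.span_mono ?_ h
    rintro _ ⟨x, ⟨n, hn⟩, rfl⟩
    refine ⟨n, ?_⟩
    rw [← (orbitMap m).map_smul, ← hn]
    exact ιU_smul_ιD_smul hm .pos i i x
  equivariant := by
    intro i j
    have h1 : ∀ k l : Q.Idx, ιD Q q (momentMat Q q k l) • m =
        if k = l then (ξ k.1 : ℂ) • m else 0 := by
      intro k l
      have h := h0 _ (μ_sub_mem Q q ξ (Tmat Q q .l k l))
      rw [μ_l, tr_l, map_sub, sub_smul, AlgHom.commutes, algebraMap_smul, sub_eq_zero] at h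
      rw [h, ite_smul, zero_smul]
    have h2 := congrFun (congrFun (moment_act Q q y) i) j
    rw [Matrix.mul_apply, Matrix.mul_apply] at h2
    have h3 := congrArg (fun z => ιD Q q z • m) h2
    simp only [map_sum, map_mul, Finset.sum_smul, mul_smul, h1, smul_ite, smul_zero,
      Finset.sum_ite_eq', Finset.sum_ite_eq, Finset.mem_univ, if_true] at h3
    simp only [ιU_smul_ιD_smul hm]
    rw [h3, smul_comm]
    by_cases hij : triLE Q .pos i j
    · rw [hij.block Q]
    · rw [act_tri Q q .pos y hij, map_zero, zero_smul, smul_zero, smul_zero]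

end GoodCyclic

variable (Q q ξ) in
theorem isEquivariant_cyc : isEquivariant Q q ξ (cyc Q q ξ) := by
  intro p
  obtain ⟨y, rfl⟩ := exists_ιD_smul_cycGen Q q ξ p
  exact good_of_invariant (cycGen_mem_invariants Q q ξ)
    (fun y hy => (ιD_smul_cycGen_eq_zero Q q ξ y).2 hy) y

/-- The invariants of the cyclic module are the classes of the elements which are invariant modulo
the left ideal. -/
theorem ιD_smul_cycGen_mem_invariants (y : D Q q) :
    ιD Q q y • cycGen Q q ξ ∈ invariants (cyc Q q ξ) ↔ y ∈ Nξ Q q ξ := by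
  refine forall_congr' fun s => forall_congr' fun i => forall_congr' fun j => ?_
  rw [ιU_smul_ιD_smul (cycGen_mem_invariants Q q ξ), ← ιD_smul_cycGen_eq_zero, map_sub, sub_smul,
    sub_eq_zero, apply_ite (ιD Q q), map_zero, ite_smul, zero_smul]

end CyclicModule

/-! ### The left adjoint of the functor of invariants -/

section LeftAdjoint

open CategoryTheory CategoryTheory.Limits
open scoped ModuleCat

variable {V E : Type u} [Fintype V] [DecidableEq V] [LinearOrder E] {Q : DimQuiver V E} {q : ℂ}
variable [NeZero q] [Fintype E] {ξ : V → ℂˣ}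

variable (Q q ξ) in
/-- The projection to `𝒜` of the algebra of elements which are invariant modulo the left ideal. -/
noncomputable def Aξ.mk : Nξ Q q ξ →+* Aξ Q q ξ := Ideal.Quotient.mk (Nideal Q q ξ)

theorem Aξ.mk_surjective : Function.Surjective (Aξ.mk Q q ξ) := Ideal.Quotient.mk_surjective

theorem Aξ.mk_eq_zero {b : Nξ Q q ξ} (hb : b.1 ∈ Jξ Q q ξ) : Aξ.mk Q q ξ b = 0 :=
  Ideal.Quotient.eq_zero_iff_mem.2 hb

theorem Aξ.mk_smul_coe (M : DMod Q q ξ) (b : Nξ Q q ξ) (m : (H Q q ξ).obj M) :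
    (Aξ.mk Q q ξ b • m).1 = ιD Q q b.1 • m.1 := rfl

/-- Two homomorphisms from the cyclic module agree if they agree on the generator. -/
theorem cyc_hom_ext {M : ModuleCat.{u} (B Q q)} {f g : cyc Q q ξ →ₗ[B Q q] M}
    (h : f (cycGen Q q ξ) = g (cycGen Q q ξ)) : f = g := by
  refine LinearMap.ext fun p => ?_
  obtain ⟨y, rfl⟩ := exists_ιD_smul_cycGen Q q ξ p
  rw [map_smul, map_smul, h]

variable (Q q ξ) in
/-- The direct sum of copies of the cyclic module `𝒟_q / 𝒟_q μ(ℐ_ξ)`, indexed by `I`. -/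
noncomputable def free (I : Type u) : DMod Q q ξ :=
  ⟨ModuleCat.of (B Q q) (I →₀ cyc Q q ξ), fun g => by
    induction g using Finsupp.induction_linear with
    | zero => exact Good.zero
    | add a b ha hb => exact Good.add ha hb
    | single i p =>
      exact Good.map (M := cyc Q q ξ) (N := ModuleCat.of (B Q q) (I →₀ cyc Q q ξ))
        (Finsupp.lsingle i) (isEquivariant_cyc Q q ξ p)⟩

/-- The generators of a direct sum of copies of the cyclic module, as invariants. -/
noncomputable def freeGen (I : Type u) (i : I) : (H Q q ξ).obj (free Q q ξ I) :=
  ⟨Finsupp.single i (cycGen Q q ξ), fun s k l => by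
    refine (Finsupp.smul_single _ _ _).trans ?_
    rw [cycGen_mem_invariants Q q ξ s k l]
    by_cases h : k = l
    · rw [if_pos h]
      exact (if_pos h).symm
    · rw [if_neg h]
      exact (Finsupp.single_zero _).trans (if_neg h).symm⟩

/-- The homomorphism from `𝒜^I` to the invariants of a direct sum of copies of the cyclic
module. -/
noncomputable def freeInv (I : Type u) :
    (I →₀ Aξ Q q ξ) →ₗ[Aξ Q q ξ] (H Q q ξ).obj (free Q q ξ I) :=
  Finsupp.linearCombination _ (freeGen I)

theorem freeInv_single (I : Type u) (i : I) :
    freeInv (ξ := ξ) (Q := Q) (q := q) I (Finsupp.single i 1) = freeGen I i := by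
  rw [freeInv, Finsupp.linearCombination_single, one_smul]

theorem freeInv_single_coe (I : Type u) (i : I) (b : Nξ Q q ξ) :
    (freeInv I (Finsupp.single i (Aξ.mk Q q ξ b))).1 =
      Finsupp.single i (ιD Q q b.1 • cycGen Q q ξ) := by
  rw [freeInv, Finsupp.linearCombination_single, Aξ.mk_smul_coe]
  exact Finsupp.smul_single _ _ _

/-- The entries of `freeInv I f` are the classes of representatives of the entries of `f`. -/
theorem freeInv_apply (I : Type u) (f : I →₀ Aξ Q q ξ) (i : I) :
    ∃ b : Nξ Q q ξ, Aξ.mk Q q ξ b = f i ∧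
      DFunLike.coe (F := I →₀ cyc Q q ξ) (freeInv I f).1 i = ιD Q q b.1 • cycGen Q q ξ := by
  classical
  induction f using Finsupp.induction_linear with
  | zero =>
    refine ⟨0, map_zero _, ?_⟩
    rw [map_zero]
    exact (show (0 : cyc Q q ξ) = ιD Q q 0 • cycGen Q q ξ by rw [map_zero, zero_smul])
  | add f g hf hg =>
    obtain ⟨b, hb, hb'⟩ := hf
    obtain ⟨c, hc, hc'⟩ := hg
    refine ⟨b + c, ?_, ?_⟩
    · rw [Finsupp.add_apply, ← hb, ← hc, map_add]
    · rw [map_add]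
      refine (congrArg₂ (· + ·) hb' hc').trans ?_
      rw [← add_smul, ← map_add]
      rfl
  | single j a =>
    obtain ⟨b, rfl⟩ := Aξ.mk_surjective a
    by_cases h : j = i
    · subst h
      refine ⟨b, Finsupp.single_eq_same.symm, ?_⟩
      rw [freeInv_single_coe, Finsupp.single_eq_same]
    · refine ⟨0, (map_zero _).trans (Finsupp.single_eq_of_ne' h).symm, ?_⟩
      rw [freeInv_single_coe, Finsupp.single_eq_of_ne' h]
      exact (show (0 : cyc Q q ξ) = ιD Q q 0 • cycGen Q q ξ by rw [map_zero, zero_smul])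

theorem freeInv_injective (I : Type u) :
    Function.Injective (freeInv (ξ := ξ) (Q := Q) (q := q) I) := by
  refine (injective_iff_map_eq_zero _).2 fun f hf => Finsupp.ext fun i => ?_
  obtain ⟨b, hb, hb'⟩ := freeInv_apply I f i
  rw [hf] at hb'
  have h := (ιD_smul_cycGen_eq_zero Q q ξ b.1).1 hb'.symm
  rw [← hb]
  exact Aξ.mk_eq_zero h

theorem freeInv_surjective (I : Type u) :
    Function.Surjective (freeInv (ξ := ξ) (Q := Q) (q := q) I) := by
  classical
  rintro ⟨g, hg⟩
  change I →₀ cyc Q q ξ at g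
  have h1 : ∀ i, g i ∈ invariants (cyc Q q ξ) := by
    intro i s k l
    have h := hg s k l
    by_cases hkl : k = l
    · rw [if_pos hkl]
      exact congrArg (fun x : I →₀ cyc Q q ξ => x i) (h.trans (if_pos hkl))
    · rw [if_neg hkl]
      exact congrArg (fun x : I →₀ cyc Q q ξ => x i) (h.trans (if_neg hkl))
  have h2 : ∀ i, ∃ b : Nξ Q q ξ, ιD Q q b.1 • cycGen Q q ξ = g i := by
    intro i
    obtain ⟨y, hy⟩ := exists_ιD_smul_cycGen Q q ξ (g i)
    have h := h1 i
    rw [← hy, ιD_smul_cycGen_mem_invariants] at h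
    exact ⟨⟨y, h⟩, hy⟩
  choose b hb using h2
  refine ⟨∑ i ∈ g.support, Finsupp.single i (Aξ.mk Q q ξ (b i)),
    Subtype.ext ?_⟩
  rw [map_sum]
  refine (AddSubgroup.val_finsetSum (H := invariants (free Q q ξ I).obj) _ _).trans ?_
  refine (Finset.sum_congr rfl fun i _ => freeInv_single_coe I i (b i)).trans ?_
  simp only [hb]
  exact Finsupp.sum_single g

/-- The homomorphism out of a direct sum of copies of the cyclic module which is given by a family
of invariants. -/
noncomputable def freeHom {I : Type u} (M : DMod Q q ξ) (m : I → (H Q q ξ).obj M) :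
    free Q q ξ I ⟶ M :=
  ObjectProperty.homMk (ModuleCat.ofHom
    (Finsupp.lsum ℕ fun i => invHom M (m i).1 (m i).2 : (I →₀ cyc Q q ξ) →ₗ[B Q q] M.obj))

theorem freeHom_gen {I : Type u} (M : DMod Q q ξ) (m : I → (H Q q ξ).obj M) (i : I) :
    (H Q q ξ).map (freeHom M m) (freeGen I i) = m i := by
  refine Subtype.ext ((Finsupp.lsum_single ℕ _ _ _).trans ?_)
  exact invHom_cycGen M _ _

theorem freeHom_inv {I : Type u} (M : DMod Q q ξ) (m : I → (H Q q ξ).obj M)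
    (f : I →₀ Aξ Q q ξ) :
    (H Q q ξ).map (freeHom M m) (freeInv I f) = Finsupp.linearCombination _ m f := by
  refine (Finsupp.apply_linearCombination _ ((H Q q ξ).map (freeHom M m)).hom _ _).trans ?_
  congr 1
  congr 1
  funext i
  exact freeHom_gen M m i

variable (N : ModuleCat.{u} (Aξ Q q ξ))

/-- The relations between the elements of `N`: the kernel of the canonical surjection from the free
module on the set `N`. -/
noncomputable def relN : Submodule (Aξ Q q ξ) (N →₀ Aξ Q q ξ) :=
  LinearMap.ker (Finsupp.linearCombination (Aξ Q q ξ) (id : N → N))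

/-- The submodule generated by the images of the relations of `N`. -/
noncomputable def relD : Submodule (B Q q) (N →₀ cyc Q q ξ) :=
  Submodule.span (B Q q) {g | ∃ f ∈ relN N, g = (freeInv N f).1}

/-- The value on `N` of the left adjoint of `ℍ`: the equivariant module with one generator for each
element of `N` and with the relations of `N`. -/
noncomputable def leftObj : DMod Q q ξ :=
  ⟨ModuleCat.of (B Q q) ((N →₀ cyc Q q ξ) ⧸ relD N), fun x => by
    obtain ⟨g, rfl⟩ := Submodule.mkQ_surjective _ x
    exact Good.map (M := (free Q q ξ N).obj)
      (N := ModuleCat.of (B Q q) ((N →₀ cyc Q q ξ) ⧸ relD N)) (relD N).mkQ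
      ((free Q q ξ N).property g)⟩

/-- The projection from the direct sum of copies of the cyclic module. -/
noncomputable def leftProj : free Q q ξ N ⟶ leftObj N :=
  ObjectProperty.homMk (ModuleCat.ofHom (relD N).mkQ)

theorem leftProj_surjective : Function.Surjective (leftProj N).hom :=
  Submodule.mkQ_surjective _

theorem leftProj_inv_eq_zero {f : N →₀ Aξ Q q ξ} (hf : f ∈ relN N) :
    (H Q q ξ).map (leftProj N) (freeInv N f) = 0 :=
  Subtype.ext ((Submodule.Quotient.mk_eq_zero _).2 (Submodule.subset_span ⟨f, hf, rfl⟩))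

theorem leftProj_inv_congr {f g : N →₀ Aξ Q q ξ}
    (h : Finsupp.linearCombination (Aξ Q q ξ) (id : N → N) f =
      Finsupp.linearCombination (Aξ Q q ξ) (id : N → N) g) :
    (H Q q ξ).map (leftProj N) (freeInv N f) = (H Q q ξ).map (leftProj N) (freeInv N g) := by
  have h1 : f - g ∈ relN N := by
    rw [relN, LinearMap.mem_ker, map_sub, h, sub_self]
  have h2 := leftProj_inv_eq_zero N h1
  rwa [map_sub, map_sub, sub_eq_zero] at h2

/-- The unit of the adjunction, which sends `n` to the generator with index `n`. -/
noncomputable def unitMap : N ⟶ (H Q q ξ).obj (leftObj N) :=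
  ModuleCat.ofHom
    { toFun := fun n => (H Q q ξ).map (leftProj N) (freeInv N (Finsupp.single n 1))
      map_add' := fun n n' => by
        refine (leftProj_inv_congr N (g := Finsupp.single n 1 + Finsupp.single n' 1)
          (by simp [Finsupp.linearCombination_single])).trans ?_
        rw [map_add]
        exact map_add ((H Q q ξ).map (leftProj N)).hom _ _
      map_smul' := fun a n => by
        refine (leftProj_inv_congr N (g := a • Finsupp.single n 1)
          (by simp [Finsupp.linearCombination_single])).trans ?_
        rw [map_smul]
        exact map_smul ((H Q q ξ).map (leftProj N)).hom _ _ }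

theorem unitMap_apply (n : N) :
    unitMap N n = (H Q q ξ).map (leftProj N) (freeInv N (Finsupp.single n 1)) := rfl

theorem unitMap_linearCombination (f : N →₀ Aξ Q q ξ) :
    unitMap N (Finsupp.linearCombination (Aξ Q q ξ) (id : N → N) f) =
      (H Q q ξ).map (leftProj N) (freeInv N f) :=
  leftProj_inv_congr N (by rw [Finsupp.linearCombination_single, one_smul, id])

theorem unitMap_bijective (hq : ∀ n : ℕ, 0 < n → q ^ n ≠ 1) :
    Function.Bijective (unitMap N) := by
  constructor
  · refine (injective_iff_map_eq_zero (unitMap N).hom).2 fun n hn => ?_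
    -- The relations are the image of a direct sum `free R` of cyclic modules, so that invariants
    -- among them come from invariants of `free R`, that is, from relations over `𝒜`.
    set T := freeHom (free Q q ξ N) fun r : relN N => freeInv N r.1 with hT
    have hrange : relD N ≤ LinearMap.range T.hom.hom := by
      refine Submodule.span_le.2 ?_
      rintro _ ⟨f, hf, rfl⟩
      exact ⟨(freeGen _ ⟨f, hf⟩).1,
        congrArg Subtype.val (freeHom_gen (free Q q ξ N) (fun r : relN N => freeInv N r.1) ⟨f, hf⟩)⟩
    have h1 : (freeInv N (Finsupp.single n (1 : Aξ Q q ξ))).1 ∈ relD N :=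
      (Submodule.Quotient.mk_eq_zero _).1 (congrArg Subtype.val hn)
    obtain ⟨g, hg⟩ := hrange h1
    obtain ⟨g', hg', hgg⟩ := exists_mem_invariants hq (free Q q ξ (relN N)).property T.hom.hom g
      (hg ▸ (freeInv N (Finsupp.single n 1)).2)
    obtain ⟨h, hh⟩ := freeInv_surjective (relN N) ⟨g', hg'⟩
    have h2 : (H Q q ξ).map T (freeInv (relN N) h) =
        freeInv N (Finsupp.single n (1 : Aξ Q q ξ)) := by
      rw [hh]
      exact Subtype.ext (hgg.trans hg)
    rw [hT, freeHom_inv] at h2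
    have h3 : freeInv N (Finsupp.linearCombination (Aξ Q q ξ) (fun r : relN N => r.1) h) =
        freeInv N (Finsupp.single n (1 : Aξ Q q ξ)) := by
      rw [← h2, Finsupp.apply_linearCombination]
      rfl
    have h4 := freeInv_injective N h3
    have h5 : Finsupp.single n (1 : Aξ Q q ξ) ∈ relN N := by
      rw [← h4, Finsupp.linearCombination_apply]
      exact Submodule.sum_mem _ fun r _ => Submodule.smul_mem _ _ r.2
    rw [relN, LinearMap.mem_ker, Finsupp.linearCombination_single, one_smul] at h5
    exact h5
  · rintro ⟨x, hx⟩
    obtain ⟨g, rfl⟩ := leftProj_surjective N x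
    obtain ⟨g', hg', hgg⟩ :=
      exists_mem_invariants hq (free Q q ξ N).property (leftProj N).hom.hom g hx
    obtain ⟨f, hf⟩ := freeInv_surjective N ⟨g', hg'⟩
    refine ⟨Finsupp.linearCombination (Aξ Q q ξ) (id : N → N) f, ?_⟩
    rw [unitMap_linearCombination, hf]
    exact Subtype.ext hgg

/-- The universal property of `leftObj`. -/
theorem unitMap_comp_bijective (M : DMod Q q ξ) :
    Function.Bijective fun f : leftObj N ⟶ M => unitMap N ≫ (H Q q ξ).map f := by
  constructor
  · intro f g h
    refine ObjectProperty.hom_ext _ (ModuleCat.hom_ext ?_)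
    refine Submodule.linearMap_qext _ (Finsupp.lhom_ext' fun n => cyc_hom_ext ?_)
    have h1 := congrArg Subtype.val (congrArg (fun t : N ⟶ (H Q q ξ).obj M => t n) h)
    dsimp only at h1
    rw [ModuleCat.comp_apply, ModuleCat.comp_apply, unitMap_apply, freeInv_single] at h1
    exact h1
  · intro φ
    have hφ : relD N ≤ LinearMap.ker (freeHom M fun n => φ n).hom.hom := by
      refine Submodule.span_le.2 ?_
      rintro _ ⟨f, hf, rfl⟩
      have h := freeHom_inv M (fun n => φ n) f
      have h1 : Finsupp.linearCombination (Aξ Q q ξ) (fun n => φ n) f = 0 := by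
        have h2 := Finsupp.apply_linearCombination (Aξ Q q ξ) φ.hom (id : N → N) f
        rw [show Finsupp.linearCombination (Aξ Q q ξ) (id : N → N) f = 0 from hf, map_zero] at h2
        exact h2.symm
      rw [h1] at h
      exact congrArg Subtype.val h
    refine ⟨ObjectProperty.homMk (ModuleCat.ofHom ((relD N).liftQ _ hφ)), ?_⟩
    refine ModuleCat.hom_ext (LinearMap.ext fun n => ?_)
    show (H Q q ξ).map _ (unitMap N n) = φ n
    rw [unitMap_apply, freeInv_single]
    exact (Subtype.ext rfl : _ = (H Q q ξ).map (freeHom M fun n => φ n) (freeGen N n)).trans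
      (freeHom_gen M _ n)

variable (Q q ξ)

/-- The bijection of the adjunction, which is composition with the unit. -/
noncomputable def leftEquiv (N : ModuleCat.{u} (Aξ Q q ξ)) (M : DMod Q q ξ) :
    (leftObj N ⟶ M) ≃ (N ⟶ (H Q q ξ).obj M) :=
  Equiv.ofBijective _ (unitMap_comp_bijective N M)

theorem leftEquiv_comp (N : ModuleCat.{u} (Aξ Q q ξ)) (M M' : DMod Q q ξ) (g : M ⟶ M')
    (h : leftObj N ⟶ M) :
    leftEquiv Q q ξ N M' (h ≫ g) = leftEquiv Q q ξ N M h ≫ (H Q q ξ).map g := by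
  show unitMap N ≫ (H Q q ξ).map (h ≫ g) = (unitMap N ≫ (H Q q ξ).map h) ≫ (H Q q ξ).map g
  rw [Functor.map_comp, Category.assoc]

/-- The left adjoint of `ℍ`. -/
noncomputable def leftFunctor : ModuleCat.{u} (Aξ Q q ξ) ⥤ DMod Q q ξ :=
  Adjunction.leftAdjointOfEquiv (leftEquiv Q q ξ) (leftEquiv_comp Q q ξ)

/-- The adjunction between `leftFunctor` and `ℍ`. -/
noncomputable def leftAdj : leftFunctor Q q ξ ⊣ H Q q ξ :=
  Adjunction.adjunctionOfEquivLeft (leftEquiv Q q ξ) (leftEquiv_comp Q q ξ)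

theorem isIso_unitMap (hq : ∀ n : ℕ, 0 < n → q ^ n ≠ 1) (N : ModuleCat.{u} (Aξ Q q ξ)) :
    IsIso (unitMap N) :=
  (ConcreteCategory.isIso_iff_bijective _).2 (unitMap_bijective N hq)

theorem isIso_unit (hq : ∀ n : ℕ, 0 < n → q ^ n ≠ 1) : IsIso (leftAdj Q q ξ).unit := by
  rw [NatTrans.isIso_iff_isIso_app]
  intro N
  have h : (leftAdj Q q ξ).unit.app N = unitMap N := by
    have h1 : (leftAdj Q q ξ).unit.app N = leftEquiv Q q ξ N (leftObj N) (𝟙 _) := by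
      simp [leftAdj, leftFunctor]
    rw [h1]
    show unitMap N ≫ (H Q q ξ).map (𝟙 _) = _
    rw [CategoryTheory.Functor.map_id, Category.comp_id]
  rw [h]
  exact isIso_unitMap Q q ξ hq N

instance : (H Q q ξ).Additive where
  map_add := rfl

/-- `ℍ` preserves epimorphisms, since these are surjective and invariants lift. -/
theorem H_preservesEpi (hq : ∀ n : ℕ, 0 < n → q ^ n ≠ 1) {M N : DMod Q q ξ} (f : M ⟶ N) [Epi f] :
    Epi ((H Q q ξ).map f) := by
  have := (isEquivariant Q q ξ).preservesEpimorphisms_ι_of_isNormalMonoCategory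
  have h : Function.Surjective f.hom :=
    (ModuleCat.epi_iff_surjective _).1 (inferInstanceAs (Epi ((isEquivariant Q q ξ).ι.map f)))
  refine (ModuleCat.epi_iff_surjective _).2 ?_
  rintro ⟨n, hn⟩
  obtain ⟨m, rfl⟩ := h n
  obtain ⟨m', hm', h'⟩ := exists_mem_invariants hq M.property f.hom.hom m hn
  exact ⟨⟨m', hm'⟩, Subtype.ext h'⟩

theorem H_exact (hq : ∀ n : ℕ, 0 < n → q ^ n ≠ 1) :
    PreservesFiniteLimits (H Q q ξ) ∧ PreservesFiniteColimits (H Q q ξ) := by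
  have h1 : PreservesLimitsOfSize.{0, 0} (H Q q ξ) := (leftAdj Q q ξ).rightAdjoint_preservesLimits
  have h2 : PreservesFiniteLimits (H Q q ξ) := PreservesLimitsOfSize.preservesFiniteLimits _
  refine ((H Q q ξ).exact_tfae.out 0 3).1 fun S hS => ?_
  have h3 : ∀ S : ShortComplex (DMod Q q ξ), S.ShortExact →
      (S.map (H Q q ξ)).Exact ∧ Mono ((H Q q ξ).map S.f) :=
    ((H Q q ξ).preservesFiniteLimits_tfae.out 0 3).2 h2
  have := hS.epi_g
  exact { exact := (h3 S hS).1, mono_f := (h3 S hS).2, epi_g := H_preservesEpi Q q ξ hq S.g }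

theorem kernel_iff (M : DMod Q q ξ) : (H Q q ξ).kernel M ↔ aspherical Q q ξ M := by
  show IsZero ((H Q q ξ).obj M) ↔ _
  rw [ModuleCat.isZero_iff_subsingleton]
  constructor
  · intro h m hm
    exact congrArg Subtype.val (h.elim (⟨m, hm⟩ : (H Q q ξ).obj M) 0)
  · intro h
    refine ⟨fun a b => Subtype.ext ?_⟩
    rw [h a.1 a.2, h b.1 b.2]

theorem H_isLocalization (hq : ∀ n : ℕ, 0 < n → q ^ n ≠ 1) [(H Q q ξ).kernel.IsSerreClass] :
    (H Q q ξ).IsLocalization (H Q q ξ).kernel.isoModSerre := by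
  obtain ⟨_, _⟩ := H_exact Q q ξ hq
  -- The left adjoint is fully faithful.
  have := isIso_unit Q q ξ hq
  have hF := (leftAdj Q q ξ).fullyFaithfulLOfIsIsoUnit
  have := hF.full
  have := hF.faithful
  rw [Abelian.isoModSerre_kernel_eq_inverseImage_isomorphisms]
  exact (leftAdj Q q ξ).isLocalization_rightAdjoint'

end LeftAdjoint
end QuiverQuantization

open CategoryTheory QuiverQuantization

theorem mainTheorem9 {V E : Type u} [Fintype V] [DecidableEq V] [Fintype E] [LinearOrder E]
    (Q : DimQuiver V E) (q : ℂ) [NeZero q] (hq : ∀ n : ℕ, 0 < n → q ^ n ≠ 1) (ξ : V → ℂˣ) :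
    (H Q q ξ).EssSurj ∧
    (∀ M : DMod Q q ξ, (H Q q ξ).kernel M ↔ aspherical Q q ξ M) ∧
    ∃ (_ : (H Q q ξ).kernel.IsSerreClass)
      (h : (H Q q ξ).kernel.isoModSerre.IsInvertedBy (H Q q ξ)),
      (Localization.Construction.lift (H Q q ξ) h).IsEquivalence := by
  obtain ⟨_, _⟩ := H_exact Q q ξ hq
  have := H_isLocalization Q q ξ hq
  refine ⟨⟨fun N => ?_⟩, kernel_iff Q q ξ, inferInstance, Localization.inverts _ _,
    Functor.IsLocalization.isEquivalence⟩
  have := isIso_unitMap Q q ξ hq N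
  exact ⟨leftObj N, ⟨(asIso (unitMap N)).symm⟩⟩
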